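/- **Definitions.** For elements $a,b\ge 0$ of a C*-algebra $A$, write $a\lesssim b$ if there is a sequence $(x_n)$ in $A$ with $\lim_n\|x_n^*bx_n-a\|=0$. For an integer $k\ge 0$ let $\mathcal I_k$ be the class of quotients of C*-algebras of the form $QM_r(C(Y))Q$, where $r\ge 1$, $Y$ is a finite CW complex of covering dimension at most $k$ and $Q\in M_r(C(Y))$ is a projection; every such quotient has the form $PM_r(C(X))P$ with $X\subseteq Y$ compact and $P=Q|_X$. A unital simple C*-algebra $A$ belongs to $\mathcal C_1$ if for every finite subset $\mathcal F\subset A$, all $\epsilon,\eta>0$ and every nonzero $a\in A_+$ there are a projection $p\in A$, an integer $d\ge 0$ and a C*-subalgebra $C\subseteq A$ with unit $1_C=p$ and $C\cong PM_r(C(X))P\in\mathcal I_d$ for some nonempty $X$, such that 1. $\|px-xp\|<\epsilon$ for all $x\in\mathcal F$; 2. $\operatorname{dist}(pxp,C)<\epsilon$ for all $x\in\mathcal F$; 3. $\operatorname{rank}P(\xi)>0$ and $\dfrac{d+1}{\operatorname{rank}P(\xi)}<\dfrac{\eta}{2}$ for all $\xi\in X$; 4. $1-p\lesssim a$. Let $T(A)$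 be the set of tracial states of $A$. For $\epsilon>0$ let $f_\epsilon:[0,\infty)\to[0,1]$ be the continuous function that is $0$ on $[0,\epsilon/2]$, $1$ on $[\epsilon,\infty)$ and linear on $[\epsilon/2,\epsilon]$. For $a\in A_+$ and $\tau\in T(A)$ put $d_\tau(a)=\lim_{\epsilon\to0^+}\tau(f_\epsilon(a))$. **Theorem.** Every unital simple C*-algebra $A$ in $\mathcal C_1$ has strict comparison for positive elements: if $a,b\in A_+$ and $d_\tau(a)<d_\tau(b)$ for all $\tau\in T(A)$, then $a\lesssim b$. -/

import Mathlib

open Filter Topology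
open scoped ComplexOrder

/-! ### Comparison of positive elements -/

/-- Cuntz subequivalence `a ≲ b` (used for positive `a`, `b`): there is a sequence `xₙ` in `A` with
`‖xₙ* b xₙ - a‖ → 0`. -/
def CuntzLE {A : Type*} [CStarAlgebra A] (a b : A) : Prop :=
  ∃ x : ℕ → A, Tendsto (fun n => ‖star (x n) * b * x n - a‖) atTop (𝓝 0)

/-- The tracial state space `T(A)`: positive linear functionals `τ` on `A` with `τ 1 = 1` and
`τ (x y) = τ (y x)`. -/
def tracialStates (A : Type*) [CStarAlgebra A] [PartialOrder A] [StarOrderedRing A] :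
    Set (A →ₚ[ℂ] ℂ) :=
  {τ | τ 1 = 1 ∧ ∀ x y : A, τ (x * y) = τ (y * x)}

/-- The function that vanishes on `[0, ε/2]`, equals `1` on `[ε, ∞)`, and is linear on
`[ε/2, ε]`. -/
noncomputable def cutoff (ε t : ℝ) : ℝ := max 0 (min 1 (2 * t / ε - 1))

/-- The dimension function `d_τ(a) = lim_{ε → 0+} τ(f_ε(a))`, where `f_ε` is `cutoff ε`. The limit
exists for every positive `a` and every tracial state `τ`: see `tendsto_dimFun`. -/
noncomputable def dimFun {A : Type*} [CStarAlgebra A] [PartialOrder A] [StarOrderedRing A]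
    (τ : A →ₚ[ℂ] ℂ) (a : A) : ℝ :=
  limUnder (𝓝[>] (0 : ℝ)) (fun ε : ℝ => (τ (cfc (cutoff ε) a)).re)

lemma cutoff_continuous (ε : ℝ) : Continuous (cutoff ε) := by
  unfold cutoff; fun_prop

lemma cutoff_le_one (ε t : ℝ) : cutoff ε t ≤ 1 :=
  max_le zero_le_one (min_le_left _ _)

lemma cutoff_anti {ε δ t : ℝ} (hε : 0 < ε) (h : ε ≤ δ) (ht : 0 ≤ t) :
    cutoff δ t ≤ cutoff ε t := by
  unfold cutoff
  gcongr

lemma tendsto_dimFun {A : Type*} [CStarAlgebra A] [PartialOrder A] [StarOrderedRing A]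
    {τ : A →ₚ[ℂ] ℂ} (hτ : τ ∈ tracialStates A) {a : A} (ha : 0 ≤ a) :
    Tendsto (fun ε : ℝ => (τ (cfc (cutoff ε) a)).re) (𝓝[>] 0) (𝓝 (dimFun τ a)) := by
  have hanti : AntitoneOn (fun ε : ℝ => (τ (cfc (cutoff ε) a)).re) (Set.Ioi 0) := by
    intro ε hε δ _ hεδ
    have h : cfc (cutoff δ) a ≤ cfc (cutoff ε) a :=
      cfc_mono (fun t ht => cutoff_anti hε hεδ (spectrum_nonneg_of_nonneg ha ht))
        (cutoff_continuous δ).continuousOn (cutoff_continuous ε).continuousOn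
    exact (Complex.le_def.1 (OrderHomClass.mono τ h)).1
  have hbdd : BddAbove ((fun ε : ℝ => (τ (cfc (cutoff ε) a)).re) '' Set.Ioi 0) := by
    refine ⟨1, ?_⟩
    rintro _ ⟨ε, _, rfl⟩
    have h : cfc (cutoff ε) a ≤ 1 := cfc_le_one _ _ (fun t _ => cutoff_le_one ε t)
    have h' := (Complex.le_def.1 (OrderHomClass.mono τ h)).1
    rw [hτ.1] at h'
    simpa using h'
  exact tendsto_nhds_limUnder ⟨_, hanti.tendsto_nhdsGT hbdd⟩

/-! ### Simple C*-algebras -/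

/-- A C*-algebra is simple if it is nonzero and has no closed two-sided ideals other than `0` and
itself. -/
def IsSimpleCStar (A : Type*) [CStarAlgebra A] : Prop :=
  Nontrivial A ∧ ∀ I : TwoSidedIdeal A, IsClosed (I : Set A) → I = ⊥ ∨ I = ⊤

/-! ### The algebras `P M_r(C(X)) P` -/

/-- The covering dimension of `Y` is at most `k`: every finite open cover has an open refinement
(which may be taken to be a shrinking with the same index set) such that every point lies in at
most `k + 1` of its members. -/
def CoveringDimLE (Y : Type*) [TopologicalSpace Y] (k : ℕ) : Prop :=
  ∀ (n : ℕ) (U : Fin n → Set Y), (∀ i, IsOpen (U i)) → (⋃ i, U i) = Set.univ →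
    ∃ V : Fin n → Set Y, (∀ i, IsOpen (V i)) ∧ (∀ i, V i ⊆ U i) ∧ (⋃ i, V i) = Set.univ ∧
      ∀ y : Y, {i | y ∈ V i}.ncard ≤ k + 1

/-- The corner `P M P` as a star subalgebra of `M = M_r(C(X))`, for a projection `P`. Here
`M_r(C(X))` is written as the algebra `C(X, M_r(ℂ))` of continuous matrix-valued functions. -/
def cornerAlg {X : Type*} [TopologicalSpace X] {r : ℕ} (P : C(X, Matrix (Fin r) (Fin r) ℂ))
    (hP : IsStarProjection P) :
    NonUnitalStarSubalgebra ℂ C(X, Matrix (Fin r) (Fin r) ℂ) where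
  carrier := {m | P * m = m ∧ m * P = m}
  zero_mem' := by simp
  add_mem' := by
    rintro a b ⟨h1, h2⟩ ⟨h3, h4⟩
    exact ⟨by rw [mul_add, h1, h3], by rw [add_mul, h2, h4]⟩
  mul_mem' := by
    rintro a b ⟨h1, h2⟩ ⟨h3, h4⟩
    exact ⟨by rw [← mul_assoc, h1], by rw [mul_assoc, h4]⟩
  smul_mem' := by
    rintro c a ⟨h1, h2⟩
    exact ⟨by rw [mul_smul_comm, h1], by rw [smul_mul_assoc, h2]⟩
  star_mem' := by
    rintro a ⟨h1, h2⟩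
    have hs : star P = P := hP.isSelfAdjoint
    have e1 := congrArg star h2
    have e2 := congrArg star h1
    rw [star_mul, hs] at e1 e2
    exact ⟨e1, e2⟩

/-- The data presenting a C*-algebra in the class `I_k` of quotients of algebras `Q M_r(C(Y)) Q`,
with `Y` a finite CW complex of covering dimension at most `k`: such a quotient is
`P M_r(C(X)) P`, with `X` a compact subset of `Y` and `P` the restriction to `X` of the projection
`Q`. -/
structure IkModel (k : ℕ) where
  Y : Type
  [top : TopologicalSpace Y]
  [t2 : T2Space Y]
  [cw : Topology.CWComplex (Set.univ : Set Y)]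
  finite : Topology.RelCWComplex.Finite (Set.univ : Set Y)
  dim_le : CoveringDimLE Y k
  r : ℕ
  one_le_r : 1 ≤ r
  Q : C(Y, Matrix (Fin r) (Fin r) ℂ)
  isStarProjection_Q : IsStarProjection Q
  X : Set Y
  isCompact_X : IsCompact X

namespace IkModel

attribute [instance] IkModel.top IkModel.t2 IkModel.cw

variable {k : ℕ} (M : IkModel k)

/-- The projection `P = Q|_X` in `M_r(C(X))`. -/
noncomputable def P : C(M.X, Matrix (Fin M.r) (Fin M.r) ℂ) := M.Q.restrict M.X

lemma isStarProjection_P : IsStarProjection M.P := by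
  have h := M.isStarProjection_Q
  constructor
  · have h1 : M.Q * M.Q = M.Q := h.isIdempotentElem
    change M.P * M.P = M.P
    ext1 x
    exact congrArg (fun q : C(M.Y, Matrix (Fin M.r) (Fin M.r) ℂ) => q x.1) h1
  · have h1 : star M.Q = M.Q := h.isSelfAdjoint
    change star M.P = M.P
    ext1 x
    exact congrArg (fun q : C(M.Y, Matrix (Fin M.r) (Fin M.r) ℂ) => q x.1) h1

/-- The algebra `P M_r(C(X)) P`. -/
noncomputable def alg : NonUnitalStarSubalgebra ℂ C(M.X, Matrix (Fin M.r) (Fin M.r) ℂ) :=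
  cornerAlg M.P M.isStarProjection_P

/-- The rank of the matrix `P(x)`. -/
noncomputable def rankAt (x : M.X) : ℕ := (M.P x).rank

end IkModel

/-! ### The classes `C_g` and `C_1` -/

/-- The approximation property that defines membership of a unital simple C*-algebra `A` in `C_g`.
For all finite `F ⊆ A`, `ε, η > 0` and nonzero `a ≥ 0` there are a projection `p ∈ A` and a
C*-subalgebra `C` with unit `p` which is isomorphic to `P M_r(C(X)) P` in `I_d` for some `d`,
with `X` nonempty, and has the four listed properties. -/
def InClassC (g : ℕ → ℕ) (A : Type*) [CStarAlgebra A] [PartialOrder A] [StarOrderedRing A] :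
    Prop :=
  ∀ (F : Finset A) (ε η : ℝ) (a : A), 0 < ε → 0 < η → 0 ≤ a → a ≠ 0 →
    ∃ (p : A) (C : NonUnitalStarSubalgebra ℂ A) (d : ℕ) (M : IkModel d),
      IsStarProjection p ∧
      IsClosed (C : Set A) ∧ p ∈ C ∧ (∀ c ∈ C, p * c = c ∧ c * p = c) ∧
      M.X.Nonempty ∧ Nonempty (C ≃⋆ₐ[ℂ] M.alg) ∧
      (∀ x ∈ F, ‖p * x - x * p‖ < ε) ∧
      (∀ x ∈ F, Metric.infDist (p * x * p) (C : Set A) < ε) ∧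
      (∀ x : M.X, 0 < M.rankAt x ∧ ((d : ℝ) + 1) / M.rankAt x < η / ((g d : ℝ) + 1)) ∧
      CuntzLE (1 - p) a

/-- The approximation property that defines membership of a unital simple C*-algebra in `C_1`. -/
def InClassC1 (A : Type*) [CStarAlgebra A] [PartialOrder A] [StarOrderedRing A] : Prop :=
  InClassC (fun _ => 1) A

/-! ### Cuntz comparison in a C*-algebra -/

section Cuntz

variable {A : Type*} [CStarAlgebra A]

/-! It is enough to compare `(a - ε/2)_+` with `b`. Put `g = f_{ε/2}(a)`. Each `τ(g)` is at most
`d_τ(a)`, hence smaller than `d_τ(b)`, and compactness of the trace space gives one `δ` and one `η`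
with `τ(g) + 2η ≤ τ(f_δ(b))` for all `τ` (`exists_uniform_gap`). Simplicity and the large ranks in
the class then allow a small piece to be reserved inside `b`: there are orthogonal `b₁` and `c ≠ 0`
with `b₁ + c ≲ b` and `τ(f_δ(b)) ≤ τ(b₁) + η` (`exists_orthogonal_splitting`).

Now take `p` and `C ≅ P M_r(C(X)) P` with `1 - p ≲ c`. The normalized traces at the points of `X`
are traces on `C`; for a good enough approximation they must respect the gap between `g` and `b₁`,
since otherwise an ultralimit of them would be a tracial state of `A` violating it
(`exists_trace_transfer`). So at every point the compression of `b₁` exceeds that of `g` in trace by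
a fixed fraction of `rank P`, while `d + 1` is a small fraction of `rank P`.

Over a space of dimension `d` such a gap yields a comparison (`exists_pointwise_comparison`). Up to
small errors, one needs a continuous field of matrices that is injective from a spectral subspace of
`g` into one of `b₁`. A convex combination `∑ tᵢ Wᵢ`, with `t` a partition of unity having at most
`d + 1` nonzero entries at each point, works for generic `W`: the bad `W` are locally Lipschitz
images of sets of too small real dimension, so Hausdorff dimension excludes them
(`exists_generic_family`).

Back in `A` this gives `g ≤ y* b₁ y + (1 - p) + (1 - η/64)`. Hence `(g - (1 - η/64))_+ ≲ b₁ + c ≲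
b`, by Rørdam's lemma and orthogonality (`exists_cuntzLE_of_trace_gap`). The cut so close to `1` is
harmless, because `f_{ε/2}` equals `1` on the spectrum that matters for `(a - ε/2)_+`
(`cuntzLE_cfc_cutoff`); and it is what bounds the dimension of the spectral subspace of `g` by
little more than its trace. -/

theorem cuntzLE_iff {a b : A} : CuntzLE a b ↔ ∀ ε > 0, ∃ x : A, ‖star x * b * x - a‖ < ε := by
  constructor
  · rintro ⟨x, hx⟩ ε hε
    obtain ⟨n, hn⟩ := ((tendsto_order.1 hx).2 ε hε).exists
    exact ⟨x n, hn⟩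
  · intro h
    choose x hx using fun n : ℕ => h (1 / ((n : ℝ) + 1)) (by positivity)
    refine ⟨x, squeeze_zero (fun n => norm_nonneg _) (fun n => (hx n).le) ?_⟩
    exact tendsto_one_div_add_atTop_nhds_zero_nat

theorem CuntzLE.trans {a b c : A} (hab : CuntzLE a b) (hbc : CuntzLE b c) : CuntzLE a c := by
  rw [cuntzLE_iff] at *
  intro ε hε
  obtain ⟨x, hx⟩ := hab (ε / 2) (by positivity)
  obtain ⟨y, hy⟩ := hbc (ε / 2 / (‖x‖ * ‖x‖ + 1)) (by positivity)
  refine ⟨y * x, ?_⟩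
  have e : star (y * x) * c * (y * x) - a
      = star x * (star y * c * y - b) * x + (star x * b * x - a) := by
    rw [star_mul]; noncomm_ring
  rw [e]
  have h1 : ‖star x * (star y * c * y - b) * x‖ ≤ ε / 2 := by
    calc _ ≤ ‖x‖ * ‖star y * c * y - b‖ * ‖x‖ := by
          refine (norm_mul_le _ _).trans ?_
          gcongr
          refine (norm_mul_le _ _).trans ?_
          rw [norm_star]
      _ = ‖star y * c * y - b‖ * (‖x‖ * ‖x‖) := by ring
      _ ≤ (ε / 2 / (‖x‖ * ‖x‖ + 1)) * (‖x‖ * ‖x‖ + 1) := by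
          gcongr
          linarith
      _ = ε / 2 := by field_simp
  calc _ ≤ _ := norm_add_le _ _
    _ < ε := by linarith

theorem cuntzLE_of_forall_approx {a b : A}
    (h : ∀ ε > 0, ∃ s, ‖s - a‖ < ε ∧ CuntzLE s b) : CuntzLE a b := by
  rw [cuntzLE_iff]
  intro ε hε
  obtain ⟨s, hs, hsb⟩ := h (ε / 2) (by positivity)
  obtain ⟨x, hx⟩ := cuntzLE_iff.1 hsb (ε / 2) (by positivity)
  refine ⟨x, ?_⟩
  calc _ = ‖(star x * b * x - s) + (s - a)‖ := by congr 1; abel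
    _ ≤ _ := norm_add_le _ _
    _ < ε := by linarith

theorem cuntzLE_conj (x b : A) : CuntzLE (star x * b * x) b :=
  ⟨fun _ => x, by simp⟩

theorem cuntzLE_smul (b : A) {K : ℝ} (hK : 0 ≤ K) : CuntzLE (K • b) b := by
  have h := cuntzLE_conj (algebraMap ℝ A (Real.sqrt K)) b
  have e : star (algebraMap ℝ A (Real.sqrt K)) * b * algebraMap ℝ A (Real.sqrt K) = K • b := by
    rw [← algebraMap_star_comm, star_trivial, ← Algebra.smul_def, ← Algebra.commutes,
      ← Algebra.smul_def, smul_smul, Real.mul_self_sqrt hK]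
  rwa [e] at h

variable [PartialOrder A] [StarOrderedRing A]

theorem cuntzLE_of_le {a b : A} (ha : 0 ≤ a) (hab : a ≤ b) : CuntzLE a b := by
  have hb : 0 ≤ b := ha.trans hab
  rw [cuntzLE_iff]
  intro ε hε
  obtain ⟨δ, hδ, hδε⟩ : ∃ δ : ℝ, 0 < δ ∧ δ < ε := ⟨ε / 2, by positivity, by linarith⟩
  -- With `s = (b + δ)^{-1/2}` the witness is `x = s a^{1/2}`: then `x* b x - a = -δ x* x`, and
  -- `‖x‖² = ‖s a s‖ ≤ ‖s b s‖ ≤ 1`. The `max` only makes `f` continuous on all of `ℝ`.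
  set f : ℝ → ℝ := fun t => (Real.sqrt (max t 0 + δ))⁻¹ with hf
  have hpos : ∀ t : ℝ, 0 < max t 0 + δ := fun t => by positivity
  have hfc : Continuous f := by
    rw [hf]
    exact Continuous.inv₀ (by fun_prop) (fun t => (Real.sqrt_pos.2 (hpos t)).ne')
  set s : A := cfc f b with hs
  set k : A := CFC.sqrt a with hk
  have hss : star s = s := (cfc_predicate (R := ℝ) f b : IsSelfAdjoint _)
  have hks : star k = k := (IsSelfAdjoint.of_nonneg (CFC.sqrt_nonneg a))
  have hkk : k * k = a := CFC.sqrt_mul_sqrt_self a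
  have hff : ∀ t ∈ spectrum ℝ b, f t * f t = (t + δ)⁻¹ := by
    intro t ht
    have ht0 : 0 ≤ t := spectrum_nonneg_of_nonneg hb ht
    simp only [hf]
    rw [← mul_inv, Real.mul_self_sqrt (hpos t).le, max_eq_left ht0]
  have e1 : s * b * s = cfc (fun t => f t * t * f t) b := by
    rw [cfc_mul (fun t => f t * t) f b (by fun_prop) (by fun_prop),
      cfc_mul f (fun t => t) b (by fun_prop) (by fun_prop), cfc_id' ℝ b]
  have e2 : 1 - s * b * s = δ • (s * s) := by
    rw [e1, hs, ← cfc_mul f f b (by fun_prop) (by fun_prop),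
      ← cfc_smul δ _ b (by fun_prop), ← cfc_one ℝ b, ← cfc_sub _ _ b (by fun_prop) (by fun_prop)]
    refine cfc_congr fun t ht => ?_
    have ht0 : 0 ≤ t := spectrum_nonneg_of_nonneg hb ht
    have h1 := hff t ht
    have : f t * t * f t = t * (t + δ)⁻¹ := by rw [← h1]; ring
    simp only [this, h1, Pi.one_apply, smul_eq_mul]
    have : t + δ ≠ 0 := by positivity
    field_simp
    ring
  have e3 : ‖s * b * s‖ ≤ 1 := by
    rw [e1]
    refine norm_cfc_le zero_le_one fun t ht => ?_
    have ht0 : 0 ≤ t := spectrum_nonneg_of_nonneg hb ht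
    have h1 := hff t ht
    have : f t * t * f t = t * (t + δ)⁻¹ := by rw [← h1]; ring
    rw [this, Real.norm_of_nonneg (by positivity), ← div_eq_mul_inv]
    exact (div_le_one (by positivity)).2 (by linarith)
  have e4 : ‖s * a * s‖ ≤ 1 := by
    refine le_trans (CStarAlgebra.norm_le_norm_of_nonneg_of_le ?_ ?_) e3
    · have := star_left_conjugate_nonneg ha s
      rwa [hss] at this
    · have := star_left_conjugate_le_conjugate hab s
      rwa [hss] at this
  have e5 : ‖s * k‖ * ‖s * k‖ ≤ 1 := by
    have : s * a * s = (s * k) * star (s * k) := by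
      rw [star_mul, hss, hks, ← hkk]; noncomm_ring
    rwa [this, CStarRing.norm_self_mul_star] at e4
  refine ⟨s * k, ?_⟩
  have e6 : star (s * k) * b * (s * k) - a = -(δ • (star (s * k) * (s * k))) := by
    have : star (s * k) * (s * k) = k * (s * s) * k := by
      rw [star_mul, hss, hks]; noncomm_ring
    rw [this, ← smul_mul_assoc, ← mul_smul_comm, ← e2, star_mul, hss, hks, ← hkk]
    noncomm_ring
  rw [e6, norm_neg, norm_smul, CStarRing.norm_star_mul_self, Real.norm_of_nonneg hδ.le]
  nlinarith

theorem cuntzLE_of_le_smul {a b : A} (ha : 0 ≤ a) {K : ℝ} (hK : 0 ≤ K) (hab : a ≤ K • b) :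
    CuntzLE a b :=
  (cuntzLE_of_le ha hab).trans (cuntzLE_smul b hK)

/-- A one-sided form of Rørdam's lemma. -/
theorem cuntzLE_of_le_add {g u : A} (hg : 0 ≤ g) {ε : ℝ} (h : g ≤ u + algebraMap ℝ A ε) :
    CuntzLE (cfc (fun t : ℝ => max (t - ε) 0) g) u := by
  refine cuntzLE_of_forall_approx fun γ hγ => ?_
  -- `E` vanishes up to `ε` and is `1` from `ε + γ/2` on, so `e (g - ε) e` is positive, lies within
  -- `γ/2` of `(g - ε)_+`, and is dominated by `e u e`.
  set E : ℝ → ℝ := fun t => min 1 (max (t - ε) 0 / (γ / 2)) with hE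
  have hEc : Continuous E := by rw [hE]; fun_prop
  have hE0 : ∀ t, 0 ≤ E t := fun t => le_min zero_le_one (by positivity)
  have hEle : ∀ t, t ≤ ε → E t = 0 := fun t ht => by
    simp only [hE]
    rw [max_eq_right (by linarith)]; simp
  set e : A := cfc E g
  have hes : star e = e := (cfc_predicate (R := ℝ) E g : IsSelfAdjoint _)
  have e1 : e * (g - algebraMap ℝ A ε) * e = cfc (fun t => E t * (t - ε) * E t) g := by
    rw [cfc_mul (fun t => E t * (t - ε)) E g (by fun_prop) (by fun_prop),
      cfc_mul E (fun t => t - ε) g (by fun_prop) (by fun_prop),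
      cfc_sub (fun t => t) (fun _ => ε) g (by fun_prop) (by fun_prop), cfc_id' ℝ g,
      cfc_const ε g]
  have e2 : 0 ≤ e * (g - algebraMap ℝ A ε) * e := by
    rw [e1]
    refine cfc_nonneg fun t _ => ?_
    rcases le_total t ε with ht | ht
    · rw [hEle t ht]; simp
    · exact mul_nonneg (mul_nonneg (hE0 t) (by linarith)) (hE0 t)
  refine ⟨e * (g - algebraMap ℝ A ε) * e, ?_, ?_⟩
  · rw [e1, ← cfc_sub _ _ g (by fun_prop) (by fun_prop)]
    refine lt_of_le_of_lt (norm_cfc_le (c := γ / 2) (by positivity) fun t _ => ?_) (by linarith)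
    rcases le_total t ε with ht | ht
    · rw [hEle t ht, max_eq_right (by linarith)]; simp; positivity
    · rw [max_eq_left (by linarith)]
      have hEt : E t = min 1 ((t - ε) / (γ / 2)) := by
        simp only [hE]; rw [max_eq_left (by linarith)]
      rcases le_total (t - ε) (γ / 2) with h' | h'
      · have h1 : E t ≤ 1 := min_le_left _ _
        have h0 := hE0 t
        rw [Real.norm_eq_abs, abs_le]
        have h2 : E t * E t ≤ 1 := by nlinarith
        have h3 : 0 ≤ E t * E t := by positivity
        have h4 : 0 ≤ t - ε := by linarith
        constructor
        · nlinarith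
        · nlinarith
      · have : E t = 1 := by
          rw [hEt]; exact min_eq_left ((one_le_div (by positivity)).2 h')
        rw [this]; simp; positivity
  · refine (cuntzLE_of_le e2 ?_).trans (cuntzLE_conj e u)
    have := star_left_conjugate_le_conjugate (sub_le_iff_le_add.2 h) e
    rwa [hes] at this ⊢

theorem norm_cfc_max_sub_sub_le {b : A} (hb : 0 ≤ b) {γ : ℝ} (hγ : 0 ≤ γ) :
    ‖cfc (fun t : ℝ => max (t - γ) 0) b - b‖ ≤ γ := by
  nth_rw 2 [← cfc_id' ℝ b]
  rw [← cfc_sub _ _ b (by fun_prop) (by fun_prop)]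
  refine norm_cfc_le hγ fun t ht => ?_
  have ht0 : 0 ≤ t := spectrum_nonneg_of_nonneg hb ht
  rw [Real.norm_eq_abs, abs_le]
  rcases le_total (t - γ) 0 with h | h
  · rw [max_eq_right h]; constructor <;> linarith
  · rw [max_eq_left h]; constructor <;> linarith

/-- Away from zero `t` is bounded by a multiple of `t³`. The cube appears in sums of orthogonal
elements, where a factor `b` is added to the witness on either side of `b`. -/
theorem cuntzLE_cube {b : A} (hb : 0 ≤ b) : CuntzLE b (b * b * b) := by
  refine cuntzLE_of_forall_approx fun γ hγ => ?_
  refine ⟨cfc (fun t : ℝ => max (t - γ / 2) 0) b,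
    lt_of_le_of_lt (norm_cfc_max_sub_sub_le hb (by positivity)) (by linarith), ?_⟩
  refine cuntzLE_of_le_smul (K := 1 / (γ / 2) ^ 2) (cfc_nonneg fun t _ => le_max_right _ _)
    (by positivity) ?_
  have e : b * b * b = cfc (fun t : ℝ => t * t * t) b := by
    rw [cfc_mul (fun t : ℝ => t * t) (fun t => t) b (by fun_prop) (by fun_prop),
      cfc_mul (fun t : ℝ => t) (fun t => t) b (by fun_prop) (by fun_prop), cfc_id' ℝ b]
  rw [e, ← cfc_smul _ _ b (by fun_prop)]
  refine cfc_mono (fun t ht => ?_) (by fun_prop) (by fun_prop)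
  have ht0 : 0 ≤ t := spectrum_nonneg_of_nonneg hb ht
  rw [smul_eq_mul]
  refine max_le ?_ (by positivity)
  rw [one_div, inv_mul_eq_div, le_div_iff₀ (by positivity)]
  rcases le_total t (γ / 2) with h | h
  · have : (t - γ / 2) * (γ / 2) ^ 2 ≤ 0 := mul_nonpos_of_nonpos_of_nonneg (by linarith) (by positivity)
    have : 0 ≤ t * t * t := by positivity
    linarith
  · have : (γ / 2) ^ 2 ≤ t * t := by nlinarith
    nlinarith [mul_le_mul_of_nonneg_left this ht0, sq_nonneg (γ / 2)]

/-- The witness `b v + c w` has no cross terms, since `b c = c b = 0`; what remains is `v* b³ v + w*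
c³ w`. No orthogonality of `s₁` and `s₂` is needed. -/
theorem CuntzLE.add_of_mul_eq_zero {s₁ s₂ b c : A} (hb : 0 ≤ b) (hc : 0 ≤ c) (hbc : b * c = 0)
    (h₁ : CuntzLE s₁ b) (h₂ : CuntzLE s₂ c) : CuntzLE (s₁ + s₂) (b + c) := by
  have hbs : star b = b := IsSelfAdjoint.of_nonneg hb
  have hcs : star c = c := IsSelfAdjoint.of_nonneg hc
  have hcb : c * b = 0 := by
    have := congrArg star hbc
    rwa [star_mul, hbs, hcs, star_zero] at this
  rw [cuntzLE_iff]
  intro ε hε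
  obtain ⟨v, hv⟩ := cuntzLE_iff.1 (h₁.trans (cuntzLE_cube hb)) (ε / 2) (by positivity)
  obtain ⟨w, hw⟩ := cuntzLE_iff.1 (h₂.trans (cuntzLE_cube hc)) (ε / 2) (by positivity)
  refine ⟨b * v + c * w, ?_⟩
  have e : star (b * v + c * w) * (b + c) * (b * v + c * w) - (s₁ + s₂)
      = (star v * (b * b * b) * v - s₁) + (star w * (c * c * c) * w - s₂) := by
    have e1 : (b + c) * (b * v + c * w) = b * b * v + c * c * w := by
      simp only [add_mul, mul_add, ← mul_assoc, hbc, hcb]; simp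
    have e2 : star (b * v + c * w) = star v * b + star w * c := by
      rw [star_add, star_mul, star_mul, hbs, hcs]
    have e3 : (star v * b + star w * c) * (b * b * v + c * c * w)
        = star v * (b * b * b) * v + star w * (c * c * c) * w := by
      have x1 : star v * b * (c * c * w) = star v * (b * c) * (c * w) := by noncomm_ring
      have x2 : star w * c * (b * b * v) = star w * (c * b) * (b * v) := by noncomm_ring
      rw [add_mul, mul_add, mul_add, x1, x2, hbc, hcb]
      noncomm_ring
    rw [mul_assoc, e1, e2, e3]
    abel
  rw [e]
  calc _ ≤ _ := norm_add_le _ _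
    _ < ε := by linarith

end Cuntz

/-! ### Limits of approximate traces, and transfer of trace gaps to subalgebras -/

section Traces

set_option linter.unusedSectionVars false

variable {A : Type*} [CStarAlgebra A] [PartialOrder A] [StarOrderedRing A]

/-- Bounded scalars converge along an ultrafilter, and the pointwise limit inherits exactly what
holds asymptotically. This serves as weak* compactness, also for functions that are neither linear
nor positive. -/
theorem exists_tracialState_of_ultrafilter {ι : Type*} (l : Ultrafilter ι) (ψ : ι → A → ℂ)
    (hbd : ∀ x, ∃ M : ℝ, ∀ᶠ i in l, ‖ψ i x‖ ≤ M)
    (hadd : ∀ x y, Tendsto (fun i => ψ i (x + y) - ψ i x - ψ i y) l (𝓝 0))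
    (hsmul : ∀ (c : ℂ) x, Tendsto (fun i => ψ i (c • x) - c * ψ i x) l (𝓝 0))
    (hone : Tendsto (fun i => ψ i 1) l (𝓝 1))
    (htr : ∀ x y, Tendsto (fun i => ψ i (x * y) - ψ i (y * x)) l (𝓝 0))
    (hpos : ∀ x, 0 ≤ x → ∃ s : ι → ℂ, (∀ᶠ i in l, 0 ≤ s i) ∧
      Tendsto (fun i => ψ i x - s i) l (𝓝 0)) :
    ∃ τ ∈ tracialStates A, ∀ x, Tendsto (fun i => ψ i x) l (𝓝 (τ x)) := by
  have hlim : ∀ x, ∃ t : ℂ, Tendsto (fun i => ψ i x) l (𝓝 t) := by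
    intro x
    obtain ⟨M, hM⟩ := hbd x
    obtain ⟨t, -, ht⟩ := (isCompact_closedBall (0 : ℂ) M).ultrafilter_le_nhds'
      (l.map (fun i => ψ i x)) (by
        rw [Ultrafilter.mem_map]
        filter_upwards [hM] with i hi
        simpa using hi)
    exact ⟨t, ht⟩
  choose T hT using hlim
  let L : A →ₗ[ℂ] ℂ :=
    { toFun := T
      map_add' := fun x y => by
        have h := tendsto_nhds_unique (((hT (x + y)).sub (hT x)).sub (hT y)) (hadd x y)
        linear_combination h
      map_smul' := fun c x => by
        have h := tendsto_nhds_unique ((hT (c • x)).sub ((hT x).const_mul c)) (hsmul c x)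
        simp only [RingHom.id_apply, smul_eq_mul]
        linear_combination h }
  refine ⟨PositiveLinearMap.mk₀ L ?_, ⟨?_, ?_⟩, hT⟩
  · intro x hx
    obtain ⟨s, hs0, hs⟩ := hpos x hx
    have h : Tendsto s l (𝓝 (T x)) := by
      have := (hT x).sub hs
      simpa using this
    exact isClosed_Ici.mem_of_tendsto h hs0
  · exact tendsto_nhds_unique (hT 1) hone
  · intro x y
    have h := tendsto_nhds_unique ((hT (x * y)).sub (hT (y * x))) (htr x y)
    exact sub_eq_zero.1 h

theorem re_mono {τ : A →ₚ[ℂ] ℂ} {x y : A} (h : x ≤ y) : (τ x).re ≤ (τ y).re :=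
  (Complex.le_def.1 (OrderHomClass.mono τ h)).1

theorem re_nonneg {τ : A →ₚ[ℂ] ℂ} {x : A} (h : 0 ≤ x) : 0 ≤ (τ x).re := by
  simpa using re_mono (τ := τ) h

theorem norm_apply_le_of_isSelfAdjoint {τ : A →ₚ[ℂ] ℂ} (hτ : τ 1 = 1) {x : A}
    (hx : IsSelfAdjoint x) : ‖τ x‖ ≤ ‖x‖ := by
  have h1 := re_mono (τ := τ) hx.le_algebraMap_norm_self
  have h2 := re_mono (τ := τ) hx.neg_algebraMap_norm_le_self
  have h3 := (Complex.le_def.1 (OrderHomClass.mono τ hx.le_algebraMap_norm_self)).2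
  have e : (τ (algebraMap ℝ A ‖x‖)) = (‖x‖ : ℂ) := by
    have : algebraMap ℝ A ‖x‖ = ((‖x‖ : ℝ) : ℂ) • (1 : A) := by
      rw [Algebra.algebraMap_eq_smul_one]; simp
    rw [this, map_smul, hτ]; simp
  rw [map_neg] at h2
  rw [e] at h1 h2 h3
  simp only [Complex.neg_re, Complex.ofReal_re, Complex.ofReal_im] at h1 h2 h3
  have : τ x = ((τ x).re : ℂ) := Complex.ext (by simp) (by simpa using h3)
  rw [this, Complex.norm_real, Real.norm_eq_abs, abs_le]
  exact ⟨h2, h1⟩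

theorem norm_tracialState_apply_le {τ : A →ₚ[ℂ] ℂ} (hτ : τ 1 = 1) (x : A) :
    ‖τ x‖ ≤ 2 * ‖x‖ := by
  have e := realPart_add_I_smul_imaginaryPart x
  rw [← e, map_add, map_smul]
  refine (norm_add_le _ _).trans ?_
  rw [norm_smul, Complex.norm_I, one_mul]
  rw [e]
  have h1 := norm_apply_le_of_isSelfAdjoint hτ (x := (realPart x : A)) (realPart x).2
  have h2 := norm_apply_le_of_isSelfAdjoint hτ (x := (imaginaryPart x : A)) (imaginaryPart x).2
  have h3 : ‖(realPart x : A)‖ ≤ ‖x‖ := realPart.norm_le x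
  have h4 : ‖(imaginaryPart x : A)‖ ≤ ‖x‖ := imaginaryPart.norm_le x
  linarith

theorem re_cfc_cutoff_le_dimFun {τ : A →ₚ[ℂ] ℂ} (hτ : τ ∈ tracialStates A) {a : A} (ha : 0 ≤ a)
    {ε : ℝ} (hε : 0 < ε) : (τ (cfc (cutoff ε) a)).re ≤ dimFun τ a := by
  refine ge_of_tendsto (tendsto_dimFun hτ ha) ?_
  filter_upwards [Ioc_mem_nhdsGT hε] with δ hδ
  refine re_mono (cfc_mono (fun t ht => ?_) (cutoff_continuous ε).continuousOn
    (cutoff_continuous δ).continuousOn)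
  exact cutoff_anti hδ.1 hδ.2 (spectrum_nonneg_of_nonneg ha ht)

/-- If the bound fails for `δ = η = 1/(n+1)` at `τₙ`, a limit `σ` of the `τₙ` satisfies `σ(f_ε(b)) ≤
σ(g)` for each fixed `ε`, because `f_ε ≤ f_δ` once `δ ≤ ε`. Then `d_σ(b) ≤ σ(g)`. -/
theorem exists_uniform_gap {g b : A} (hb : 0 ≤ b)
    (h : ∀ τ ∈ tracialStates A, (τ g).re < dimFun τ b) :
    ∃ δ > 0, ∃ η > 0, ∀ τ ∈ tracialStates A, (τ g).re + η ≤ (τ (cfc (cutoff δ) b)).re := by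
  by_contra! hcon
  choose τ hτ hlt using fun n : ℕ => hcon (1 / ((n : ℝ) + 1)) (by positivity)
    (1 / ((n : ℝ) + 1)) (by positivity)
  set l : Ultrafilter ℕ := Ultrafilter.of atTop
  have hl : (l : Filter ℕ) ≤ atTop := Ultrafilter.of_le _
  obtain ⟨σ, hσ, hlim⟩ := exists_tracialState_of_ultrafilter l (fun n x => τ n x)
    (fun x => ⟨2 * ‖x‖, .of_forall fun n => norm_tracialState_apply_le (hτ n).1 x⟩)
    (fun x y => by simp) (fun c x => by simp)
    (by simp [(hτ _).1])
    (fun x y => by simp [(hτ _).2 x y])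
    (fun x hx => ⟨fun n => τ n x, .of_forall fun n => by
      have := OrderHomClass.mono (τ n) hx
      simpa using this, by simp⟩)
  have hre : ∀ x, Tendsto (fun n => (τ n x).re) l (𝓝 (σ x).re) := fun x =>
    (Complex.continuous_re.tendsto _).comp (hlim x)
  refine absurd (h σ hσ) (not_lt.2 ?_)
  refine le_of_tendsto (tendsto_dimFun hσ hb) ?_
  filter_upwards [self_mem_nhdsWithin] with ε hε
  have h1 : Tendsto (fun n : ℕ => (1 : ℝ) / ((n : ℝ) + 1)) l (𝓝 0) :=
    tendsto_one_div_add_atTop_nhds_zero_nat.mono_left hl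
  have h2 : Tendsto (fun n => (τ n g).re + 1 / ((n : ℝ) + 1)) l (𝓝 (σ g).re) := by
    simpa using (hre g).add h1
  refine le_of_tendsto_of_tendsto (hre _) h2 ?_
  filter_upwards [(tendsto_order.1 h1).2 ε hε] with n hn
  refine le_trans (re_mono (cfc_mono (fun t ht => ?_) (cutoff_continuous ε).continuousOn
    (cutoff_continuous _).continuousOn)) (hlt n).le
  exact cutoff_anti (by positivity) hn.le (spectrum_nonneg_of_nonneg hb ht)

/-- `ψ` behaves on the finite set `F` like a tracial state, up to a multiple of `θ`. -/
structure IsApproxTrace (F : Finset A) (θ : ℝ) (ψ : A → ℂ) : Prop where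
  norm_le : ∀ x ∈ F, ‖ψ x‖ ≤ 2 * (‖x‖ + 1)
  add : ∀ x ∈ F, ∀ y ∈ F, x + y ∈ F → ‖ψ (x + y) - ψ x - ψ y‖ ≤ 6 * θ
  smul : ∀ (c : ℂ), ∀ x ∈ F, c • x ∈ F → ‖ψ (c • x) - c * ψ x‖ ≤ 2 * (1 + ‖c‖) * θ
  one : 1 ∈ F → ‖ψ 1 - 1‖ ≤ 2 * θ
  comm : ∀ x ∈ F, ∀ y ∈ F, x * y ∈ F → y * x ∈ F →
    ‖ψ (x * y) - ψ (y * x)‖ ≤ (8 + 6 * ‖x‖ + 6 * ‖y‖) * θ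
  pos : ∀ z ∈ F, z * z ∈ F → IsSelfAdjoint z →
    ∃ s : ℂ, 0 ≤ s ∧ ‖ψ (z * z) - s‖ ≤ (8 + 10 * ‖z‖) * θ

/-- Along pairs `(F, n)` every given element is eventually in `F`, and the error `1/(n+1)` tends to
zero. -/
theorem exists_tracialState_of_isApproxTrace (ψ : Finset A × ℕ → A → ℂ)
    (h : ∀ i, IsApproxTrace i.1 (1 / ((i.2 : ℝ) + 1)) (ψ i)) :
    ∃ l : Ultrafilter (Finset A × ℕ), (l : Filter (Finset A × ℕ)) ≤ atTop ∧
      ∃ τ ∈ tracialStates A, ∀ x, Tendsto (fun i => ψ i x) l (𝓝 (τ x)) := by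
  classical
  set l : Ultrafilter (Finset A × ℕ) := Ultrafilter.of atTop
  have hl : (l : Filter (Finset A × ℕ)) ≤ atTop := Ultrafilter.of_le _
  have hmem : ∀ x : A, ∀ᶠ i : Finset A × ℕ in l, x ∈ i.1 := fun x => by
    refine hl ((eventually_ge_atTop (({x} : Finset A), 0)).mono fun i hi => ?_)
    exact hi.1 (by simp)
  have hθ : Tendsto (fun i : Finset A × ℕ => (1 : ℝ) / ((i.2 : ℝ) + 1)) l (𝓝 0) := by
    refine (tendsto_one_div_add_atTop_nhds_zero_nat.comp ?_).mono_left hl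
    rw [← prod_atTop_atTop_eq]
    exact tendsto_snd
  have hsq : ∀ {u : Finset A × ℕ → ℂ} (K : ℝ),
      (∀ᶠ i in l, ‖u i‖ ≤ K * (1 / ((i.2 : ℝ) + 1))) → Tendsto u l (𝓝 0) := by
    intro u K hu
    refine squeeze_zero_norm' hu ?_
    simpa using hθ.const_mul K
  refine ⟨l, hl, exists_tracialState_of_ultrafilter l ψ ?_ ?_ ?_ ?_ ?_ ?_⟩
  · intro x
    refine ⟨2 * (‖x‖ + 1), ?_⟩
    filter_upwards [hmem x] with i hx
    exact (h i).norm_le x hx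
  · intro x y
    refine hsq 6 ?_
    filter_upwards [hmem x, hmem y, hmem (x + y)] with i hx hy hxy
    exact (h i).add x hx y hy hxy
  · intro c x
    refine hsq (2 * (1 + ‖c‖)) ?_
    filter_upwards [hmem x, hmem (c • x)] with i hx hxy
    exact (h i).smul c x hx hxy
  · have := hsq (u := fun i => ψ i 1 - 1) 2 (by
      filter_upwards [hmem 1] with i hx
      exact (h i).one hx)
    simpa using this.add_const 1
  · intro x y
    refine hsq (8 + 6 * ‖x‖ + 6 * ‖y‖) ?_
    filter_upwards [hmem x, hmem y, hmem (x * y), hmem (y * x)] with i hx hy hxy hyx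
    exact (h i).comm x hx y hy hxy hyx
  · intro x hx
    -- Positivity of approximate traces is recorded on squares, so a positive element enters through
    -- its square root.
    set z := CFC.sqrt x
    have hz : z * z = x := CFC.sqrt_mul_sqrt_self x
    have hzs : IsSelfAdjoint z := IsSelfAdjoint.of_nonneg (CFC.sqrt_nonneg x)
    have key : ∀ i : Finset A × ℕ, ∃ s : ℂ, z ∈ i.1 → z * z ∈ i.1 →
        0 ≤ s ∧ ‖ψ i (z * z) - s‖ ≤ (8 + 10 * ‖z‖) * (1 / ((i.2 : ℝ) + 1)) := by
      intro i
      by_cases h1 : z ∈ i.1 ∧ z * z ∈ i.1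
      · obtain ⟨s, hs⟩ := (h i).pos z h1.1 h1.2 hzs
        exact ⟨s, fun _ _ => hs⟩
      · exact ⟨0, fun a b => absurd ⟨a, b⟩ h1⟩
    choose s hs using key
    refine ⟨s, ?_, hsq (8 + 10 * ‖z‖) ?_⟩
    · filter_upwards [hmem z, hmem (z * z)] with i h1 h2
      exact (hs i h1 h2).1
    · filter_upwards [hmem z, hmem (z * z)] with i h1 h2
      have := (hs i h1 h2).2
      rwa [hz] at this

theorem norm_le_one_of_isStarProjection {p : A} (hp : IsStarProjection p) : ‖p‖ ≤ 1 := by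
  have h1 : ‖p‖ * ‖p‖ = ‖p‖ := by
    rw [← CStarRing.norm_star_mul_self, hp.isSelfAdjoint.star_eq, hp.isIdempotentElem.eq]
  nlinarith [norm_nonneg p]

theorem norm_compress_le {p : A} (hp : IsStarProjection p) (x : A) : ‖p * x * p‖ ≤ ‖x‖ := by
  have hp1 := norm_le_one_of_isStarProjection hp
  calc ‖p * x * p‖ ≤ ‖p‖ * ‖x‖ * ‖p‖ :=
        (norm_mul_le _ _).trans (by gcongr; exact norm_mul_le _ _)
    _ ≤ 1 * ‖x‖ * 1 := by gcongr
    _ = ‖x‖ := by ring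

/-- The defect of multiplicativity is `[p, x] (1 - p) y p`, so commuting approximately with `x`
alone suffices. -/
theorem norm_compress_mul_sub_le {p : A} (hp : IsStarProjection p) {x : A} (y : A) {θ : ℝ}
    (hx : ‖p * x - x * p‖ ≤ θ) : ‖p * (x * y) * p - (p * x * p) * (p * y * p)‖ ≤ θ * ‖y‖ := by
  have hp1 := norm_le_one_of_isStarProjection hp
  have hpp : p * p = p := hp.isIdempotentElem
  have h1p : ‖1 - p‖ ≤ 1 := norm_le_one_of_isStarProjection hp.one_sub
  have e : p * (x * y) * p - (p * x * p) * (p * y * p)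
      = (p * x - x * p) * (1 - p) * (y * p) := by
    have : (p * x - x * p) * (1 - p) = p * x * (1 - p) := by
      have h : p * (1 - p) = 0 := by rw [mul_sub, hpp]; simp
      rw [sub_mul, mul_assoc x p, h]; simp
    rw [this]
    have e2 : (p * x * p) * (p * y * p) = p * x * (p * p) * (y * p) := by noncomm_ring
    rw [e2, hpp]; noncomm_ring
  rw [e]
  calc _ ≤ ‖p * x - x * p‖ * ‖1 - p‖ * (‖y‖ * ‖p‖) :=
        (norm_mul_le _ _).trans (by gcongr <;> exact norm_mul_le _ _)
    _ ≤ θ * 1 * (‖y‖ * 1) := by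
        have : 0 ≤ θ := (norm_nonneg _).trans hx
        gcongr
    _ = _ := by ring

/-- Choose `c x ∈ C` within `θ` of `p x p` for each `x ∈ F` and put `ψ x = φ (c x)`. The choice is
arbitrary, so `ψ` is only approximately linear; compression by `p` is almost multiplicative on `F`,
which gives the approximate trace property. -/
theorem exists_isApproxTrace {F : Finset A} {θ : ℝ} (hθ : 0 < θ) (hθ1 : θ ≤ 1) {p : A}
    (hp : IsStarProjection p) {C : NonUnitalStarSubalgebra ℂ A} (φ : C →ₗ[ℂ] ℂ) (q : C)
    (hq : (q : A) = p) (hφq : φ q = 1) (hφ : ∀ c d : C, φ (c * d) = φ (d * c))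
    (hφn : ∀ c : C, ‖φ c‖ ≤ 2 * ‖(c : A)‖) (hφp : ∀ c : C, 0 ≤ φ (star c * c))
    (hcomm : ∀ x ∈ F, ‖p * x - x * p‖ < θ)
    (hdist : ∀ x ∈ F, Metric.infDist (p * x * p) (C : Set A) < θ) :
    ∃ ψ : A → ℂ, IsApproxTrace F θ ψ ∧
      ∀ x ∈ F, ∀ c : C, ‖p * x * p - c‖ ≤ θ → ‖ψ x - φ c‖ ≤ 4 * θ := by
  have key : ∀ x : A, ∃ c : C, x ∈ F → ‖p * x * p - c‖ ≤ θ := by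
    intro x
    by_cases hx : x ∈ F
    · obtain ⟨c, hc, hlt⟩ := (Metric.infDist_lt_iff ⟨0, C.zero_mem⟩).1 (hdist x hx)
      exact ⟨⟨c, hc⟩, fun _ => by rw [dist_eq_norm] at hlt; exact hlt.le⟩
    · exact ⟨0, fun h => absurd h hx⟩
  choose c hc using key
  have hcn : ∀ x ∈ F, ‖(c x : A)‖ ≤ ‖x‖ + θ := by
    intro x hx
    have := norm_compress_le hp x
    have h2 : ‖(c x : A)‖ ≤ ‖p * x * p‖ + ‖p * x * p - c x‖ := by
      have := norm_sub_le (p * x * p) (p * x * p - c x)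
      simpa using this
    linarith [hc x hx]
  have hd : ∀ (u v : C) (K : ℝ), ‖(u : A) - v‖ ≤ K → ‖φ u - φ v‖ ≤ 2 * K := by
    intro u v K h
    rw [← map_sub]
    exact (hφn _).trans (by simpa using h)
  have hmul : ∀ x ∈ F, ∀ y ∈ F, x * y ∈ F →
      ‖(c (x * y) : A) - c x * c y‖ ≤ (2 + ‖x‖ + 2 * ‖y‖) * θ := by
    intro x hx y hy hxy
    have e : (c (x * y) : A) - c x * c y = -(p * (x * y) * p - c (x * y))
        + (p * (x * y) * p - (p * x * p) * (p * y * p))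
        + ((p * x * p - c x) * (p * y * p) + c x * (p * y * p - c y)) := by noncomm_ring
    rw [e]
    have h1 := hc _ hxy
    have h2 := norm_compress_mul_sub_le hp y (hcomm x hx).le
    have h3 : ‖(p * x * p - c x) * (p * y * p)‖ ≤ θ * ‖y‖ :=
      (norm_mul_le _ _).trans (by gcongr; exacts [hc x hx, norm_compress_le hp y])
    have h4 : ‖(c x : A) * (p * y * p - c y)‖ ≤ (‖x‖ + θ) * θ :=
      (norm_mul_le _ _).trans (by gcongr; exacts [hcn x hx, hc y hy])
    have h5 : (‖x‖ + θ) * θ ≤ (‖x‖ + 1) * θ := by gcongr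
    calc _ ≤ ‖-(p * (x * y) * p - c (x * y))‖ + _ + (_ + _) :=
          (norm_add_le _ _).trans (add_le_add (norm_add_le _ _) (norm_add_le _ _))
      _ ≤ θ + θ * ‖y‖ + (θ * ‖y‖ + (‖x‖ + 1) * θ) := by
          rw [norm_neg]; gcongr; exact h4.trans h5
      _ = _ := by ring
  refine ⟨fun x => φ (c x), ⟨?_, ?_, ?_, ?_, ?_, ?_⟩, ?_⟩
  · intro x hx
    refine (hφn _).trans ?_
    gcongr
    exact (hcn x hx).trans (by gcongr)
  · intro x hx y hy hxy
    have := hd (c (x + y)) (c x + c y) (3 * θ) (by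
      have e : (c (x + y) : A) - ((c x + c y : C) : A)
          = -(p * (x + y) * p - c (x + y)) + ((p * x * p - c x) + (p * y * p - c y)) := by
        push_cast; noncomm_ring
      rw [e]
      calc _ ≤ ‖-(p * (x + y) * p - c (x + y))‖ + (_ + _) :=
            (norm_add_le _ _).trans (add_le_add le_rfl (norm_add_le _ _))
        _ ≤ θ + (θ + θ) := by
            rw [norm_neg]
            gcongr
            exacts [hc _ hxy, hc x hx, hc y hy]
        _ = _ := by ring)
    rw [map_add] at this
    calc _ = ‖φ (c (x + y)) - (φ (c x) + φ (c y))‖ := by congr 1; ring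
      _ ≤ _ := this
      _ = _ := by ring
  · intro k x hx hkx
    have := hd (c (k • x)) (k • c x) ((1 + ‖k‖) * θ) (by
      have e : (c (k • x) : A) - ((k • c x : C) : A)
          = -(p * (k • x) * p - c (k • x)) + k • (p * x * p - c x) := by
        push_cast
        rw [smul_sub, mul_smul_comm, smul_mul_assoc]; abel
      rw [e]
      refine (norm_add_le _ _).trans ?_
      rw [norm_neg, norm_smul, add_mul, one_mul]
      gcongr
      exacts [hc _ hkx, hc x hx])
    rw [map_smul, smul_eq_mul] at this
    linarith
  · intro h1
    have := hd (c 1) q θ (by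
      have := hc 1 h1
      rw [mul_one, hp.isIdempotentElem.eq] at this
      rw [hq, norm_sub_rev]; exact this)
    rwa [hφq] at this
  · intro x hx y hy hxy hyx
    have h1 := hd (c (x * y)) (c x * c y) _ (by simpa using hmul x hx y hy hxy)
    have h2 := hd (c (y * x)) (c y * c x) _ (by simpa using hmul y hy x hx hyx)
    rw [hφ (c y)] at h2
    calc _ = ‖(φ (c (x * y)) - φ (c x * c y)) - (φ (c (y * x)) - φ (c x * c y))‖ := by
          congr 1; ring
      _ ≤ _ := norm_sub_le _ _
      _ ≤ _ := add_le_add h1 h2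
      _ = _ := by ring
  · intro z hz hzz hzs
    refine ⟨_, hφp (c z), ?_⟩
    -- `c z` need not be self-adjoint, only nearly so; the positive number to compare with is `φ` of
    -- `star (c z) * c z`.
    have h1 : ‖(c z : A) - star (c z : A)‖ ≤ 2 * θ := by
      have e : (c z : A) - star (c z : A)
          = star (p * z * p - c z) - (p * z * p - c z) := by
        rw [star_sub, star_mul, star_mul, hp.isSelfAdjoint.star_eq, hzs.star_eq]
        noncomm_ring
      rw [e]
      refine (norm_sub_le _ _).trans ?_
      rw [norm_star]
      linarith [hc z hz]
    have h2 := hd (c (z * z)) (star (c z) * c z) ((4 + 5 * ‖z‖) * θ) (by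
      have e : (c (z * z) : A) - ((star (c z) * c z : C) : A)
          = (c (z * z) - c z * c z) + (c z - star (c z : A)) * c z := by
        push_cast; noncomm_ring
      rw [e]
      refine (norm_add_le _ _).trans ?_
      have h3 := hmul z hz z hz hzz
      have h4 : ‖((c z : A) - star (c z : A)) * c z‖ ≤ 2 * θ * (‖z‖ + 1) :=
        (norm_mul_le _ _).trans (by gcongr; exact (hcn z hz).trans (by gcongr))
      nlinarith)
    linarith
  · intro x hx d hxd
    have := hd (c x) d (2 * θ) (by
      have e : (c x : A) - d = (p * x * p - d) - (p * x * p - c x) := by abel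
      rw [e]
      refine (norm_sub_le _ _).trans ?_
      linarith [hc x hx])
    linarith

/-- Traces on `C` need not come from `A`. If the conclusion failed for every `F` and `θ`, the
resulting approximate traces would converge to a tracial state of `A` whose gap is at most `η/2`. -/
theorem exists_trace_transfer {g h : A} {η : ℝ} (hη : 0 < η)
    (hgap : ∀ τ ∈ tracialStates A, (τ g).re + η ≤ (τ h).re) :
    ∃ (F : Finset A) (θ : ℝ), 0 < θ ∧
      ∀ (p : A) (C : NonUnitalStarSubalgebra ℂ A) (φ : C →ₗ[ℂ] ℂ) (q : C),
        IsStarProjection p → (q : A) = p → φ q = 1 → (∀ c d : C, φ (c * d) = φ (d * c)) →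
        (∀ c : C, ‖φ c‖ ≤ 2 * ‖(c : A)‖) → (∀ c : C, 0 ≤ φ (star c * c)) →
        (∀ x ∈ F, ‖p * x - x * p‖ < θ) →
        (∀ x ∈ F, Metric.infDist (p * x * p) (C : Set A) < θ) →
        ∀ g' h' : C, ‖p * g * p - g'‖ ≤ θ → ‖p * h * p - h'‖ ≤ θ →
          (φ g').re + η / 2 ≤ (φ h').re := by
  classical
  by_contra! hcon
  have key : ∀ i : Finset A × ℕ, ∃ ψ : A → ℂ, IsApproxTrace i.1 (1 / ((i.2 : ℝ) + 1)) ψ ∧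
      (g ∈ i.1 → h ∈ i.1 → (ψ h).re ≤ (ψ g).re + η / 2 + 8 * (1 / ((i.2 : ℝ) + 1))) := by
    intro i
    have hpos : (0 : ℝ) < 1 / ((i.2 : ℝ) + 1) := by positivity
    obtain ⟨p, C, φ, q, hp, hq, hφq, hφ, hφn, hφp, hcomm, hdist, g', h', hg, hh, hlt⟩ :=
      hcon i.1 (1 / ((i.2 : ℝ) + 1)) hpos
    obtain ⟨ψ, h1, h2⟩ := exists_isApproxTrace hpos
      ((div_le_one (by positivity)).2 (by simp)) hp φ q hq hφq hφ hφn hφp hcomm hdist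
    refine ⟨ψ, h1, fun hgi hhi => ?_⟩
    have e1 := (abs_le.1 ((Complex.abs_re_le_norm _).trans (h2 g hgi g' hg))).1
    have e2 := (abs_le.1 ((Complex.abs_re_le_norm _).trans (h2 h hhi h' hh))).2
    rw [Complex.sub_re] at e1 e2
    linarith
  choose ψ hψ hle using key
  obtain ⟨l, hl, τ, hτ, hlim⟩ := exists_tracialState_of_isApproxTrace ψ hψ
  have hmem : ∀ x : A, ∀ᶠ i : Finset A × ℕ in l, x ∈ i.1 := fun x => by
    refine hl ((eventually_ge_atTop (({x} : Finset A), 0)).mono fun i hi => ?_)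
    exact hi.1 (by simp)
  have hθ : Tendsto (fun i : Finset A × ℕ => (1 : ℝ) / ((i.2 : ℝ) + 1)) l (𝓝 0) := by
    refine (tendsto_one_div_add_atTop_nhds_zero_nat.comp ?_).mono_left hl
    rw [← prod_atTop_atTop_eq]
    exact tendsto_snd
  have hre : ∀ x, Tendsto (fun n => (ψ n x).re) l (𝓝 (τ x).re) := fun x =>
    (Complex.continuous_re.tendsto _).comp (hlim x)
  have h1 : Tendsto (fun i => (ψ i g).re + η / 2 + 8 * (1 / ((i.2 : ℝ) + 1))) l
      (𝓝 ((τ g).re + η / 2)) := by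
    simpa using ((hre g).add_const (η / 2)).add (hθ.const_mul 8)
  have h2 := le_of_tendsto_of_tendsto (hre h) h1 (by
    filter_upwards [hmem g, hmem h] with i hgi hhi using hle i hgi hhi)
  linarith [hgap τ hτ]

end Traces

/-! ### Generic matrix families and a dimension count -/

section Generic

open scoped Matrix.Norms.L2Operator Matrix

/-- `Z` carries the kernel of `M` isomorphically onto a complement of its range, after a projection
onto the kernel. -/
theorem Matrix.exists_isUnit_add {r : ℕ} (M : Matrix (Fin r) (Fin r) ℂ) :
    ∃ Z : Matrix (Fin r) (Fin r) ℂ, IsUnit (M + Z) ∧ Z.rank + M.rank ≤ r := by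
  set f := Matrix.mulVecLin M with hf
  obtain ⟨Q, hQ⟩ := Submodule.exists_isCompl (LinearMap.range f)
  have h1 := LinearMap.finrank_range_add_finrank_ker f
  have h2 := Submodule.finrank_add_eq_of_isCompl hQ
  have h3 : Module.finrank ℂ (LinearMap.ker f) = Module.finrank ℂ Q := by omega
  let e := LinearEquiv.ofFinrankEq (LinearMap.ker f) Q h3
  obtain ⟨π, hπ⟩ := LinearMap.exists_leftInverse_of_injective (LinearMap.ker f).subtype
    (Submodule.ker_subtype _)
  set z : (Fin r → ℂ) →ₗ[ℂ] (Fin r → ℂ) := Q.subtype ∘ₗ e.toLinearMap ∘ₗ π with hz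
  have hzM : (LinearMap.toMatrix' z).mulVecLin = z := by
    rw [← Matrix.toLin'_apply', Matrix.toLin'_toMatrix']
  refine ⟨LinearMap.toMatrix' z, ?_, ?_⟩
  · rw [← Matrix.mulVec_injective_iff_isUnit]
    rw [← Matrix.coe_mulVecLin, Matrix.mulVecLin_add, hzM]
    rw [← LinearMap.ker_eq_bot, LinearMap.ker_eq_bot']
    intro v hv
    have hv' : f v = -z v := by
      rw [LinearMap.add_apply] at hv
      exact eq_neg_of_add_eq_zero_left hv
    have hzQ : z v ∈ Q := (e (π v)).2
    have hfQ : f v ∈ Q := by rw [hv']; exact Q.neg_mem hzQ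
    have h0 : f v = 0 := by
      have := hQ.disjoint.le_bot ⟨LinearMap.mem_range_self f v, hfQ⟩
      simpa using this
    have hz0 : z v = 0 := by
      rw [h0] at hv'; exact neg_eq_zero.1 hv'.symm
    have hπv : π v = ⟨v, h0⟩ := by
      have := LinearMap.congr_fun hπ ⟨v, h0⟩
      simpa using this
    have : e (π v) = 0 := Subtype.ext hz0
    rw [LinearEquiv.map_eq_zero_iff, hπv] at this
    exact congrArg Subtype.val this
  · have hr1 : M.rank = Module.finrank ℂ (LinearMap.range f) := rfl
    have hr2 : (LinearMap.toMatrix' z).rank = Module.finrank ℂ (LinearMap.range z) := by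
      rw [Matrix.rank, hzM]
    have hle : LinearMap.range z ≤ Q := by
      rintro _ ⟨v, rfl⟩; exact (e (π v)).2
    have := Submodule.finrank_mono hle
    simp only [Module.finrank_fin_fun] at h1 h2
    omega

theorem ContDiffAt.mulVec {E : Type*} [NormedAddCommGroup E] [NormedSpace ℝ E] {r : ℕ}
    {f : E → Matrix (Fin r) (Fin r) ℂ} {g : E → Fin r → ℂ} {x : E}
    (hf : ContDiffAt ℝ 1 f x) (hg : ContDiffAt ℝ 1 g x) :
    ContDiffAt ℝ 1 (fun y => f y *ᵥ g y) x := by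
  rw [contDiffAt_pi] at hg ⊢
  intro i
  simp only [Matrix.mulVec, dotProduct]
  refine ContDiffAt.sum fun j _ => ContDiffAt.mul ?_ (hg j)
  let ent : Matrix (Fin r) (Fin r) ℂ →ₗ[ℝ] ℂ :=
    { toFun := fun M => M i j
      map_add' := fun _ _ => rfl
      map_smul' := fun _ _ => rfl }
  exact (LinearMap.toContinuousLinearMap ent).contDiff.contDiffAt.comp x hf

variable {r N : ℕ}

/-- The matrices with a single nonzero column, the `l`-th one of the `j`-th matrix. -/
noncomputable def columnInsert (j : Fin N) (l : Fin r) :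
    (Fin r → ℂ) →ₗ[ℂ] (Fin N → Matrix (Fin r) (Fin r) ℂ) where
  toFun u := Pi.single j (Matrix.vecMulVec u (Pi.single l 1))
  map_add' u v := by rw [Matrix.add_vecMulVec, Pi.single_add]
  map_smul' c u := by rw [Matrix.smul_vecMulVec, Pi.single_smul]; rfl

/-- The `l`-th column of the `j`-th matrix. -/
noncomputable def columnEval (j : Fin N) (l : Fin r) :
    (Fin N → Matrix (Fin r) (Fin r) ℂ) →ₗ[ℂ] (Fin r → ℂ) where
  toFun V a := V j a l
  map_add' _ _ := rfl
  map_smul' _ _ := rfl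

theorem columnEval_columnInsert (j : Fin N) (l : Fin r) (u : Fin r → ℂ) :
    columnEval j l (columnInsert j l u) = u := by
  ext a
  change (Pi.single j (Matrix.vecMulVec u (Pi.single l 1)) :
    Fin N → Matrix (Fin r) (Fin r) ℂ) j a l = u a
  simp [Matrix.vecMulVec_apply]

theorem finrank_ker_columnEval (j : Fin N) (l : Fin r) :
    Module.finrank ℂ (LinearMap.ker (columnEval j l)) + r
      = Module.finrank ℂ (Fin N → Matrix (Fin r) (Fin r) ℂ) := by
  have h := LinearMap.finrank_range_add_finrank_ker (columnEval j l)
  have h2 : LinearMap.range (columnEval j l) = ⊤ :=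
    LinearMap.range_eq_top.2 fun u => ⟨_, columnEval_columnInsert j l u⟩
  rw [h2, finrank_top, Module.finrank_fin_fun] at h
  omega

theorem sum_smul_columnInsert_mulVec (j : Fin N) (l : Fin r) (u ξ : Fin r → ℂ) (t : Fin N → ℝ) :
    (∑ i, (t i : ℂ) • columnInsert j l u i) *ᵥ ξ = ((t j : ℂ) * ξ l) • u := by
  have : ∑ i, (t i : ℂ) • columnInsert j l u i
      = (t j : ℂ) • Matrix.vecMulVec u (Pi.single l 1) := by
    rw [Finset.sum_eq_single j]
    · simp [columnInsert]
    · intro i _ hi; simp [columnInsert, Pi.single_eq_of_ne hi]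
    · simp
  rw [this, Matrix.smul_mulVec, Matrix.vecMulVec_mulVec]
  ext a
  simp
  ring

/-- The families `W` for which a nonzero `ξ` in the kernel of `D t` is mapped by `∑ tᵢ Wᵢ` to the
kernel of `C t`, for some `t` supported in `σ`. -/
def degenerateSet (C D : (Fin N → ℝ) → Matrix (Fin r) (Fin r) ℂ)
    (Z Z' : Matrix (Fin r) (Fin r) ℂ) (σ : Finset (Fin N)) (j : Fin N) (l : Fin r) :
    Set (Fin N → Matrix (Fin r) (Fin r) ℂ) :=
  {W | ∃ (t : Fin N → ℝ) (ξ : Fin r → ℂ), (∀ i ∉ σ, t i = 0) ∧ t j ≠ 0 ∧ ξ l ≠ 0 ∧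
    IsUnit (C t + Z) ∧ IsUnit (D t + Z') ∧ D t *ᵥ ξ = 0 ∧
    C t *ᵥ ((∑ i, (t i : ℂ) • W i) *ᵥ ξ) = 0}

/-- A rational parametrization of `degenerateSet`. -/
noncomputable def degenerateParam (Z Z' : Matrix (Fin r) (Fin r) ℂ) (j : Fin N) (l : Fin r)
    (y : (Fin N → ℝ) × Matrix (Fin r) (Fin r) ℂ × Matrix (Fin r) (Fin r) ℂ ×
      (Fin r → ℂ) × (Fin r → ℂ) × (Fin N → Matrix (Fin r) (Fin r) ℂ)) :
    Fin N → Matrix (Fin r) (Fin r) ℂ :=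
  y.2.2.2.2.2 + columnInsert j l
    (((y.1 j : ℂ) * (Ring.inverse (y.2.2.1 + Z') *ᵥ y.2.2.2.2.1) l)⁻¹ •
      (Ring.inverse (y.2.1 + Z) *ᵥ y.2.2.2.1
        - (∑ i, (y.1 i : ℂ) • y.2.2.2.2.2 i) *ᵥ (Ring.inverse (y.2.2.1 + Z') *ᵥ y.2.2.2.2.1)))

theorem contDiffAt_degenerateParam (Z Z' : Matrix (Fin r) (Fin r) ℂ) (j : Fin N) (l : Fin r)
    (y : (Fin N → ℝ) × Matrix (Fin r) (Fin r) ℂ × Matrix (Fin r) (Fin r) ℂ ×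
      (Fin r → ℂ) × (Fin r → ℂ) × (Fin N → Matrix (Fin r) (Fin r) ℂ))
    (h1 : IsUnit (y.2.1 + Z)) (h2 : IsUnit (y.2.2.1 + Z')) (h3 : y.1 j ≠ 0)
    (h4 : (Ring.inverse (y.2.2.1 + Z') *ᵥ y.2.2.2.2.1) l ≠ 0) :
    ContDiffAt ℝ 1 (degenerateParam Z Z' j l) y := by
  have hinv : ∀ {g : ((Fin N → ℝ) × Matrix (Fin r) (Fin r) ℂ × Matrix (Fin r) (Fin r) ℂ ×
      (Fin r → ℂ) × (Fin r → ℂ) × (Fin N → Matrix (Fin r) (Fin r) ℂ)) →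
        Matrix (Fin r) (Fin r) ℂ}, ContDiffAt ℝ 1 g y → IsUnit (g y) →
      ContDiffAt ℝ 1 (fun y => Ring.inverse (g y)) y := by
    intro g hg hu
    obtain ⟨u, hu⟩ := hu
    have := contDiffAt_ringInverse ℝ (n := 1) u
    rw [hu] at this
    exact this.comp y hg
  have hξ : ContDiffAt ℝ 1 (fun y : (Fin N → ℝ) × Matrix (Fin r) (Fin r) ℂ ×
      Matrix (Fin r) (Fin r) ℂ × (Fin r → ℂ) × (Fin r → ℂ) ×
        (Fin N → Matrix (Fin r) (Fin r) ℂ) =>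
      Ring.inverse (y.2.2.1 + Z') *ᵥ y.2.2.2.2.1) y :=
    (hinv (by fun_prop) h2).mulVec (by fun_prop)
  have hη : ContDiffAt ℝ 1 (fun y : (Fin N → ℝ) × Matrix (Fin r) (Fin r) ℂ ×
      Matrix (Fin r) (Fin r) ℂ × (Fin r → ℂ) × (Fin r → ℂ) ×
        (Fin N → Matrix (Fin r) (Fin r) ℂ) =>
      Ring.inverse (y.2.1 + Z) *ᵥ y.2.2.2.1) y :=
    (hinv (by fun_prop) h1).mulVec (by fun_prop)
  have ht : ∀ i, ContDiffAt ℝ 1 (fun y : (Fin N → ℝ) × Matrix (Fin r) (Fin r) ℂ ×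
      Matrix (Fin r) (Fin r) ℂ × (Fin r → ℂ) × (Fin r → ℂ) ×
        (Fin N → Matrix (Fin r) (Fin r) ℂ) => (y.1 i : ℂ)) y := fun i =>
    Complex.ofRealCLM.contDiff.contDiffAt.comp y (by fun_prop)
  have hs : ContDiffAt ℝ 1 (fun y : (Fin N → ℝ) × Matrix (Fin r) (Fin r) ℂ ×
      Matrix (Fin r) (Fin r) ℂ × (Fin r → ℂ) × (Fin r → ℂ) ×
        (Fin N → Matrix (Fin r) (Fin r) ℂ) =>
      ∑ i, (y.1 i : ℂ) • y.2.2.2.2.2 i) y :=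
    ContDiffAt.sum fun i _ => (ht i).smul (by fun_prop)
  have hu := (((ht j).mul (contDiffAt_pi.1 hξ l)).inv
    (mul_ne_zero (by exact_mod_cast h3) h4)).smul (hη.sub (hs.mulVec hξ))
  have hL := (LinearMap.toContinuousLinearMap
    ((columnInsert (N := N) j l).restrictScalars ℝ)).contDiff (n := 1)
  exact ContDiffAt.add (by fun_prop) (hL.contDiffAt.comp y hu)

/-- Put `η = (∑ tᵢ Wᵢ) ξ`. As `D ξ = 0` and `C η = 0`, `ξ = (D + Z')⁻¹ Z' ξ` and `η = (C + Z)⁻¹ Z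
η`, so both vectors are recovered from `t` and points of the ranges of `Z'` and `Z`. Since `t j * ξ
l ≠ 0`, the equation for `η` then determines the `l`-th column of `W j` from the other entries. The
real parameter count is `|σ| + 2 rank Z + 2 rank Z'` plus the full dimension minus `2r`. Locally
Lipschitz maps do not raise Hausdorff dimension, which is why `C` and `D` are required to be
Lipschitz. -/
theorem dimH_degenerateSet_lt {C D : (Fin N → ℝ) → Matrix (Fin r) (Fin r) ℂ} {KC KD : NNReal}
    (hC : LipschitzWith KC C) (hD : LipschitzWith KD D) {Z Z' : Matrix (Fin r) (Fin r) ℂ}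
    {σ : Finset (Fin N)} (j : Fin N) (l : Fin r)
    (hσ : σ.card + 2 * Z.rank + 2 * Z'.rank < 2 * r) :
    dimH (degenerateSet C D Z Z' σ j l)
      ≤ ((Module.finrank ℝ (Fin N → Matrix (Fin r) (Fin r) ℂ) - 1 : ℕ) : ENNReal) := by
  classical
  set E := (σ → ℝ) × (LinearMap.range Z.mulVecLin) × (LinearMap.range Z'.mulVecLin) ×
    (LinearMap.ker (columnEval (N := N) j l))
  let ext : (σ → ℝ) →ₗ[ℝ] (Fin N → ℝ) :=
    { toFun := fun s i => if h : i ∈ σ then s ⟨i, h⟩ else 0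
      map_add' := fun s t => by ext i; by_cases h : i ∈ σ <;> simp [h]
      map_smul' := fun c s => by ext i; by_cases h : i ∈ σ <;> simp [h] }
  let J : E → (Fin N → ℝ) × Matrix (Fin r) (Fin r) ℂ × Matrix (Fin r) (Fin r) ℂ ×
      (Fin r → ℂ) × (Fin r → ℂ) × (Fin N → Matrix (Fin r) (Fin r) ℂ) := fun x =>
    (ext x.1, C (ext x.1), D (ext x.1), x.2.1, x.2.2.1, x.2.2.2)
  obtain ⟨K, hJ⟩ : ∃ K, LipschitzWith K J := by
    have h0 : LipschitzWith _ (fun x : E => ext x.1) :=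
      (LinearMap.toContinuousLinearMap ext).lipschitz.comp LipschitzWith.prod_fst
    have h1 : LipschitzWith _ (fun x : E => (x.2.1 : Fin r → ℂ)) :=
      (LipschitzWith.subtype_val _).comp (LipschitzWith.prod_fst.comp LipschitzWith.prod_snd)
    have h2 : LipschitzWith _ (fun x : E => (x.2.2.1 : Fin r → ℂ)) :=
      (LipschitzWith.subtype_val _).comp
        (LipschitzWith.prod_fst.comp (LipschitzWith.prod_snd.comp LipschitzWith.prod_snd))
    have h3 : LipschitzWith _ (fun x : E => (x.2.2.2 : Fin N → Matrix (Fin r) (Fin r) ℂ)) :=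
      (LipschitzWith.subtype_val _).comp
        (LipschitzWith.prod_snd.comp (LipschitzWith.prod_snd.comp LipschitzWith.prod_snd))
    exact ⟨_, h0.prodMk ((hC.comp h0).prodMk ((hD.comp h0).prodMk (h1.prodMk (h2.prodMk h3))))⟩
  let S : Set E := {x | IsUnit ((J x).2.1 + Z) ∧ IsUnit ((J x).2.2.1 + Z') ∧ (J x).1 j ≠ 0 ∧
    (Ring.inverse ((J x).2.2.1 + Z') *ᵥ (J x).2.2.2.2.1) l ≠ 0}
  have hsub : degenerateSet C D Z Z' σ j l ⊆ (degenerateParam Z Z' j l ∘ J) '' S := by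
    rintro W ⟨t, ξ, htσ, htj, hξl, hu, hu', hDξ, hCη⟩
    set η := (∑ i, (t i : ℂ) • W i) *ᵥ ξ with hη
    set V := W - columnInsert j l (columnEval j l W) with hV
    have hext : ext (fun i => t i) = t := by
      ext i
      by_cases h : i ∈ σ
      · simp [ext, h]
      · simp [ext, h, htσ i h]
    have hξ' : Ring.inverse (D t + Z') *ᵥ (Z' *ᵥ ξ) = ξ := by
      have : Z' *ᵥ ξ = (D t + Z') *ᵥ ξ := by rw [Matrix.add_mulVec, hDξ, zero_add]
      rw [this, Matrix.mulVec_mulVec, Ring.inverse_mul_cancel _ hu', Matrix.one_mulVec]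
    have hη' : Ring.inverse (C t + Z) *ᵥ (Z *ᵥ η) = η := by
      have : Z *ᵥ η = (C t + Z) *ᵥ η := by rw [Matrix.add_mulVec, hCη, zero_add]
      rw [this, Matrix.mulVec_mulVec, Ring.inverse_mul_cancel _ hu, Matrix.one_mulVec]
    refine ⟨(fun i => t i, ⟨Z *ᵥ η, LinearMap.mem_range_self Z.mulVecLin η⟩,
      ⟨Z' *ᵥ ξ, LinearMap.mem_range_self Z'.mulVecLin ξ⟩, ⟨V, ?_⟩), ?_, ?_⟩
    · rw [LinearMap.mem_ker, hV, map_sub, columnEval_columnInsert, sub_self]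
    · simp only [S, J, Set.mem_ofPred_eq, hext, hξ']
      exact ⟨hu, hu', htj, hξl⟩
    · simp only [Function.comp, J, degenerateParam, hext, hξ', hη']
      have e1 : (∑ i, (t i : ℂ) • V i) *ᵥ ξ
          = η - ((t j : ℂ) * ξ l) • columnEval j l W := by
        rw [hη, ← sum_smul_columnInsert_mulVec j l _ ξ t, ← Matrix.sub_mulVec,
          ← Finset.sum_sub_distrib]
        simp [hV, smul_sub]
      have hne : (t j : ℂ) * ξ l ≠ 0 := mul_ne_zero (by exact_mod_cast htj) hξl
      rw [e1, sub_sub_cancel, inv_smul_smul₀ hne, hV, sub_add_cancel]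
  calc dimH (degenerateSet C D Z Z' σ j l) ≤ dimH ((degenerateParam Z Z' j l ∘ J) '' S) :=
        dimH_mono hsub
    _ ≤ dimH S := by
        refine dimH_image_le_of_locally_lipschitzOn fun x hx => ?_
        obtain ⟨K', U, hU, hK'⟩ := (contDiffAt_degenerateParam Z Z' j l (J x) hx.1 hx.2.1
          hx.2.2.1 hx.2.2.2).exists_lipschitzOnWith
        exact ⟨_, J ⁻¹' U, mem_nhdsWithin_of_mem_nhds (hJ.continuous.continuousAt hU),
          hK'.comp hJ.lipschitzOnWith (Set.mapsTo_preimage J U)⟩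
    _ ≤ dimH (Set.univ : Set E) := dimH_mono (Set.subset_univ _)
    _ = (Module.finrank ℝ E : ENNReal) := Real.dimH_univ_eq_finrank E
    _ ≤ _ := by
        have h1 := finrank_ker_columnEval (N := N) j l
        have h2 : Module.finrank ℝ E = σ.card + (2 * Z.rank + (2 * Z'.rank +
            2 * Module.finrank ℂ (LinearMap.ker (columnEval (N := N) j l)))) := by
          have f1 : Module.Free ℝ (LinearMap.range Z.mulVecLin) := Module.Free.of_divisionRing _ _
          have f2 : Module.Free ℝ (LinearMap.range Z'.mulVecLin) := Module.Free.of_divisionRing _ _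
          have f3 : Module.Free ℝ (LinearMap.ker (columnEval (N := N) j l)) :=
            Module.Free.of_divisionRing _ _
          have f4 := Module.Free.prod ℝ (LinearMap.range Z'.mulVecLin)
            (LinearMap.ker (columnEval (N := N) j l))
          have f5 := Module.Free.prod ℝ (LinearMap.range Z.mulVecLin)
            ((LinearMap.range Z'.mulVecLin) × (LinearMap.ker (columnEval (N := N) j l)))
          simp only [E, Module.finrank_prod, Module.finrank_fintype_fun_eq_card,
            Fintype.card_coe, finrank_real_of_complex, Matrix.rank]
        rw [h2, finrank_real_of_complex, ← h1]
        exact_mod_cast (by omega)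

/-- The conclusion says that `C t` composed with `∑ tᵢ Wᵢ` is injective on the kernel of `D t`. Bad
families form a countable union of degenerate sets, each of dimension below that of the whole space,
so some `W` avoids them all. -/
theorem exists_generic_family {C D : (Fin N → ℝ) → Matrix (Fin r) (Fin r) ℂ} {KC KD : NNReal}
    (hC : LipschitzWith KC C) (hD : LipschitzWith KD D) (d : ℕ) :
    ∃ W : Fin N → Matrix (Fin r) (Fin r) ℂ, ∀ t : Fin N → ℝ, t ≠ 0 →
      (Finset.univ.filter fun i => t i ≠ 0).card ≤ d + 1 →
      2 * r + d + 1 < 2 * (C t).rank + 2 * (D t).rank →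
      ∀ ξ : Fin r → ℂ, D t *ᵥ ξ = 0 → C t *ᵥ ((∑ i, (t i : ℂ) • W i) *ᵥ ξ) = 0 → ξ = 0 := by
  classical
  set G : Set (Fin N → ℝ) := {t | 2 * r + d + 1 < 2 * (C t).rank + 2 * (D t).rank}
  choose Z hZ hZr using fun t => Matrix.exists_isUnit_add (C t)
  choose Z' hZ' hZr' using fun t => Matrix.exists_isUnit_add (D t)
  -- The ranks vary with `t`, but corrections `Z t₀`, `Z' t₀` of small rank still work near `t₀`. By
  -- the Lindelöf property countably many `t₀` suffice.
  let U : (Fin N → ℝ) → Set (Fin N → ℝ) := fun t₀ =>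
    {t | IsUnit (C t + Z t₀) ∧ IsUnit (D t + Z' t₀)}
  have hU : ∀ t₀ ∈ G, U t₀ ∈ 𝓝[G] t₀ := by
    intro t₀ _
    refine mem_nhdsWithin_of_mem_nhds ?_
    have o1 : IsOpen {t | IsUnit (C t + Z t₀)} :=
      Units.isOpen.preimage (hC.continuous.add continuous_const)
    have o2 : IsOpen {t | IsUnit (D t + Z' t₀)} :=
      Units.isOpen.preimage (hD.continuous.add continuous_const)
    exact (o1.inter o2).mem_nhds ⟨hZ t₀, hZ' t₀⟩
  obtain ⟨T, hTG, hTc, hcov⟩ := TopologicalSpace.countable_cover_nhdsWithin hU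
  have := hTc.to_subtype
  let ι := T × {σ : Finset (Fin N) // σ.card ≤ d + 1} × Fin N × Fin r
  let B : ι → Set (Fin N → Matrix (Fin r) (Fin r) ℂ) := fun i =>
    degenerateSet C D (Z i.1) (Z' i.1) i.2.1 i.2.2.1 i.2.2.2
  rcases isEmpty_or_nonempty ι with hι | hι
  · refine ⟨0, fun t ht hcard hrk ξ _ _ => ?_⟩
    by_contra hξ
    obtain ⟨l, -⟩ := Function.ne_iff.1 hξ
    obtain ⟨j, -⟩ := Function.ne_iff.1 ht
    obtain ⟨t₀, ht₀, -⟩ := Set.mem_iUnion₂.1 (hcov (show t ∈ G from hrk))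
    exact hι.elim (⟨t₀, ht₀⟩, ⟨_, hcard⟩, j, l)
  have hdim : dimH (⋃ i, B i)
      ≤ ((Module.finrank ℝ (Fin N → Matrix (Fin r) (Fin r) ℂ) - 1 : ℕ) : ENNReal) := by
    rw [dimH_iUnion]
    refine iSup_le fun i => dimH_degenerateSet_lt hC hD _ _ ?_
    have h1 : 2 * r + d + 1 < _ := hTG i.1.2
    have h2 := hZr i.1
    have h3 := hZr' i.1
    have h4 := i.2.1.2
    omega
  have hpos : 0 < Module.finrank ℝ (Fin N → Matrix (Fin r) (Fin r) ℂ) := by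
    obtain ⟨_, _, j, l⟩ := hι
    have : Nonempty (Fin r) := ⟨l⟩
    have : Nonempty (Fin N) := ⟨j⟩
    exact Module.finrank_pos
  have hdense : Dense (⋃ i, B i)ᶜ := by
    refine dense_compl_of_dimH_lt_finrank (hdim.trans_lt ?_)
    exact_mod_cast (by omega)
  obtain ⟨W, hW⟩ := hdense.nonempty
  refine ⟨W, fun t ht hcard hrk ξ h1 h2 => ?_⟩
  by_contra hξ
  obtain ⟨l, hl⟩ := Function.ne_iff.1 hξ
  obtain ⟨j, hj⟩ := Function.ne_iff.1 ht
  obtain ⟨t₀, ht₀, htU⟩ := Set.mem_iUnion₂.1 (hcov (show t ∈ G from hrk))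
  refine hW (Set.mem_iUnion.2 ⟨(⟨t₀, ht₀⟩, ⟨_, hcard⟩, j, l), t, ξ, ?_, hj, hl, htU.1, htU.2, h1,
    h2⟩)
  intro i hi
  simpa using hi

end Generic

/-! ### Lipschitz functional calculus, traces and ranks of matrices -/

section MatrixInequalities

open scoped Matrix.Norms.L2Operator Matrix MatrixOrder

variable {r : ℕ}

theorem sum_norm_sq_entry_eq_trace (M : Matrix (Fin r) (Fin r) ℂ) :
    ((∑ i, ∑ j, ‖M i j‖ ^ 2 : ℝ) : ℂ) = (star M * M).trace := by
  rw [Finset.sum_comm]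
  simp only [Matrix.trace, Matrix.diag, Matrix.mul_apply, Matrix.star_apply]
  push_cast
  refine Finset.sum_congr rfl fun j _ => Finset.sum_congr rfl fun i _ => ?_
  rw [← Complex.conj_mul']; rfl

theorem sum_norm_sq_entry_mul_mul {U V : Matrix (Fin r) (Fin r) ℂ} (hU : star U * U = 1)
    (hV : V * star V = 1) (M : Matrix (Fin r) (Fin r) ℂ) :
    ∑ i, ∑ j, ‖(U * M * V) i j‖ ^ 2 = ∑ i, ∑ j, ‖M i j‖ ^ 2 := by
  have h : ((∑ i, ∑ j, ‖(U * M * V) i j‖ ^ 2 : ℝ) : ℂ)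
      = ((∑ i, ∑ j, ‖M i j‖ ^ 2 : ℝ) : ℂ) := by
    rw [sum_norm_sq_entry_eq_trace, sum_norm_sq_entry_eq_trace]
    have e : star (U * M * V) * (U * M * V) = star V * (star M * M) * V := by
      rw [star_mul, star_mul]
      calc _ = star V * (star M * (star U * U) * M) * V := by noncomm_ring
        _ = _ := by rw [hU, mul_one]
    rw [e, Matrix.trace_mul_comm, ← mul_assoc, hV, one_mul]
  exact_mod_cast h

/-- In eigenbases of `A` and `B` the entries of `f(A) - f(B)` are `(f(λᵢ) - f(μⱼ)) Mᵢⱼ` with `M`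
independent of `f`. Comparing with `f = id` entry by entry gives the bound in the Hilbert–Schmidt
norm, where the Lipschitz constant is preserved. -/
theorem sum_norm_sq_entry_cfc_sub_le {f : ℝ → ℝ} {L : NNReal} (hf : LipschitzWith L f)
    {A B : Matrix (Fin r) (Fin r) ℂ} (hA : A.IsHermitian) (hB : B.IsHermitian) :
    ∑ i, ∑ j, ‖(cfc f A - cfc f B) i j‖ ^ 2 ≤ (L : ℝ) ^ 2 * ∑ i, ∑ j, ‖(A - B) i j‖ ^ 2 := by
  obtain ⟨U, hU, hUU, hUU'⟩ : ∃ U : Matrix (Fin r) (Fin r) ℂ,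
      (hA.eigenvectorUnitary : Matrix (Fin r) (Fin r) ℂ) = U ∧ star U * U = 1 ∧ U * star U = 1 :=
    ⟨_, rfl, Unitary.coe_star_mul_self _, Unitary.coe_mul_star_self _⟩
  obtain ⟨V, hV, hVV, hVV'⟩ : ∃ V : Matrix (Fin r) (Fin r) ℂ,
      (hB.eigenvectorUnitary : Matrix (Fin r) (Fin r) ℂ) = V ∧ star V * V = 1 ∧ V * star V = 1 :=
    ⟨_, rfl, Unitary.coe_star_mul_self _, Unitary.coe_mul_star_self _⟩
  set M : Matrix (Fin r) (Fin r) ℂ := star U * V with hM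
  have key : ∀ f : ℝ → ℝ, ∑ i, ∑ j, ‖(hA.cfc f - hB.cfc f) i j‖ ^ 2
      = ∑ i, ∑ j, ‖((f (hA.eigenvalues i) - f (hB.eigenvalues j) : ℝ) : ℂ) * M i j‖ ^ 2 := by
    intro f
    rw [← sum_norm_sq_entry_mul_mul (U := star U) (V := V) (by rw [star_star]; exact hUU') hVV']
    have e : star U * (hA.cfc f - hB.cfc f) * V
        = Matrix.diagonal (fun i => ((f (hA.eigenvalues i) : ℝ) : ℂ)) * M
          - M * Matrix.diagonal (fun i => ((f (hB.eigenvalues i) : ℝ) : ℂ)) := by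
      rw [Matrix.IsHermitian.cfc, Matrix.IsHermitian.cfc, Unitary.conjStarAlgAut_apply,
        Unitary.conjStarAlgAut_apply, hU, hV, mul_sub, sub_mul]
      congr 1
      · calc _ = (star U * U) * Matrix.diagonal (fun i => ((f (hA.eigenvalues i) : ℝ) : ℂ)) *
                (star U * V) := by
              simp only [mul_assoc]; rfl
          _ = _ := by rw [hUU, one_mul]
      · calc _ = (star U * V) * Matrix.diagonal (fun i => ((f (hB.eigenvalues i) : ℝ) : ℂ)) *
                (star V * V) := by
              simp only [mul_assoc]; rfl
          _ = _ := by rw [hVV, mul_one]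
    rw [e]
    refine Finset.sum_congr rfl fun i _ => Finset.sum_congr rfl fun j _ => ?_
    rw [Matrix.sub_apply, Matrix.diagonal_mul, Matrix.mul_diagonal]
    push_cast
    congr 2
    ring
  have hid : hA.cfc (fun t => t) - hB.cfc (fun t => t) = A - B := by
    rw [← hA.cfc_eq, ← hB.cfc_eq, cfc_id' ℝ A, cfc_id' ℝ B]
  rw [hA.cfc_eq, hB.cfc_eq, key f, ← hid, key, Finset.mul_sum]
  refine Finset.sum_le_sum fun i _ => ?_
  rw [Finset.mul_sum]
  refine Finset.sum_le_sum fun j _ => ?_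
  rw [norm_mul, norm_mul, ← mul_pow, Complex.norm_real, Complex.norm_real, ← mul_assoc]
  refine pow_le_pow_left₀ (by positivity) ?_ 2
  exact mul_le_mul_of_nonneg_right (hf.norm_sub_le _ _) (norm_nonneg _)

/-- Equivalence of norms in finite dimension passes from the Hilbert–Schmidt to the operator norm.
The constant depends on `r`, but for Hausdorff dimension its size is irrelevant. -/
theorem exists_norm_cfc_sub_le (r : ℕ) {f : ℝ → ℝ} {L : NNReal} (hf : LipschitzWith L f) :
    ∃ K : NNReal, ∀ A B : Matrix (Fin r) (Fin r) ℂ, A.IsHermitian → B.IsHermitian →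
      ‖cfc f A - cfc f B‖ ≤ K * ‖A - B‖ := by
  let T : Matrix (Fin r) (Fin r) ℂ ≃ₗ[ℂ] EuclideanSpace ℂ (Fin r × Fin r) :=
    { toFun := fun M => WithLp.toLp 2 fun p => M p.1 p.2
      invFun := fun v => Matrix.of fun i j => v (i, j)
      map_add' := fun _ _ => rfl
      map_smul' := fun _ _ => rfl
      left_inv := fun _ => rfl
      right_inv := fun _ => rfl }
  have hT : ∀ M, ‖T M‖ ^ 2 = ∑ i, ∑ j, ‖M i j‖ ^ 2 := fun M => by
    rw [EuclideanSpace.norm_sq_eq, Fintype.sum_prod_type]; rfl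
  let T' := T.toContinuousLinearEquiv
  obtain ⟨K₁, h1⟩ : ∃ K, LipschitzWith K T := ⟨_, T'.toContinuousLinearMap.lipschitz⟩
  obtain ⟨K₂, h2⟩ : ∃ K, LipschitzWith K T.symm := ⟨_, T'.symm.toContinuousLinearMap.lipschitz⟩
  refine ⟨K₂ * L * K₁, fun A B hA hB => ?_⟩
  have e1 : ‖cfc f A - cfc f B‖ ≤ K₂ * ‖T (cfc f A - cfc f B)‖ := by
    have := h2.norm_sub_le (T (cfc f A)) (T (cfc f B))
    rwa [← map_sub T, T.symm_apply_apply] at this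
  have e2 : ‖T (cfc f A - cfc f B)‖ ≤ L * ‖T (A - B)‖ := by
    refine le_of_sq_le_sq ?_ (by positivity)
    rw [mul_pow, hT, hT]
    exact sum_norm_sq_entry_cfc_sub_le hf hA hB
  have e3 : ‖T (A - B)‖ ≤ K₁ * ‖A - B‖ := by
    have := h1.norm_sub_le A B
    rw [← map_sub] at this
    exact this
  rw [NNReal.coe_mul, NNReal.coe_mul]
  calc _ ≤ _ := e1
    _ ≤ K₂ * (L * (K₁ * ‖A - B‖)) := by gcongr; exact e2.trans (by gcongr)
    _ = _ := by rw [← mul_assoc, ← mul_assoc]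

theorem Matrix.trace_re_mono {M M' : Matrix (Fin r) (Fin r) ℂ} (h : M ≤ M') :
    M.trace.re ≤ M'.trace.re := by
  have := (Matrix.le_iff.1 h).trace_nonneg
  rw [Matrix.trace_sub] at this
  have := (Complex.le_def.1 this).1
  simpa using this

theorem Matrix.trace_re_le_rank {M : Matrix (Fin r) (Fin r) ℂ} (h0 : 0 ≤ M) (h1 : M ≤ 1) :
    M.trace.re ≤ M.rank := by
  have hM : M.IsHermitian := (Matrix.nonneg_iff_posSemidef.1 h0).1
  rw [hM.trace_eq_sum_eigenvalues, hM.rank_eq_card_non_zero_eigs, Fintype.card_subtype,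
    Finset.card_filter]
  push_cast
  rw [Complex.re_sum]
  refine Finset.sum_le_sum fun i _ => ?_
  have hle : hM.eigenvalues i ≤ 1 := by
    have h2 : M ≤ algebraMap ℝ _ 1 := by simpa using h1
    exact (le_algebraMap_iff_spectrum_le (ha := hM.isSelfAdjoint)).1 h2 _ (hM.eigenvalues_mem_spectrum_real i)
  by_cases h : hM.eigenvalues i = 0
  · simp [h]
  · simpa [h] using hle

theorem Matrix.trace_re_eq_rank {M : Matrix (Fin r) (Fin r) ℂ} (h : IsStarProjection M) :
    M.trace.re = M.rank := by
  have h1 : IsIdempotentElem (Matrix.toLin' M) := by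
    rw [IsIdempotentElem, Module.End.mul_eq_comp, ← Matrix.toLin'_mul, h.isIdempotentElem.eq]
  have h2 := ((LinearMap.isProj_range_iff_isIdempotentElem _).2 h1).trace
  rw [Matrix.trace_toLin'_eq] at h2
  rw [h2]
  rfl

theorem Matrix.trace_re_compress_le {P M : Matrix (Fin r) (Fin r) ℂ} (hP : IsStarProjection P)
    (hM : 0 ≤ M) : (P * M * P).trace.re ≤ M.trace.re := by
  have h1 : 0 ≤ star (1 - P) * M * (1 - P) := star_left_conjugate_nonneg hM _
  have h2 := Matrix.trace_re_mono h1
  rw [hP.one_sub.isSelfAdjoint.star_eq, Matrix.trace_mul_comm, ← mul_assoc,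
    hP.one_sub.isIdempotentElem.eq, sub_mul, Matrix.trace_sub, one_mul] at h2
  rw [Matrix.trace_mul_comm, ← mul_assoc, hP.isIdempotentElem.eq]
  simp at h2
  linarith

end MatrixInequalities

/-! ### Covering dimension and partitions of unity -/

section Covering

/-- Adjoin `Kᶜ` to open extensions of the cover, at index `0`; its shrinking misses `K` and can be
dropped. -/
theorem CoveringDimLE.of_isClosed {Y : Type*} [TopologicalSpace Y] {k : ℕ}
    (h : CoveringDimLE Y k) {K : Set Y} (hK : IsClosed K) : CoveringDimLE K k := by
  intro n U hU hcov
  choose O hO hOU using fun i => isOpen_induced_iff.1 (hU i)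
  obtain ⟨V, hV, hVO, hVcov, hcard⟩ := h (n + 1) (Fin.cons Kᶜ O)
    (fun i => by
      refine Fin.cases ?_ (fun i => ?_) i
      · simpa using hK.isOpen_compl
      · simpa using hO i)
    (by
      refine Set.eq_univ_of_forall fun y => Set.mem_iUnion.2 ?_
      by_cases hy : y ∈ K
      · obtain ⟨i, hi⟩ := Set.mem_iUnion.1 (hcov.symm ▸ Set.mem_univ (⟨y, hy⟩ : K))
        rw [← hOU i] at hi
        exact ⟨i.succ, by simpa using hi⟩
      · exact ⟨0, by simpa using hy⟩)
  refine ⟨fun i => Subtype.val ⁻¹' V i.succ, fun i => (hV _).preimage continuous_subtype_val,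
    fun i y hy => ?_, ?_, fun y => ?_⟩
  · rw [← hOU i]
    simpa using hVO i.succ hy
  · refine Set.eq_univ_of_forall fun y => Set.mem_iUnion.2 ?_
    obtain ⟨i, hi⟩ := Set.mem_iUnion.1 (hVcov.symm ▸ Set.mem_univ (y : Y))
    obtain rfl | ⟨i, rfl⟩ := Fin.eq_zero_or_eq_succ i
    · have := hVO 0 hi
      simp at this
    · exact ⟨i, hi⟩
  · refine le_trans ?_ (hcard y)
    rw [← Set.ncard_image_of_injective _ (Fin.succ_injective n)]
    refine Set.ncard_le_ncard ?_ (Set.toFinite _)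
    rintro _ ⟨i, hi, rfl⟩
    exact hi

/-- The partition of unity is subordinate to the shrunken cover, so the order bound on that cover
limits the number of nonzero values at each point. -/
theorem CoveringDimLE.exists_partition {X E : Type*} [TopologicalSpace X] [CompactSpace X]
    [T2Space X] [PseudoMetricSpace E] {d : ℕ} (hX : CoveringDimLE X d) (f : C(X, E)) {ε : ℝ}
    (hε : 0 < ε) :
    ∃ (N : ℕ) (y : Fin N → X) (φ : Fin N → C(X, ℝ)), (∀ i x, 0 ≤ φ i x) ∧
      (∀ x, ∑ i, φ i x = 1) ∧ (∀ x, (Finset.univ.filter fun i => φ i x ≠ 0).card ≤ d + 1) ∧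
      ∀ i x, φ i x ≠ 0 → dist (f x) (f (y i)) < ε := by
  obtain ⟨s, -, hs⟩ := isCompact_univ.elim_nhds_subcover
    (fun x => {z | dist (f z) (f x) < ε}) (fun x _ =>
      (isOpen_lt (by fun_prop) continuous_const).mem_nhds (by simpa using hε))
  let e := s.equivFin.symm
  obtain ⟨V, hV, hVU, hVcov, hcard⟩ := hX s.card
    (fun i => {z | dist (f z) (f (e i : X)) < ε})
    (fun i => isOpen_lt (by fun_prop) continuous_const)
    (by
      refine Set.eq_univ_of_forall fun z => Set.mem_iUnion.2 ?_
      obtain ⟨x, hx, hz⟩ := Set.mem_iUnion₂.1 (hs (Set.mem_univ z))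
      exact ⟨e.symm ⟨x, hx⟩, by simpa using hz⟩)
  obtain ⟨φ, hφ⟩ := PartitionOfUnity.exists_isSubordinate isClosed_univ V hV hVcov.ge
  have hmem : ∀ i x, φ i x ≠ 0 → x ∈ V i := fun i x h => hφ i (subset_tsupport _ h)
  refine ⟨s.card, fun i => e i, fun i => φ i, fun i x => φ.nonneg i x, fun x => ?_, fun x => ?_,
    fun i x h => hVU i (hmem i x h)⟩
  · rw [← finsum_eq_sum_of_fintype]
    exact φ.sum_eq_one (Set.mem_univ x)
  · refine le_trans ?_ (hcard x)
    rw [← Set.ncard_coe_finset]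
    refine Set.ncard_le_ncard (fun i hi => hmem i x ?_) (Set.toFinite _)
    simpa using hi

theorem norm_sum_smul_sub_le {E : Type*} [NormedAddCommGroup E] [NormedSpace ℝ E] {N : ℕ}
    {t : Fin N → ℝ} (ht0 : ∀ i, 0 ≤ t i) (ht1 : ∑ i, t i = 1) (v : Fin N → E) (w : E) {ε : ℝ}
    (h : ∀ i, t i ≠ 0 → ‖v i - w‖ ≤ ε) : ‖∑ i, t i • v i - w‖ ≤ ε := by
  have e : ∑ i, t i • v i - w = ∑ i, t i • (v i - w) := by
    simp only [smul_sub, Finset.sum_sub_distrib, ← Finset.sum_smul, ht1, one_smul]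
  rw [e]
  calc _ ≤ ∑ i, ‖t i • (v i - w)‖ := norm_sum_le _ _
    _ ≤ ∑ i, t i * ε := by
        refine Finset.sum_le_sum fun i _ => ?_
        rw [norm_smul, Real.norm_of_nonneg (ht0 i)]
        by_cases hi : t i = 0
        · simp [hi]
        · exact mul_le_mul_of_nonneg_left (h i hi) (ht0 i)
    _ = ε := by rw [← Finset.sum_mul, ht1, one_mul]

end Covering

/-! ### Lipschitz fields of matrices and uniform lower bounds -/

section PointwiseComparison

open scoped Matrix.Norms.L2Operator Matrix MatrixOrder

variable {r : ℕ}

theorem exists_lipschitzWith_cfc_sum {N : ℕ} (v : Fin N → Matrix (Fin r) (Fin r) ℂ)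
    (hv : ∀ i, 0 ≤ v i) {f : ℝ → ℝ} {L : NNReal} (hf : LipschitzWith L f) :
    ∃ K, LipschitzWith K (fun t : Fin N → ℝ => cfc f (∑ i, t i • v i)) := by
  obtain ⟨K, hK⟩ := exists_norm_cfc_sub_le r hf
  let B : (Fin N → ℝ) →ₗ[ℝ] Matrix (Fin r) (Fin r) ℂ :=
    { toFun := fun t => ∑ i, t i • v i
      map_add' := fun s t => by simp [add_smul, Finset.sum_add_distrib]
      map_smul' := fun c t => by simp [mul_smul, Finset.smul_sum] }
  have hB : ∀ t, (B t).IsHermitian := fun t => by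
    change IsSelfAdjoint (∑ i, t i • v i)
    exact isSelfAdjoint_sum _ fun i _ =>
      (IsSelfAdjoint.all (t i)).smul (IsSelfAdjoint.of_nonneg (hv i))
  obtain ⟨K', hK'⟩ : ∃ K', LipschitzWith K' B :=
    ⟨_, (LinearMap.toContinuousLinearMap B).lipschitz⟩
  refine ⟨K * K', LipschitzWith.of_dist_le_mul fun s t => ?_⟩
  rw [dist_eq_norm]
  refine (hK _ _ (hB s) (hB t)).trans ?_
  rw [NNReal.coe_mul, mul_assoc]
  gcongr
  rw [← dist_eq_norm]
  exact hK'.dist_le_mul s t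

theorem star_dotProduct_star_mul_self_mulVec (M : Matrix (Fin r) (Fin r) ℂ) (ζ : Fin r → ℂ) :
    star ζ ⬝ᵥ ((star M * M) *ᵥ ζ) = ((∑ i, ‖(M *ᵥ ζ) i‖ ^ 2 : ℝ) : ℂ) := by
  rw [← Matrix.mulVec_mulVec, Matrix.dotProduct_mulVec, Matrix.star_eq_conjTranspose,
    ← Matrix.star_mulVec]
  simp only [dotProduct, Pi.star_apply]
  push_cast
  refine Finset.sum_congr rfl fun i _ => ?_
  rw [← Complex.conj_mul']; rfl

theorem star_mul_self_le_of_forall {M M' : Matrix (Fin r) (Fin r) ℂ}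
    (h : ∀ ζ : Fin r → ℂ, ∑ i, ‖(M *ᵥ ζ) i‖ ^ 2 ≤ ∑ i, ‖(M' *ᵥ ζ) i‖ ^ 2) :
    star M * M ≤ star M' * M' := by
  rw [Matrix.le_iff]
  refine Matrix.PosSemidef.of_dotProduct_mulVec_nonneg ?_ fun ζ => ?_
  · exact (IsSelfAdjoint.star_mul_self M').sub (IsSelfAdjoint.star_mul_self M)
  · rw [Matrix.sub_mulVec, dotProduct_sub, star_dotProduct_star_mul_self_mulVec,
      star_dotProduct_star_mul_self_mulVec, ← Complex.ofReal_sub]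
    exact_mod_cast sub_nonneg.2 (h ζ)

/-- `|D x ξ|² + |T x ξ|²` is continuous and positive on the compact product of `X` with the unit
sphere; its minimum is `κ`. -/
theorem exists_pos_lower_bound {X : Type*} [TopologicalSpace X] [CompactSpace X]
    (D T : C(X, Matrix (Fin r) (Fin r) ℂ))
    (h : ∀ x ξ, D x *ᵥ ξ = 0 → T x *ᵥ ξ = 0 → ξ = 0) :
    ∃ κ > 0, ∀ x ξ, D x *ᵥ ξ = 0 → κ * ∑ i, ‖ξ i‖ ^ 2 ≤ ∑ i, ‖(T x *ᵥ ξ) i‖ ^ 2 := by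
  set nsq : (Fin r → ℂ) → ℝ := fun ξ => ∑ i, ‖ξ i‖ ^ 2 with hnsq
  have hnc : Continuous nsq := by rw [hnsq]; fun_prop
  have hn0 : ∀ ξ, 0 ≤ nsq ξ := fun ξ => by simp only [hnsq]; positivity
  have hnz : ∀ ξ, nsq ξ = 0 → ξ = 0 := by
    intro ξ hξ
    ext i
    have := (Finset.sum_eq_zero_iff_of_nonneg (fun i _ => by positivity)).1 hξ i (Finset.mem_univ i)
    simpa using this
  have hns : ∀ (c : ℝ) ξ, nsq ((c : ℂ) • ξ) = c ^ 2 * nsq ξ := by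
    intro c ξ
    simp [hnsq, Finset.mul_sum, mul_pow]
  have hcomp : IsCompact {ξ : Fin r → ℂ | nsq ξ = 1} := by
    refine Metric.isCompact_of_isClosed_isBounded (isClosed_eq hnc continuous_const) ?_
    refine (Metric.isBounded_closedBall (x := (0 : Fin r → ℂ)) (r := 1)).subset fun ξ hξ => ?_
    rw [mem_closedBall_zero_iff, pi_norm_le_iff_of_nonneg zero_le_one]
    intro i
    have h1 : ‖ξ i‖ ^ 2 ≤ nsq ξ :=
      Finset.single_le_sum (f := fun i => ‖ξ i‖ ^ 2) (fun i _ => by positivity) (Finset.mem_univ i)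
    have h2 : nsq ξ = 1 := hξ
    exact (sq_le_one_iff₀ (norm_nonneg _)).1 (h1.trans h2.le)
  let F : X × (Fin r → ℂ) → ℝ := fun p => nsq (D p.1 *ᵥ p.2) + nsq (T p.1 *ᵥ p.2)
  have hF : Continuous F := by
    refine (hnc.comp ?_).add (hnc.comp ?_)
    · exact ((D.continuous.comp continuous_fst).matrix_mulVec continuous_snd)
    · exact ((T.continuous.comp continuous_fst).matrix_mulVec continuous_snd)
  obtain ⟨κ, hκ, hle⟩ : ∃ κ > 0, ∀ x ξ, nsq ξ = 1 → κ ≤ F (x, ξ) := by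
    rcases ((Set.univ : Set X) ×ˢ {ξ : Fin r → ℂ | nsq ξ = 1}).eq_empty_or_nonempty with he | hne
    · refine ⟨1, one_pos, fun x ξ hξ => ?_⟩
      have : (x, ξ) ∈ (Set.univ : Set X) ×ˢ {ξ : Fin r → ℂ | nsq ξ = 1} := ⟨Set.mem_univ _, hξ⟩
      rw [he] at this
      exact this.elim
    · obtain ⟨⟨x₀, ξ₀⟩, hmem, hmin⟩ :=
        ((isCompact_univ (X := X)).prod hcomp).exists_isMinOn hne hF.continuousOn
      refine ⟨F (x₀, ξ₀), ?_, fun x ξ hξ => hmin ⟨Set.mem_univ x, hξ⟩⟩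
      have h0 : 0 ≤ F (x₀, ξ₀) := add_nonneg (hn0 _) (hn0 _)
      refine lt_of_le_of_ne h0 fun h0' => ?_
      have h1 := hn0 (D x₀ *ᵥ ξ₀)
      have h2 := hn0 (T x₀ *ᵥ ξ₀)
      have h3 : nsq (D x₀ *ᵥ ξ₀) + nsq (T x₀ *ᵥ ξ₀) = 0 := h0'.symm
      have h4 := h x₀ ξ₀ (hnz _ (by linarith)) (hnz _ (by linarith))
      have h5 : nsq ξ₀ = 1 := hmem.2
      rw [h4] at h5
      simp [hnsq] at h5
  refine ⟨κ, hκ, fun x ξ hξ => ?_⟩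
  change κ * nsq ξ ≤ nsq (T x *ᵥ ξ)
  rcases (hn0 ξ).eq_or_lt with h0 | h0
  · rw [← h0, mul_zero]; exact hn0 _
  · have hs : (Real.sqrt (nsq ξ))⁻¹ ^ 2 = (nsq ξ)⁻¹ := by
      rw [inv_pow, Real.sq_sqrt h0.le]
    have := hle x ((((Real.sqrt (nsq ξ))⁻¹ : ℝ) : ℂ) • ξ) (by
      rw [hns, hs, inv_mul_cancel₀ h0.ne'])
    simp only [F] at this
    rw [Matrix.mulVec_smul, Matrix.mulVec_smul, hξ, smul_zero, hns, hs] at this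
    have hz : nsq 0 = 0 := by simp [hnsq]
    rw [hz, zero_add, inv_mul_eq_div, le_div_iff₀ h0] at this
    exact this

end PointwiseComparison

/-! ### Operator inequalities from functional calculus -/

section CStarOrder

set_option linter.unusedSectionVars false

variable {A : Type*} [CStarAlgebra A] [PartialOrder A] [StarOrderedRing A]

theorem le_add_smul_one_of_norm_sub_le {a b : A} (ha : IsSelfAdjoint a) (hb : IsSelfAdjoint b)
    {ε : ℝ} (h : ‖a - b‖ ≤ ε) : a ≤ b + ε • (1 : A) := by
  have h1 := (ha.sub hb).le_algebraMap_norm_self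
  have h2 : algebraMap ℝ A ‖a - b‖ ≤ ε • 1 := by
    rw [Algebra.algebraMap_eq_smul_one]
    exact smul_le_smul_of_nonneg_right h zero_le_one
  exact sub_le_iff_le_add'.1 (h1.trans h2)

theorem cfc_sub_const_id {a : A} (ha : 0 ≤ a) (δ : ℝ) :
    cfc (fun s : ℝ => s - δ) a = a - δ • (1 : A) := by
  rw [cfc_sub (fun s : ℝ => s) (fun _ => δ) a (by fun_prop) (by fun_prop),
    cfc_id' ℝ a, cfc_const δ a, Algebra.algebraMap_eq_smul_one]

theorem cfc_cut_mul_cfc_cut_eq_zero {a : A} {θ : ℝ} (hθ : 0 < θ) :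
    cfc (fun s : ℝ => max (1 - s / θ) 0) a * cfc (fun s : ℝ => max (s - θ) 0) a = 0 := by
  rw [← cfc_mul _ _ a (by fun_prop) (by fun_prop), ← cfc_const_zero ℝ a]
  refine cfc_congr fun s _ => ?_
  rcases le_total s θ with hs | hs
  · have h : max (s - θ) 0 = 0 := max_eq_right (by linarith)
    simp [h]
  · have h : max (1 - s / θ) 0 = 0 := max_eq_right (by linarith [(one_le_div hθ).2 hs])
    simp [h]

/-- With `k = (s - θ)_+` this is the scalar inequality `k - ε/2 ≤ (2/ε) k²`. -/
theorem sub_smul_one_le_smul_cfc_mul_cfc {a : A} (ha : 0 ≤ a) (θ : ℝ) {ε : ℝ} (hε : 0 < ε) :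
    a - (θ + ε / 2) • (1 : A)
      ≤ (2 / ε) • (cfc (fun s : ℝ => max (s - θ) 0) a * cfc (fun s : ℝ => max (s - θ) 0) a) := by
  rw [← cfc_mul _ _ a (by fun_prop) (by fun_prop), ← cfc_smul _ _ a (by fun_prop),
    ← cfc_sub_const_id ha]
  refine cfc_mono (fun s _ => ?_) (by fun_prop) (by fun_prop)
  have h3 : s - θ ≤ max (s - θ) 0 := le_max_left _ _
  set k := max (s - θ) 0
  have h4 : k - ε / 2 ≤ 2 / ε * (k * k) := by
    rw [div_mul_eq_mul_div, le_div_iff₀ hε]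
    nlinarith [sq_nonneg (k - ε / 2), sq_nonneg k]
  rw [smul_eq_mul]
  linarith

/-- Where `(s - δ)_+` is nonzero, `s - 3δ/4 ≥ δ/4`. The room left below `3δ/4` absorbs the later
replacement of `a` by a nearby element. -/
theorem cfc_cut_mul_self_le {a : A} (ha : 0 ≤ a) {δ : ℝ} (hδ : 0 < δ) :
    cfc (fun s : ℝ => max (s - δ) 0) a * cfc (fun s : ℝ => max (s - δ) 0) a
      ≤ (4 / δ) • (cfc (fun s : ℝ => max (s - δ) 0) a * (a - (3 * δ / 4) • (1 : A))
        * cfc (fun s : ℝ => max (s - δ) 0) a) := by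
  rw [← cfc_sub_const_id ha, ← cfc_mul _ _ a (by fun_prop) (by fun_prop),
    ← cfc_mul _ _ a (by fun_prop) (by fun_prop), ← cfc_mul _ _ a (by fun_prop) (by fun_prop),
    ← cfc_smul _ _ a (by fun_prop)]
  refine cfc_mono (fun s _ => ?_) (by fun_prop) (by fun_prop)
  rw [smul_eq_mul]
  rcases le_total s δ with hs | hs
  · rw [max_eq_right (by linarith)]; simp
  · set c := max (s - δ) 0
    have h5 : 0 ≤ c * c := mul_self_nonneg _
    have h6 : 1 ≤ 4 / δ * (s - 3 * δ / 4) := by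
      rw [div_mul_eq_mul_div, le_div_iff₀ hδ]
      linarith
    calc c * c = 1 * (c * c) := (one_mul _).symm
      _ ≤ 4 / δ * (s - 3 * δ / 4) * (c * c) := by gcongr
      _ = _ := by ring

end CStarOrder

/-! ### Comparison over a space of finite covering dimension -/

section PointwiseComparison

open scoped Matrix.Norms.L2Operator Matrix MatrixOrder

variable {r : ℕ}

/-- For a positive contraction the rank is at least the trace. Compressing by `P` first makes the
loss `δ + ε` count only `tr P` times instead of `r` times, as a gap in normalized traces requires.
-/
theorem le_rank_cfc_sub {P b M : Matrix (Fin r) (Fin r) ℂ} (hP : IsStarProjection P)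
    (hb : 0 ≤ b) (hPb : P * b * P = b) (hM0 : 0 ≤ M) (hM1 : M ≤ 1) {δ ε : ℝ} (hδ : 0 < δ)
    (h : ‖M - b‖ ≤ ε) :
    b.trace.re - (δ + ε) * P.trace.re ≤ (cfc (fun s : ℝ => max (s - δ) 0) M).rank := by
  set C := cfc (fun s : ℝ => max (s - δ) 0) M
  have hC0 : 0 ≤ C := cfc_nonneg fun s _ => le_max_right _ _
  have hC1 : C ≤ 1 := by
    have : C ≤ cfc (fun s : ℝ => s) M := by
      refine cfc_mono (fun s hs => ?_) (by fun_prop) (by fun_prop)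
      have := spectrum_nonneg_of_nonneg hM0 hs
      exact max_le (by linarith) this
    rw [cfc_id' ℝ M] at this
    exact this.trans hM1
  have h1 : b - (δ + ε) • (1 : Matrix (Fin r) (Fin r) ℂ) ≤ C := by
    have h2 : cfc (fun s : ℝ => s - δ) M ≤ C :=
      cfc_mono (fun s _ => le_max_left _ _) (by fun_prop) (by fun_prop)
    rw [cfc_sub_const_id hM0] at h2
    have h3 := le_add_smul_one_of_norm_sub_le (IsSelfAdjoint.of_nonneg hb)
      (IsSelfAdjoint.of_nonneg hM0) ((norm_sub_rev _ _).trans_le h)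
    refine le_trans ?_ h2
    rw [sub_le_iff_le_add]
    refine h3.trans (le_of_eq ?_)
    rw [add_smul]; abel
  have h2 : P * (b - (δ + ε) • (1 : Matrix (Fin r) (Fin r) ℂ)) * P ≤ P * C * P := by
    have := star_left_conjugate_le_conjugate h1 P
    rwa [hP.isSelfAdjoint.star_eq] at this
  have h3 := Matrix.trace_re_mono h2
  have h4 := Matrix.trace_re_compress_le hP hC0
  have h5 := Matrix.trace_re_le_rank hC0 hC1
  rw [mul_sub, sub_mul, hPb, mul_smul_comm, smul_mul_assoc, mul_one,
    hP.isIdempotentElem.eq, Matrix.trace_sub, Matrix.trace_smul] at h3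
  simp only [Complex.sub_re, Complex.real_smul, Complex.re_ofReal_mul] at h3
  linarith

/-- `(1 - s/θ)_+ ≥ 1 - s/θ`, followed by trace at most rank. Equivalently, the kernel of `D`, the
spectral subspace of `M` for `[θ, ∞)`, has dimension at most about `tr g / θ`. -/
theorem le_rank_cfc_one_sub {g M : Matrix (Fin r) (Fin r) ℂ} (hg : 0 ≤ g) (hM0 : 0 ≤ M)
    {θ ε : ℝ} (hθ : 0 < θ) (h : ‖M - g‖ ≤ ε) :
    r - (g.trace.re + ε * r) / θ ≤ (cfc (fun s : ℝ => max (1 - s / θ) 0) M).rank := by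
  set D := cfc (fun s : ℝ => max (1 - s / θ) 0) M
  have hD0 : 0 ≤ D := cfc_nonneg fun s _ => le_max_right _ _
  have hD1 : D ≤ 1 := cfc_le_one _ _ fun s hs => by
    have := spectrum_nonneg_of_nonneg hM0 hs
    refine max_le ?_ zero_le_one
    have : 0 ≤ s / θ := by positivity
    linarith
  have h2 : cfc (fun s : ℝ => 1 - θ⁻¹ * s) M ≤ D :=
    cfc_mono (fun s _ => by
      rw [inv_mul_eq_div]; exact le_max_left _ _) (by fun_prop) (by fun_prop)
  rw [cfc_sub (fun _ => (1 : ℝ)) (fun s => θ⁻¹ * s) M (by fun_prop) (by fun_prop),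
    cfc_const_mul θ⁻¹ (fun s => s) M (by fun_prop), cfc_id' ℝ M,
    cfc_const (1 : ℝ) M, map_one] at h2
  have h3 := Matrix.trace_re_mono h2
  have h4 := Matrix.trace_re_mono (le_add_smul_one_of_norm_sub_le (IsSelfAdjoint.of_nonneg hM0)
    (IsSelfAdjoint.of_nonneg hg) h)
  have h5 := Matrix.trace_re_le_rank hD0 hD1
  rw [Matrix.trace_sub, Matrix.trace_smul, Matrix.trace_one] at h3
  rw [Matrix.trace_add, Matrix.trace_smul, Matrix.trace_one] at h4
  simp only [Complex.sub_re, Complex.add_re, Complex.real_smul, Complex.re_ofReal_mul,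
    Fintype.card_fin, Complex.natCast_re] at h3 h4
  refine le_trans ?_ (h3.trans h5)
  rw [div_eq_inv_mul]
  gcongr

theorem star_mul_self_le_smul_of_forall {M M' : Matrix (Fin r) (Fin r) ℂ} {κ : ℝ} (hκ : 0 < κ)
    (h : ∀ ζ : Fin r → ℂ, κ * ∑ i, ‖(M *ᵥ ζ) i‖ ^ 2 ≤ ∑ i, ‖(M' *ᵥ ζ) i‖ ^ 2) :
    star M * M ≤ κ⁻¹ • (star M' * M') := by
  have hs : κ⁻¹ • (star M' * M') = star (Real.sqrt κ⁻¹ • M') * (Real.sqrt κ⁻¹ • M') := by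
    rw [star_smul, star_trivial (Real.sqrt κ⁻¹), smul_mul_smul_comm, Real.mul_self_sqrt (by positivity)]
  rw [hs]
  refine star_mul_self_le_of_forall fun ζ => ?_
  rw [Matrix.smul_mulVec]
  simp only [Pi.smul_apply, norm_smul, mul_pow, ← Finset.mul_sum, Real.norm_eq_abs, sq_abs]
  rw [Real.sq_sqrt (by positivity), inv_mul_eq_div, le_div_iff₀ hκ, mul_comm]
  exact h ζ

/-- The three estimates chain together: `g - α` is controlled by `H* H`, that by `(C Wt H)* (C Wt
H)`, and `C²` by `C (b - β) C`. The constants combine into `K`, and `v = √K C Wt H`. -/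
theorem exists_continuous_dominating {X : Type*} [TopologicalSpace X]
    (g b C Wt H : C(X, Matrix (Fin r) (Fin r) ℂ)) {κ ε δ α β : ℝ} (hκ : 0 ≤ κ) (hε : 0 ≤ ε)
    (hδ : 0 ≤ δ) (hcc : ∀ x, IsSelfAdjoint (C x))
    (hHg : ∀ x, g x - α • (1 : Matrix (Fin r) (Fin r) ℂ) ≤ (2 / ε) • (star (H x) * H x))
    (hHH : ∀ x, star (H x) * H x ≤ κ⁻¹ • (star (C x * Wt x * H x) * (C x * Wt x * H x)))
    (hCb : ∀ x, C x * C x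
      ≤ (4 / δ) • (C x * (b x - β • (1 : Matrix (Fin r) (Fin r) ℂ)) * C x)) :
    ∃ v : C(X, Matrix (Fin r) (Fin r) ℂ), ∀ x, g x - α • (1 : Matrix (Fin r) (Fin r) ℂ)
        ≤ star (v x) * (b x - β • (1 : Matrix (Fin r) (Fin r) ℂ)) * v x := by
  set K : ℝ := 2 / ε * κ⁻¹ * (4 / δ) with hK
  have hK0 : 0 ≤ K := by positivity
  refine ⟨((Real.sqrt K : ℝ) : ℂ) • (C * Wt * H), fun x => ?_⟩
  have e : star ((((Real.sqrt K : ℝ) : ℂ) • (C * Wt * H)) x)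
      * (b x - β • (1 : Matrix (Fin r) (Fin r) ℂ)) * ((((Real.sqrt K : ℝ) : ℂ) • (C * Wt * H)) x)
      = K • (star (Wt x * H x) * (C x * (b x - β • (1 : Matrix (Fin r) (Fin r) ℂ)) * C x)
        * (Wt x * H x)) := by
    have e0 : (((Real.sqrt K : ℝ) : ℂ) • (C * Wt * H)) x
        = Real.sqrt K • (C x * (Wt x * H x)) := by
      change ((Real.sqrt K : ℝ) : ℂ) • (C x * Wt x * H x) = _
      rw [mul_assoc]
      ext i j
      simp [Matrix.smul_apply]
    rw [e0, star_smul, star_trivial (Real.sqrt K), star_mul, (hcc x).star_eq, smul_mul_assoc, smul_mul_assoc,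
      mul_smul_comm, smul_smul, Real.mul_self_sqrt hK0]
    congr 1
    noncomm_ring
  rw [e]
  have h1 := star_left_conjugate_le_conjugate (hCb x) (Wt x * H x)
  calc _ ≤ (2 / ε) • (star (H x) * H x) := hHg x
    _ ≤ (2 / ε) • κ⁻¹ • (star (C x * Wt x * H x) * (C x * Wt x * H x)) :=
        smul_le_smul_of_nonneg_left (hHH x) (by positivity)
    _ = (2 / ε) • κ⁻¹ • (star (Wt x * H x) * (C x * C x) * (Wt x * H x)) := by
        congr 2
        rw [mul_assoc (C x), star_mul, (hcc x).star_eq]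
        noncomm_ring
    _ ≤ (2 / ε) • κ⁻¹ • (star (Wt x * H x) * ((4 / δ) • (C x *
        (b x - β • (1 : Matrix (Fin r) (Fin r) ℂ)) * C x)) * (Wt x * H x)) :=
        smul_le_smul_of_nonneg_left (smul_le_smul_of_nonneg_left h1 (by positivity))
          (by positivity)
    _ = _ := by
        rw [mul_smul_comm, smul_mul_assoc, smul_smul, smul_smul, hK, ← mul_assoc]

/-- A comparison theorem over a space of covering dimension at most `d`: if the rank of `b` exceeds
the rank of `g` by a sufficiently large amount at every point, in the sense of traces, then
`g - (θ + ε)` is dominated by `v* (b - δ / 2) v` for some continuous `v`. -/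
theorem exists_pointwise_comparison {X : Type*} [TopologicalSpace X] [CompactSpace X] [T2Space X]
    {d : ℕ} (hX : CoveringDimLE X d) (P g b : C(X, Matrix (Fin r) (Fin r) ℂ))
    (hP : ∀ x, IsStarProjection (P x)) (hg : ∀ x, 0 ≤ g x) (hb0 : ∀ x, 0 ≤ b x)
    (hb1 : ∀ x, b x ≤ 1) (hPb : ∀ x, P x * b x * P x = b x) {θ δ ε : ℝ} (hθ : 0 < θ)
    (hδ : 0 < δ) (hε : 0 < ε)
    (h : ∀ x, (g x).trace.re / θ + (d + 1) ≤ (b x).trace.re - δ * (P x).trace.re) :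
    ∃ v : C(X, Matrix (Fin r) (Fin r) ℂ), ∀ x,
      g x - (θ + ε) • (1 : Matrix (Fin r) (Fin r) ℂ)
        ≤ star (v x) * (b x - (δ / 2) • (1 : Matrix (Fin r) (Fin r) ℂ)) * v x := by
  -- The two bounds by `1/8` keep the rank loss at `1/4`: the ranks add up to at least `r + d +
  -- 3/4`, and twice this exceeds `2r + d + 1` even for `d = 0`.
  obtain ⟨ε', hε', hε'δ, hε'ε, hε'θ, hε'r⟩ : ∃ ε' : ℝ, 0 < ε' ∧ ε' ≤ δ / 4 ∧ ε' ≤ ε / 2 ∧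
      ε' * r / θ ≤ 1 / 8 ∧ ε' * r ≤ 1 / 8 := by
    refine ⟨min (min (δ / 4) (ε / 2)) (min (θ / (8 * (r + 1))) (1 / (8 * (r + 1)))),
      by positivity, (min_le_left _ _).trans (min_le_left _ _),
      (min_le_left _ _).trans (min_le_right _ _), ?_, ?_⟩
    · have h1 : min (min (δ / 4) (ε / 2)) (min (θ / (8 * (r + 1))) (1 / (8 * ((r : ℝ) + 1))))
          ≤ θ / (8 * (r + 1)) := (min_le_right _ _).trans (min_le_left _ _)
      rw [div_le_iff₀ hθ]
      calc _ ≤ θ / (8 * (r + 1)) * r := by gcongr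
        _ ≤ 1 / 8 * θ := by
          rw [div_mul_eq_mul_div, div_le_iff₀ (by positivity)]
          nlinarith
    · have h1 : min (min (δ / 4) (ε / 2)) (min (θ / (8 * (r + 1))) (1 / (8 * ((r : ℝ) + 1))))
          ≤ 1 / (8 * (r + 1)) := (min_le_right _ _).trans (min_le_right _ _)
      calc _ ≤ 1 / (8 * ((r : ℝ) + 1)) * r := by gcongr
        _ ≤ 1 / 8 := by
          rw [div_mul_eq_mul_div, div_le_iff₀ (by positivity)]
          linarith
  obtain ⟨N, y, φ, hφ0, hφ1, hφc, hφd⟩ := hX.exists_partition (g.prodMk b) hε'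
  -- `c` isolates the large part of `b`; `f` and `k` have disjoint supports, so the range of `k(G)`
  -- lies in the kernel of `f(G)`.
  set c : ℝ → ℝ := fun s => max (s - δ) 0 with hc
  set f : ℝ → ℝ := fun s => max (1 - s / θ) 0 with hf
  set k : ℝ → ℝ := fun s => max (s - θ) 0 with hk
  have lip_sub : ∀ a : ℝ, LipschitzWith 1 (fun s : ℝ => max (s - a) 0) := fun a =>
    LipschitzWith.max_const (by
      refine LipschitzWith.of_dist_le_mul fun s t => ?_
      simp [Real.dist_eq]) 0
  have lip_f : LipschitzWith (Real.toNNReal θ⁻¹) f :=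
    LipschitzWith.max_const (by
      refine LipschitzWith.of_dist_le_mul fun s t => ?_
      rw [Real.dist_eq, Real.dist_eq, Real.coe_toNNReal _ (by positivity)]
      have e : 1 - s / θ - (1 - t / θ) = -(θ⁻¹ * (s - t)) := by
        rw [div_eq_mul_inv, div_eq_mul_inv]; ring
      rw [e, abs_neg, abs_mul, abs_of_pos (inv_pos.2 hθ)]) 0
  obtain ⟨KC, hKC⟩ := exists_lipschitzWith_cfc_sum (fun i => b (y i)) (fun i => hb0 _) (lip_sub δ)
  obtain ⟨KD, hKD⟩ := exists_lipschitzWith_cfc_sum (fun i => g (y i)) (fun i => hg _) lip_f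
  obtain ⟨KH, hKH⟩ := exists_lipschitzWith_cfc_sum (fun i => g (y i)) (fun i => hg _) (lip_sub θ)
  -- The fields are functions of the barycentric coordinates `t`, not of `x`, so genericity is
  -- applied in `ℝ^N` although `X` itself carries no metric.
  obtain ⟨W, hW⟩ := exists_generic_family hKC hKD d
  let t : X → Fin N → ℝ := fun x i => φ i x
  have htc : Continuous t := continuous_pi fun i => (φ i).continuous
  let B : X → Matrix (Fin r) (Fin r) ℂ := fun x => ∑ i, t x i • b (y i)
  let G : X → Matrix (Fin r) (Fin r) ℂ := fun x => ∑ i, t x i • g (y i)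
  let C : C(X, Matrix (Fin r) (Fin r) ℂ) := ⟨fun x => cfc c (B x), hKC.continuous.comp htc⟩
  let D : C(X, Matrix (Fin r) (Fin r) ℂ) := ⟨fun x => cfc f (G x), hKD.continuous.comp htc⟩
  let H : C(X, Matrix (Fin r) (Fin r) ℂ) := ⟨fun x => cfc k (G x), hKH.continuous.comp htc⟩
  let Wt : C(X, Matrix (Fin r) (Fin r) ℂ) := ⟨fun x => ∑ i, (t x i : ℂ) • W i, by fun_prop⟩
  have hB0 : ∀ x, 0 ≤ B x := fun x => Finset.sum_nonneg fun i _ => smul_nonneg (hφ0 i x) (hb0 _)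
  have hG0 : ∀ x, 0 ≤ G x := fun x => Finset.sum_nonneg fun i _ => smul_nonneg (hφ0 i x) (hg _)
  have hB1 : ∀ x, B x ≤ 1 := fun x => by
    calc B x ≤ ∑ i, t x i • (1 : Matrix (Fin r) (Fin r) ℂ) :=
          Finset.sum_le_sum fun i _ => smul_le_smul_of_nonneg_left (hb1 _) (hφ0 i x)
      _ = 1 := by rw [← Finset.sum_smul, hφ1 x, one_smul]
  have hGn : ∀ x, ‖G x - g x‖ ≤ ε' := fun x =>
    norm_sum_smul_sub_le (fun i => hφ0 i x) (hφ1 x) _ _ fun i hi => by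
      rw [← dist_eq_norm, dist_comm]
      exact (le_max_left _ _).trans (hφd i x hi).le
  have hBn : ∀ x, ‖B x - b x‖ ≤ ε' := fun x =>
    norm_sum_smul_sub_le (fun i => hφ0 i x) (hφ1 x) _ _ fun i hi => by
      rw [← dist_eq_norm, dist_comm]
      exact (le_max_right _ _).trans (hφd i x hi).le
  have hcc : ∀ x, IsSelfAdjoint (C x) := fun x => cfc_predicate c (B x)
  have hHsa : ∀ x, IsSelfAdjoint (H x) := fun x => cfc_predicate k (G x)
  have hCrank : ∀ x, (b x).trace.re - (δ + ε') * (P x).trace.re ≤ (C x).rank := fun x =>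
    le_rank_cfc_sub (hP x) (hb0 x) (hPb x) (hB0 x) (hB1 x) hδ (hBn x)
  have hDrank : ∀ x, r - ((g x).trace.re + ε' * r) / θ ≤ (D x).rank := fun x =>
    le_rank_cfc_one_sub (hg x) (hG0 x) hθ (hGn x)
  have hPr : ∀ x, (P x).trace.re ≤ r := by
    intro x
    have h1 := Matrix.trace_re_mono (sub_nonneg.1 (hP x).one_sub.nonneg)
    simpa using h1
  have hinj : ∀ x ξ, D x *ᵥ ξ = 0 → (C * Wt) x *ᵥ ξ = 0 → ξ = 0 := by
    intro x ξ h1 h2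
    refine hW (t x) ?_ (hφc x) ?_ ξ h1 ?_
    · intro h0
      have := hφ1 x
      have h0' : ∀ i, φ i x = 0 := fun i => congrFun h0 i
      simp [h0'] at this
    · have e1 := hCrank x
      have e2 := hDrank x
      have e3 := h x
      have e4 : ε' * (P x).trace.re ≤ 1 / 8 :=
        (mul_le_mul_of_nonneg_left (hPr x) hε'.le).trans hε'r
      rw [add_div] at e2
      have e5 : (r : ℝ) + d + 3 / 4 ≤ (C x).rank + (D x).rank := by linarith
      have e6 : (2 : ℝ) * r + d + 1 < 2 * (C x).rank + 2 * (D x).rank := by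
        have : (0 : ℝ) ≤ d := by positivity
        linarith
      have e7 : 2 * r + d + 1 < 2 * (C x).rank + 2 * (D x).rank := by exact_mod_cast e6
      exact e7
    · rw [Matrix.mulVec_mulVec]
      exact h2
  obtain ⟨κ, hκ, hκle⟩ := exists_pos_lower_bound D (C * Wt) hinj
  have hDH : ∀ x, D x * H x = 0 := fun x => cfc_cut_mul_cfc_cut_eq_zero hθ
  have hHH : ∀ x, star (H x) * H x ≤ κ⁻¹ • (star (C x * Wt x * H x) * (C x * Wt x * H x)) := by
    intro x
    refine star_mul_self_le_smul_of_forall hκ fun ζ => ?_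
    -- The lower bound on the kernel of `D x` is applied to the vectors `H x ζ`, which lie there
    -- because `D H = 0`.
    have h1 := hκle x (H x *ᵥ ζ) (by rw [Matrix.mulVec_mulVec, hDH, Matrix.zero_mulVec])
    rwa [Matrix.mulVec_mulVec] at h1
  have hHg : ∀ x, g x - (θ + ε) • (1 : Matrix (Fin r) (Fin r) ℂ)
      ≤ (2 / ε) • (star (H x) * H x) := by
    intro x
    have h1 := le_add_smul_one_of_norm_sub_le (IsSelfAdjoint.of_nonneg (hg x))
      (IsSelfAdjoint.of_nonneg (hG0 x)) ((norm_sub_rev _ _).trans_le (hGn x))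
    have h5 : ε' • (1 : Matrix (Fin r) (Fin r) ℂ) ≤ (ε / 2) • 1 :=
      smul_le_smul_of_nonneg_right hε'ε zero_le_one
    have h6 := sub_smul_one_le_smul_cfc_mul_cfc (hG0 x) θ hε
    have e : H x = cfc (fun s : ℝ => max (s - θ) 0) (G x) := rfl
    rw [(hHsa x).star_eq, e]
    refine le_trans ?_ h6
    rw [sub_le_iff_le_add]
    refine h1.trans ((add_le_add le_rfl h5).trans (le_of_eq ?_))
    have : θ + ε = (θ + ε / 2) + ε / 2 := by ring
    rw [this, add_smul (θ + ε / 2)]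
    abel
  have hCb : ∀ x, C x * C x
      ≤ (4 / δ) • (C x * (b x - (δ / 2) • (1 : Matrix (Fin r) (Fin r) ℂ)) * C x) := by
    intro x
    have h1 := le_add_smul_one_of_norm_sub_le (IsSelfAdjoint.of_nonneg (hB0 x))
      (IsSelfAdjoint.of_nonneg (hb0 x)) (hBn x)
    have h2 : B x - (3 * δ / 4) • (1 : Matrix (Fin r) (Fin r) ℂ) ≤ b x - (δ / 2) • 1 := by
      have h5 : ε' • (1 : Matrix (Fin r) (Fin r) ℂ) ≤ (δ / 4) • 1 :=
        smul_le_smul_of_nonneg_right hε'δ zero_le_one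
      rw [sub_le_iff_le_add]
      refine h1.trans ((add_le_add le_rfl h5).trans (le_of_eq ?_))
      have : 3 * δ / 4 = δ / 2 + δ / 4 := by ring
      rw [this, add_smul]
      abel
    have h3 := star_left_conjugate_le_conjugate h2 (C x)
    rw [(hcc x).star_eq] at h3
    exact (cfc_cut_mul_self_le (hB0 x) hδ).trans
      (smul_le_smul_of_nonneg_left h3 (by positivity))
  exact exists_continuous_dominating g b C Wt H hκ.le hε.le hδ.le hcc hHg hHH hCb

end PointwiseComparison

/-! ### Corner algebras and their fiber traces -/

section Corner

set_option linter.unusedSectionVars false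

open scoped Matrix.Norms.L2Operator Matrix MatrixOrder

theorem Matrix.trace_re_le_norm_mul {r : ℕ} {P m : Matrix (Fin r) (Fin r) ℂ}
    (hP : IsStarProjection P) (hm : P * m * P = m) : m.trace.re ≤ ‖m‖ * P.trace.re := by
  have hsa : IsSelfAdjoint (m + star m) := IsSelfAdjoint.add_star_self m
  have h1 := hsa.le_algebraMap_norm_self
  have h2 : algebraMap ℝ (Matrix (Fin r) (Fin r) ℂ) ‖m + star m‖ ≤ (2 * ‖m‖) • 1 := by
    rw [Algebra.algebraMap_eq_smul_one]
    refine smul_le_smul_of_nonneg_right ((norm_add_le _ _).trans ?_) zero_le_one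
    rw [norm_star, two_mul]
  have h3 := star_left_conjugate_le_conjugate (h1.trans h2) P
  have hm' : P * star m * P = star m := by
    have := congrArg star hm
    rwa [star_mul, star_mul, hP.isSelfAdjoint.star_eq, ← mul_assoc] at this
  rw [hP.isSelfAdjoint.star_eq, mul_add, add_mul, hm, hm', mul_smul_comm, smul_mul_assoc, mul_one,
    hP.isIdempotentElem.eq] at h3
  have h4 := Matrix.trace_re_mono h3
  rw [Matrix.trace_add, Matrix.star_eq_conjTranspose, Matrix.trace_conjTranspose,
    Matrix.trace_smul] at h4
  simp only [Complex.add_re, Complex.star_def, Complex.conj_re, Complex.real_smul,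
    Complex.re_ofReal_mul] at h4
  linarith

theorem Matrix.norm_trace_le {r : ℕ} {P m : Matrix (Fin r) (Fin r) ℂ}
    (hP : IsStarProjection P) (hm : P * m * P = m) : ‖m.trace‖ ≤ 2 * ‖m‖ * P.trace.re := by
  have key : ∀ c : ℂ, ‖c‖ = 1 → (c * m.trace).re ≤ ‖m‖ * P.trace.re := by
    intro c hc
    have := Matrix.trace_re_le_norm_mul (m := c • m) hP
      (by rw [mul_smul_comm, smul_mul_assoc, hm])
    rwa [Matrix.trace_smul, norm_smul, hc, one_mul, smul_eq_mul] at this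
  have h1 := key 1 (by simp)
  have h2 := key (-1) (by simp)
  have h3 := key Complex.I (by simp)
  have h4 := key (-Complex.I) (by simp)
  simp at h1 h2 h3 h4
  have h5 := Complex.norm_le_abs_re_add_abs_im m.trace
  have h6 : |m.trace.re| ≤ ‖m‖ * P.trace.re := abs_le.2 ⟨by linarith, h1⟩
  have h7 : |m.trace.im| ≤ ‖m‖ * P.trace.re := abs_le.2 ⟨by linarith, by linarith⟩
  linarith

variable {A : Type*} [CStarAlgebra A] {X : Type*} [TopologicalSpace X] {r : ℕ}
  {P : C(X, Matrix (Fin r) (Fin r) ℂ)} {hP : IsStarProjection P}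

theorem IsStarProjection.apply (hP : IsStarProjection P) (x : X) : IsStarProjection (P x) :=
  ⟨congrArg (fun q : C(X, Matrix (Fin r) (Fin r) ℂ) => q x) hP.isIdempotentElem.eq,
    congrArg (fun q : C(X, Matrix (Fin r) (Fin r) ℂ) => q x) hP.isSelfAdjoint.star_eq⟩

theorem cornerAlg.compress_apply (m : cornerAlg P hP) (x : X) :
    P x * (m : C(X, Matrix (Fin r) (Fin r) ℂ)) x * P x
      = (m : C(X, Matrix (Fin r) (Fin r) ℂ)) x := by
  have h1 : P * (m : C(X, Matrix (Fin r) (Fin r) ℂ)) = m := m.2.1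
  have h2 : (m : C(X, Matrix (Fin r) (Fin r) ℂ)) * P = m := m.2.2
  have h : P * (m : C(X, Matrix (Fin r) (Fin r) ℂ)) * P = m := by rw [h1, h2]
  exact congrArg (fun q : C(X, Matrix (Fin r) (Fin r) ℂ) => q x) h

set_option synthInstance.maxHeartbeats 2000000 in
set_option maxHeartbeats 2000000 in
noncomputable instance cornerAlg.instModule : Module ℂ (cornerAlg P hP) := inferInstance

noncomputable instance cornerAlg.instSMul : SMul ℂ (cornerAlg P hP) := inferInstance

/-- The unit of the corner algebra. -/
def cornerUnit (P : C(X, Matrix (Fin r) (Fin r) ℂ)) (hP : IsStarProjection P) : cornerAlg P hP :=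
  ⟨P, hP.isIdempotentElem.eq, hP.isIdempotentElem.eq⟩

/-- The compression of an element to the corner algebra. -/
noncomputable def cornerCompress (P : C(X, Matrix (Fin r) (Fin r) ℂ)) (hP : IsStarProjection P)
    (m : C(X, Matrix (Fin r) (Fin r) ℂ)) : cornerAlg P hP :=
  ⟨P * m * P, by
    change P * (P * m * P) = _
    rw [← mul_assoc, ← mul_assoc, hP.isIdempotentElem.eq], by
    change (P * m * P) * P = _
    rw [mul_assoc, hP.isIdempotentElem.eq]⟩

theorem cornerUnit_mul (m : cornerAlg P hP) : cornerUnit P hP * m = m := Subtype.ext m.2.1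

theorem mul_cornerUnit (m : cornerAlg P hP) : m * cornerUnit P hP = m := Subtype.ext m.2.2

theorem isClosed_cornerAlg [CompactSpace X] :
    IsClosed (cornerAlg P hP : Set C(X, Matrix (Fin r) (Fin r) ℂ)) := by
  have h1 : IsClosed {m : C(X, Matrix (Fin r) (Fin r) ℂ) | P * m = m} :=
    isClosed_eq (by fun_prop) continuous_id
  have h2 : IsClosed {m : C(X, Matrix (Fin r) (Fin r) ℂ) | m * P = m} :=
    isClosed_eq (by fun_prop) continuous_id
  exact h1.inter h2

variable [CompactSpace X] {C : NonUnitalStarSubalgebra ℂ A} (φ : C ≃⋆ₐ[ℂ] cornerAlg P hP)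

theorem norm_corner_apply_le (hC : IsClosed (C : Set A)) (c : C) (x : X) :
    ‖(φ c : C(X, Matrix (Fin r) (Fin r) ℂ)) x‖ ≤ ‖(c : A)‖ := by
  have := hC
  have : IsClosed (cornerAlg P hP : Set C(X, Matrix (Fin r) (Fin r) ℂ)) := isClosed_cornerAlg
  have h : ‖φ c‖ ≤ ‖c‖ := NonUnitalStarAlgHom.norm_apply_le φ c
  exact (ContinuousMap.norm_coe_le_norm _ x).trans h

theorem norm_corner_symm_le (hC : IsClosed (C : Set A)) (m : cornerAlg P hP) :
    ‖((φ.symm m : C) : A)‖ ≤ ‖(m : C(X, Matrix (Fin r) (Fin r) ℂ))‖ := by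
  have := hC
  have : IsClosed (cornerAlg P hP : Set C(X, Matrix (Fin r) (Fin r) ℂ)) := isClosed_cornerAlg
  exact NonUnitalStarAlgHom.norm_apply_le φ.symm m

theorem corner_apply_eq_unit {q : C} (hq : ∀ c : C, q * c = c) : φ q = cornerUnit P hP := by
  have h := congrArg φ (hq (φ.symm (cornerUnit P hP)))
  rw [map_mul, φ.apply_symm_apply, mul_cornerUnit] at h
  exact h

theorem isStarProjection_corner_symm_unit :
    IsStarProjection ((φ.symm (cornerUnit P hP) : C) : A) := by
  constructor
  · change ((φ.symm (cornerUnit P hP) * φ.symm (cornerUnit P hP) : C) : A) = _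
    rw [← map_mul, cornerUnit_mul]
  · change ((star (φ.symm (cornerUnit P hP)) : C) : A) = _
    rw [← map_star]
    have : star (cornerUnit P hP) = cornerUnit P hP := Subtype.ext hP.isSelfAdjoint.star_eq
    rw [this]

theorem corner_symm_compress (m : cornerAlg P hP) :
    ((φ.symm (cornerUnit P hP) : C) : A) * (φ.symm m : C) * (φ.symm (cornerUnit P hP) : C)
      = (φ.symm m : C) := by
  change ((φ.symm (cornerUnit P hP) * φ.symm m * φ.symm (cornerUnit P hP) : C) : A) = _
  rw [← map_mul, ← map_mul, cornerUnit_mul, mul_cornerUnit]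

/-- Positivity is transported through norms: `q ≥ 0` and `K = ‖q‖` give `‖K u - q‖ ≤ K`, the
contractive inverse of `φ` preserves this, and compressing the resulting inequality by `p` gives
back positivity. -/
theorem corner_symm_nonneg [PartialOrder A] [StarOrderedRing A] (hC : IsClosed (C : Set A))
    {q : cornerAlg P hP} (hq : ∀ x, 0 ≤ (q : C(X, Matrix (Fin r) (Fin r) ℂ)) x) :
    0 ≤ ((φ.symm q : C) : A) := by
  set K : ℝ := ‖(q : C(X, Matrix (Fin r) (Fin r) ℂ))‖ with hK
  have hK0 : 0 ≤ K := norm_nonneg _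
  set u := cornerUnit P hP
  set p : A := ((φ.symm u : C) : A) with hp
  have hpp : IsStarProjection p := isStarProjection_corner_symm_unit φ
  have hn : ‖(((K : ℂ) • u + (-1 : ℂ) • q : cornerAlg P hP) : C(X, Matrix (Fin r) (Fin r) ℂ))‖ ≤ K := by
    rw [ContinuousMap.norm_le _ hK0]
    intro x
    have hPx := hP.apply x
    have h1 : (q : C(X, Matrix (Fin r) (Fin r) ℂ)) x ≤ K • (1 : Matrix (Fin r) (Fin r) ℂ) := by
      refine (IsSelfAdjoint.of_nonneg (hq x)).le_algebraMap_norm_self.trans ?_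
      rw [Algebra.algebraMap_eq_smul_one]
      exact smul_le_smul_of_nonneg_right (ContinuousMap.norm_coe_le_norm _ x) zero_le_one
    have h2 := star_left_conjugate_le_conjugate h1 (P x)
    rw [hPx.isSelfAdjoint.star_eq, cornerAlg.compress_apply, mul_smul_comm, smul_mul_assoc,
      mul_one, hPx.isIdempotentElem.eq] at h2
    have e : (((K : ℂ) • u + (-1 : ℂ) • q : cornerAlg P hP) : C(X, Matrix (Fin r) (Fin r) ℂ)) x
        = K • P x - (q : C(X, Matrix (Fin r) (Fin r) ℂ)) x := by
      change (K : ℂ) • P x + (-1 : ℂ) • (q : C(X, Matrix (Fin r) (Fin r) ℂ)) x = _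
      rw [Complex.coe_smul, neg_one_smul, sub_eq_add_neg]
    rw [e]
    rw [CStarAlgebra.norm_le_iff_le_algebraMap _ hK0 (sub_nonneg.2 h2),
      Algebra.algebraMap_eq_smul_one]
    refine (sub_le_self _ (hq x)).trans ?_
    exact smul_le_smul_of_nonneg_left (sub_nonneg.1 hPx.one_sub.nonneg) hK0
  have h1 := (norm_corner_symm_le φ hC ((K : ℂ) • u + (-1 : ℂ) • q)).trans hn
  have e : ((φ.symm ((K : ℂ) • u + (-1 : ℂ) • q) : C) : A) = K • p - (φ.symm q : C) := by
    have hs : φ.symm ((K : ℂ) • u + (-1 : ℂ) • q) = (K : ℂ) • φ.symm u + (-1 : ℂ) • φ.symm q := by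
      have h1 : φ.symm ((K : ℂ) • u + (-1 : ℂ) • q)
          = φ.symm ((K : ℂ) • u) + φ.symm ((-1 : ℂ) • q) := φ.symm.map_add' _ _
      have h2 : φ.symm ((K : ℂ) • u) = (K : ℂ) • φ.symm u := φ.symm.map_smul' _ _
      have h3 : φ.symm ((-1 : ℂ) • q) = (-1 : ℂ) • φ.symm q := φ.symm.map_smul' _ _
      rw [h1, h2, h3]
    rw [hs]
    change (K : ℂ) • p + (-1 : ℂ) • ((φ.symm q : C) : A) = _
    rw [Complex.coe_smul, neg_one_smul, sub_eq_add_neg]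
  rw [e] at h1
  have hqs : IsSelfAdjoint ((φ.symm q : C) : A) := by
    change ((star (φ.symm q) : C) : A) = _
    rw [← map_star]
    have : star q = q := Subtype.ext (ContinuousMap.ext fun x => (IsSelfAdjoint.of_nonneg (hq x)))
    rw [this]
  have hsa : IsSelfAdjoint (K • p - (φ.symm q : C)) :=
    ((IsSelfAdjoint.all K).smul hpp.isSelfAdjoint).sub hqs
  have h2 : K • p - (φ.symm q : C) ≤ K • (1 : A) := by
    refine hsa.le_algebraMap_norm_self.trans ?_
    rw [Algebra.algebraMap_eq_smul_one]
    exact smul_le_smul_of_nonneg_right h1 zero_le_one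
  have h3 := star_left_conjugate_le_conjugate h2 p
  rw [hpp.isSelfAdjoint.star_eq, mul_sub, sub_mul, mul_smul_comm, smul_mul_assoc, mul_smul_comm,
    smul_mul_assoc, mul_one, hpp.isIdempotentElem.eq, hpp.isIdempotentElem.eq] at h3
  have h4 : p * (φ.symm q : C) * p = ((φ.symm q : C) : A) := corner_symm_compress φ q
  rw [h4] at h3
  simpa using h3

/-- The normalized trace at a point. -/
noncomputable def fiberTrace (x : X) : C →ₗ[ℂ] ℂ where
  toFun c := ((((P x).trace.re)⁻¹ : ℝ) : ℂ) * ((φ c : C(X, Matrix (Fin r) (Fin r) ℂ)) x).trace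
  map_add' c d := by
    have h : φ (c + d) = φ c + φ d := map_add φ c d
    rw [h, ← mul_add, ← Matrix.trace_add]; rfl
  map_smul' k c := by
    have h : φ (k • c) = k • φ c := φ.map_smul' k c
    rw [h, RingHom.id_apply, smul_eq_mul, mul_left_comm, ← smul_eq_mul (a := k),
      ← Matrix.trace_smul]; rfl

theorem fiberTrace_apply (x : X) (c : C) : fiberTrace φ x c
    = ((((P x).trace.re)⁻¹ : ℝ) : ℂ) * ((φ c : C(X, Matrix (Fin r) (Fin r) ℂ)) x).trace := rfl

theorem fiberTrace_re (x : X) (c : C) : (fiberTrace φ x c).re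
    = ((φ c : C(X, Matrix (Fin r) (Fin r) ℂ)) x).trace.re / (P x).trace.re := by
  rw [fiberTrace_apply, Complex.re_ofReal_mul, inv_mul_eq_div]

theorem fiberTrace_mul_comm (x : X) (c d : C) :
    fiberTrace φ x (c * d) = fiberTrace φ x (d * c) := by
  have h1 : φ (c * d) = φ c * φ d := map_mul φ c d
  have h2 : φ (d * c) = φ d * φ c := map_mul φ d c
  rw [fiberTrace_apply, fiberTrace_apply, h1, h2]
  congr 1
  exact Matrix.trace_mul_comm ((φ c : C(X, Matrix (Fin r) (Fin r) ℂ)) x)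
    ((φ d : C(X, Matrix (Fin r) (Fin r) ℂ)) x)

theorem fiberTrace_star_mul_self_nonneg {x : X} (c : C) (h : 0 < (P x).trace.re) :
    0 ≤ fiberTrace φ x (star c * c) := by
  rw [fiberTrace_apply]
  refine mul_nonneg (by exact_mod_cast (inv_pos.2 h).le) ?_
  have h1 : φ (star c * c) = star (φ c) * φ c := by rw [map_mul, map_star]
  rw [h1]
  exact (Matrix.nonneg_iff_posSemidef.1 (star_mul_self_nonneg
    ((φ c : C(X, Matrix (Fin r) (Fin r) ℂ)) x))).trace_nonneg

theorem norm_fiberTrace_le (hC : IsClosed (C : Set A)) {x : X} (h : 0 < (P x).trace.re) (c : C) :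
    ‖fiberTrace φ x c‖ ≤ 2 * ‖(c : A)‖ := by
  rw [fiberTrace_apply]
  rw [norm_mul, Complex.norm_real, Real.norm_of_nonneg (inv_pos.2 h).le, inv_mul_le_iff₀ h]
  have h1 := Matrix.norm_trace_le (hP.apply x) (cornerAlg.compress_apply (φ c) x)
  have h2 := norm_corner_apply_le φ hC c x
  calc _ ≤ _ := h1
    _ ≤ 2 * ‖(c : A)‖ * (P x).trace.re := by gcongr
    _ = _ := by ring

theorem fiberTrace_unit {x : X} (h : 0 < (P x).trace.re) {q : C} (hq : ∀ c : C, q * c = c) :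
    fiberTrace φ x q = 1 := by
  rw [fiberTrace_apply, corner_apply_eq_unit φ hq]
  change ((((P x).trace.re)⁻¹ : ℝ) : ℂ) * (P x).trace = 1
  have h1 : (P x).trace = ((P x).trace.re : ℂ) := by
    have := (Complex.le_def.1 (Matrix.nonneg_iff_posSemidef.1 (hP.apply x).nonneg).trace_nonneg).2
    exact Complex.ext (by simp) (by simpa using this.symm)
  rw [h1, Complex.ofReal_re, ← Complex.ofReal_mul, inv_mul_cancel₀ h.ne', Complex.ofReal_one]

end Corner

/-! ### Matrix-valued functions as elements of `A` -/

section CornerLift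

set_option linter.unusedSectionVars false

open scoped Matrix.Norms.L2Operator Matrix MatrixOrder

variable {A : Type*} [CStarAlgebra A] {X : Type*} [TopologicalSpace X] [CompactSpace X] {r : ℕ}
  {P : C(X, Matrix (Fin r) (Fin r) ℂ)} {hP : IsStarProjection P}
  {C : NonUnitalStarSubalgebra ℂ A} (φ : C ≃⋆ₐ[ℂ] cornerAlg P hP)

/-- The element of `A` that corresponds to the compression of a matrix-valued function. -/
noncomputable def cornerLift : C(X, Matrix (Fin r) (Fin r) ℂ) →ₗ[ℂ] A where
  toFun m := ((φ.symm (cornerCompress P hP m) : C) : A)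
  map_add' m n := by
    have h : cornerCompress P hP (m + n) = cornerCompress P hP m + cornerCompress P hP n :=
      Subtype.ext (by change P * (m + n) * P = P * m * P + P * n * P; rw [mul_add, add_mul])
    have h1 : φ.symm (cornerCompress P hP m + cornerCompress P hP n)
        = φ.symm (cornerCompress P hP m) + φ.symm (cornerCompress P hP n) := φ.symm.map_add' _ _
    rw [h, h1]; rfl
  map_smul' k m := by
    have h : cornerCompress P hP (k • m) = k • cornerCompress P hP m :=
      Subtype.ext (by change P * (k • m) * P = k • (P * m * P); rw [mul_smul_comm, smul_mul_assoc])
    have h1 : φ.symm (k • cornerCompress P hP m) = k • φ.symm (cornerCompress P hP m) :=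
      φ.symm.map_smul' _ _
    rw [h, h1]; rfl

theorem cornerLift_apply (m : C(X, Matrix (Fin r) (Fin r) ℂ)) :
    cornerLift φ m = ((φ.symm (cornerCompress P hP m) : C) : A) := rfl

theorem cornerLift_corner (c : C) :
    cornerLift φ (φ c : C(X, Matrix (Fin r) (Fin r) ℂ)) = (c : A) := by
  have h : cornerCompress P hP (φ c : C(X, Matrix (Fin r) (Fin r) ℂ)) = φ c :=
    Subtype.ext (ContinuousMap.ext fun x => cornerAlg.compress_apply (φ c) x)
  rw [cornerLift_apply, h, φ.symm_apply_apply]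

theorem cornerLift_mul (m n : C(X, Matrix (Fin r) (Fin r) ℂ)) :
    cornerLift φ m * cornerLift φ n = cornerLift φ (m * P * n) := by
  have h : cornerCompress P hP (m * P * n) = cornerCompress P hP m * cornerCompress P hP n := by
    refine Subtype.ext ?_
    change P * (m * P * n) * P = (P * m * P) * (P * n * P)
    have e : (P * m * P) * (P * n * P) = P * m * (P * P) * n * P := by noncomm_ring
    rw [e, hP.isIdempotentElem.eq]
    noncomm_ring
  have h1 : φ.symm (cornerCompress P hP m * cornerCompress P hP n)
      = φ.symm (cornerCompress P hP m) * φ.symm (cornerCompress P hP n) := φ.symm.map_mul' _ _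
  rw [cornerLift_apply φ (m * P * n), h, h1]; rfl

theorem star_cornerLift (m : C(X, Matrix (Fin r) (Fin r) ℂ)) :
    star (cornerLift φ m) = cornerLift φ (star m) := by
  have h : cornerCompress P hP (star m) = star (cornerCompress P hP m) := by
    refine Subtype.ext ?_
    change P * star m * P = star (P * m * P)
    rw [star_mul, star_mul, hP.isSelfAdjoint.star_eq, mul_assoc]
  have h1 : φ.symm (star (cornerCompress P hP m)) = star (φ.symm (cornerCompress P hP m)) :=
    φ.symm.map_star' _
  rw [cornerLift_apply φ (star m), h, h1]; rfl

theorem cornerLift_conj (v : C(X, Matrix (Fin r) (Fin r) ℂ)) {m : C(X, Matrix (Fin r) (Fin r) ℂ)}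
    (hm : P * m * P = m) :
    star (cornerLift φ v) * cornerLift φ m * cornerLift φ v = cornerLift φ (star v * m * v) := by
  have h : star v * P * m * P * v = star v * (P * m * P) * v := by simp only [mul_assoc]
  rw [star_cornerLift, cornerLift_mul, cornerLift_mul, h, hm]

theorem cornerLift_one_mul (m : C(X, Matrix (Fin r) (Fin r) ℂ)) :
    cornerLift φ 1 * cornerLift φ m = cornerLift φ m := by
  rw [cornerLift_mul, one_mul]
  have h : cornerCompress P hP (P * m) = cornerCompress P hP m := by
    refine Subtype.ext ?_
    change P * (P * m) * P = P * m * P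
    rw [← mul_assoc P P, hP.isIdempotentElem.eq]
  rw [cornerLift_apply, cornerLift_apply, h]

theorem cornerLift_one {q : C} (hq : ∀ c : C, q * c = c) : cornerLift φ 1 = (q : A) := by
  rw [← cornerLift_corner φ q, corner_apply_eq_unit φ hq]
  have h : cornerCompress P hP 1
      = cornerCompress P hP (cornerUnit P hP : C(X, Matrix (Fin r) (Fin r) ℂ)) := by
    refine Subtype.ext ?_
    change P * 1 * P = P * P * P
    rw [mul_one, hP.isIdempotentElem.eq, hP.isIdempotentElem.eq]
  rw [cornerLift_apply, cornerLift_apply, h]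

theorem isStarProjection_cornerLift_one : IsStarProjection (cornerLift φ 1) := by
  have h := isStarProjection_corner_symm_unit φ
  have e : cornerCompress P hP 1 = cornerUnit P hP := by
    refine Subtype.ext ?_
    change P * 1 * P = P
    rw [mul_one, hP.isIdempotentElem.eq]
  rw [cornerLift_apply, e]
  exact h

theorem eq_zero_of_cornerLift_eq_zero {m : C(X, Matrix (Fin r) (Fin r) ℂ)}
    (h : cornerLift φ m = 0) (x : X) : P x * m x * P x = 0 := by
  have h1 : φ.symm (cornerCompress P hP m) = 0 := Subtype.ext h
  have h2 : φ (φ.symm (cornerCompress P hP m)) = 0 := by rw [h1, map_zero]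
  rw [φ.apply_symm_apply] at h2
  have h3 := congrArg Subtype.val h2
  exact congrArg (fun q : C(X, Matrix (Fin r) (Fin r) ℂ) => q x) h3

theorem cornerLift_nonneg [PartialOrder A] [StarOrderedRing A] (hC : IsClosed (C : Set A))
    {m : C(X, Matrix (Fin r) (Fin r) ℂ)} (hm : ∀ x, 0 ≤ m x) : 0 ≤ cornerLift φ m := by
  refine corner_symm_nonneg φ hC fun x => ?_
  have h := star_left_conjugate_nonneg (hm x) (P x)
  rw [(hP.apply x).isSelfAdjoint.star_eq] at h
  exact h

variable [PartialOrder A] [StarOrderedRing A]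

/-- Multiplying the hypothesis by `tr P(x)` turns it into the unnormalized gap of
`exists_pointwise_comparison`; the resulting matrix inequality is lifted to `A`. -/
theorem exists_comparison_of_fiberTrace [T2Space X] (hC : IsClosed (C : Set A)) {d : ℕ}
    (hX : CoveringDimLE X d) {q : C} (hq : ∀ c : C, q * c = c) (hpos : ∀ x, 0 < (P x).trace.re)
    {c c' : C} (hc' : ‖(c' : A)‖ ≤ 1) {θ δ ε : ℝ} (hθ : 0 < θ) (hδ : 0 < δ) (hε : 0 < ε)
    (h : ∀ x, (fiberTrace φ x (star c * c)).re / θ + (d + 1) / (P x).trace.re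
      ≤ (fiberTrace φ x (star c' * c')).re - δ) :
    ∃ y : A, (q : A) * y = y ∧ star (c : A) * c - (θ + ε) • (q : A)
      ≤ star y * (star (c' : A) * c' - (δ / 2) • (q : A)) * y := by
  set g : C(X, Matrix (Fin r) (Fin r) ℂ) := (φ (star c * c)).1 with hg
  set b : C(X, Matrix (Fin r) (Fin r) ℂ) := (φ (star c' * c')).1 with hb
  have hgx : ∀ x, g x = star ((φ c : C(X, Matrix (Fin r) (Fin r) ℂ)) x)
      * (φ c : C(X, Matrix (Fin r) (Fin r) ℂ)) x := fun x => by
    have h1 : φ (star c * c) = star (φ c) * φ c := by rw [map_mul, map_star]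
    rw [hg, h1]; rfl
  have hbx : ∀ x, b x = star ((φ c' : C(X, Matrix (Fin r) (Fin r) ℂ)) x)
      * (φ c' : C(X, Matrix (Fin r) (Fin r) ℂ)) x := fun x => by
    have h1 : φ (star c' * c') = star (φ c') * φ c' := by rw [map_mul, map_star]
    rw [hb, h1]; rfl
  have hb1 : ∀ x, b x ≤ 1 := fun x => by
    have h1 := (norm_corner_apply_le φ hC c' x).trans hc'
    rw [hbx, ← CStarAlgebra.norm_le_one_iff_of_nonneg _ (star_mul_self_nonneg _),
      CStarRing.norm_star_mul_self]
    exact mul_le_one₀ h1 (norm_nonneg _) h1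
  have hPb : ∀ x, P x * b x * P x = b x := fun x => cornerAlg.compress_apply _ x
  obtain ⟨v, hv⟩ := exists_pointwise_comparison hX P g b hP.apply
    (fun x => by rw [hgx]; exact star_mul_self_nonneg _)
    (fun x => by rw [hbx]; exact star_mul_self_nonneg _) hb1 hPb hθ hδ hε (fun x => by
      have h1 := h x
      rw [fiberTrace_re, fiberTrace_re] at h1
      have h2 := mul_le_mul_of_nonneg_right h1 (hpos x).le
      have h3 := (hpos x).ne'
      calc (g x).trace.re / θ + (d + 1)
          = ((g x).trace.re / (P x).trace.re / θ + (d + 1) / (P x).trace.re)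
            * (P x).trace.re := by field_simp
        _ ≤ _ := h2
        _ = (b x).trace.re - δ * (P x).trace.re := by rw [sub_mul, div_mul_cancel₀ _ h3])
  refine ⟨cornerLift φ v, ?_, ?_⟩
  · rw [← cornerLift_one φ hq, cornerLift_one_mul]
  -- Subtracting a multiple of `P` instead of `1` keeps `m` in the corner, so that lifting respects
  -- `v* m v`. Since `P ≤ 1`, this only enlarges the right-hand side.
  set m : C(X, Matrix (Fin r) (Fin r) ℂ) := b - ((δ / 2 : ℝ) : ℂ) • P with hm
  have e1 : star (c : A) * c - (θ + ε) • (q : A) = cornerLift φ (g - ((θ + ε : ℝ) : ℂ) • 1) := by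
    rw [map_sub, map_smul, cornerLift_one φ hq, Complex.coe_smul]
    congr 1
    exact (cornerLift_corner φ (star c * c)).symm
  have e2 : star (c' : A) * c' - (δ / 2) • (q : A) = cornerLift φ m := by
    have h1 : cornerLift φ P = q := by
      rw [← cornerLift_corner φ q, corner_apply_eq_unit φ hq]; rfl
    rw [hm, map_sub, map_smul, h1, Complex.coe_smul]
    congr 1
    exact (cornerLift_corner φ (star c' * c')).symm
  have e3 : P * m * P = m := by
    have h1 : P * b * P = b := ContinuousMap.ext hPb
    rw [hm, mul_sub, sub_mul, h1, mul_smul_comm, smul_mul_assoc, hP.isIdempotentElem.eq,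
      hP.isIdempotentElem.eq]
  rw [e1, e2, cornerLift_conj φ v e3, ← sub_nonneg, ← map_sub]
  refine cornerLift_nonneg φ hC fun x => ?_
  change 0 ≤ star (v x) * (b x - ((δ / 2 : ℝ) : ℂ) • P x) * v x
    - (g x - ((θ + ε : ℝ) : ℂ) • (1 : Matrix (Fin r) (Fin r) ℂ))
  rw [sub_nonneg, Complex.coe_smul, Complex.coe_smul]
  refine (hv x).trans (star_left_conjugate_le_conjugate ?_ _)
  refine sub_le_sub_left (smul_le_smul_of_nonneg_left ?_ (by positivity)) _
  exact sub_nonneg.1 (hP.apply x).one_sub.nonneg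

/-- The product of a matrix-valued function with a scalar function. -/
noncomputable def scaleFun (w : C(X, ℝ)) (m : C(X, Matrix (Fin r) (Fin r) ℂ)) :
    C(X, Matrix (Fin r) (Fin r) ℂ) :=
  ⟨fun x => (w x : ℂ) • m x, by fun_prop⟩

/-- In the corner, `∑ⱼ E_kj P E_jk = (tr P) E_kk` while `∑ⱼ E_jk P E_kj = P_kk 1`. The trace
property thus replaces `w E_kk` by `(w P_kk / tr P) 1`, which is at most `1/N`. No description of
the traces on the corner is needed. -/
theorem trace_cornerLift_le (hC : IsClosed (C : Set A)) {N : ℝ} (hN : 0 < N)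
    (h : ∀ x, N ≤ (P x).trace.re) (k : Fin r) {w : C(X, ℝ)}
    (hw : ∀ x, w x * (P x k k).re ≤ 1) {τ : A →ₚ[ℂ] ℂ} (hτ : τ ∈ tracialStates A) :
    (τ (cornerLift φ (scaleFun w (.const X (Matrix.single k k 1))))).re ≤ 1 / N := by
  have hpos : ∀ x, 0 < (P x).trace.re := fun x => hN.trans_le (h x)
  have hPt : ∀ x, (P x).trace = ((P x).trace.re : ℂ) := fun x => by
    have := (Complex.le_def.1
      (Matrix.nonneg_iff_posSemidef.1 (hP.apply x).nonneg).trace_nonneg).2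
    exact Complex.ext (by simp) (by simpa using this.symm)
  have hPk : ∀ x, P x k k = ((P x k k).re : ℂ) := fun x => by
    have h1 := (Matrix.nonneg_iff_posSemidef.1 (hP.apply x).nonneg).diag_nonneg (i := k)
    have := (Complex.le_def.1 h1).2
    exact Complex.ext (by simp) (by simpa using this.symm)
  have hcont : Continuous fun x => (P x).trace.re :=
    Complex.continuous_re.comp (Continuous.matrix_trace P.continuous)
  have hcont2 : Continuous fun x => (P x k k).re :=
    Complex.continuous_re.comp (P.continuous.matrix_elem k k)
  set w' : C(X, ℝ) := ⟨fun x => w x / (P x).trace.re,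
    w.continuous.div hcont fun x => (hpos x).ne'⟩
  set w'' : C(X, ℝ) := ⟨fun x => w x / (P x).trace.re * (P x k k).re, by
    exact (w.continuous.div hcont fun x => (hpos x).ne').mul hcont2⟩
  have e1 : cornerLift φ (scaleFun w (.const X (Matrix.single k k 1)))
      = ∑ j, cornerLift φ (scaleFun w' (.const X (Matrix.single k j 1)))
        * cornerLift φ (.const X (Matrix.single j k 1)) := by
    simp_rw [cornerLift_mul]
    rw [← map_sum]
    congr 1
    ext1 x
    rw [ContinuousMap.coe_sum, Finset.sum_apply]
    change (w x : ℂ) • Matrix.single k k (1 : ℂ) = ∑ j, ((w x / (P x).trace.re : ℝ) : ℂ) •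
      Matrix.single k j (1 : ℂ) * P x * Matrix.single j k 1
    simp_rw [smul_mul_assoc, Matrix.single_mul_mul_single, one_mul, mul_one]
    rw [← Finset.smul_sum]
    have : ∑ j, Matrix.single k k (P x j j) = (P x).trace • Matrix.single k k (1 : ℂ) := by
      rw [Matrix.smul_single, smul_eq_mul, mul_one, Matrix.trace, ← Matrix.singleAddMonoidHom_apply,
        map_sum]
      rfl
    rw [this, smul_smul]
    congr 1
    calc (w x : ℂ) = ((w x / (P x).trace.re : ℝ) : ℂ) * ((P x).trace.re : ℂ) := by
          rw [← Complex.ofReal_mul, div_mul_cancel₀ _ (hpos x).ne']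
      _ = _ := congrArg _ (hPt x).symm
  have e2 : ∑ j, cornerLift φ (.const X (Matrix.single j k 1))
      * cornerLift φ (scaleFun w' (.const X (Matrix.single k j 1)))
      = cornerLift φ (scaleFun w'' 1) := by
    simp_rw [cornerLift_mul]
    rw [← map_sum]
    congr 1
    ext1 x
    rw [ContinuousMap.coe_sum, Finset.sum_apply]
    change ∑ j, Matrix.single j k 1 * P x * (((w x / (P x).trace.re : ℝ) : ℂ) •
      Matrix.single k j (1 : ℂ)) = ((w x / (P x).trace.re * (P x k k).re : ℝ) : ℂ) •
        (1 : Matrix (Fin r) (Fin r) ℂ)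
    simp_rw [mul_smul_comm, Matrix.single_mul_mul_single, one_mul, mul_one]
    rw [← Finset.smul_sum, Complex.ofReal_mul, ← hPk, mul_smul]
    congr 1
    rw [Matrix.smul_one_eq_diagonal, Matrix.sum_single_eq_diagonal]
  rw [e1, map_sum, Finset.sum_congr rfl fun j _ => hτ.2 _ _, ← map_sum, e2]
  have e3 : cornerLift φ (scaleFun w'' 1) ≤ (1 / N) • cornerLift φ 1 := by
    rw [← sub_nonneg, ← Complex.coe_smul, ← map_smul, ← map_sub]
    refine cornerLift_nonneg φ hC fun x => ?_
    change 0 ≤ ((1 / N : ℝ) : ℂ) • (1 : Matrix (Fin r) (Fin r) ℂ)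
      - ((w x / (P x).trace.re * (P x k k).re : ℝ) : ℂ) • (1 : Matrix (Fin r) (Fin r) ℂ)
    rw [Complex.coe_smul, Complex.coe_smul, ← sub_smul]
    refine smul_nonneg (sub_nonneg.2 ?_) zero_le_one
    rw [div_mul_eq_mul_div, div_le_div_iff₀ (hpos x) hN]
    calc w x * (P x k k).re * N ≤ 1 * N := mul_le_mul_of_nonneg_right (hw x) hN.le
      _ ≤ _ := mul_le_mul_of_nonneg_left (h x) zero_le_one
  have e4 : (1 / N) • cornerLift φ 1 ≤ ((1 / N : ℝ) : ℂ) • (1 : A) := by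
    rw [Complex.coe_smul]
    exact smul_le_smul_of_nonneg_left
      (sub_nonneg.1 (isStarProjection_cornerLift_one φ).one_sub.nonneg) (by positivity)
  have e5 := re_mono (τ := τ) (e3.trans e4)
  rw [map_smul, hτ.1, smul_eq_mul, mul_one, Complex.ofReal_re] at e5
  exact e5

/-- A compressed diagonal matrix unit has rank at most one in each fiber, hence trace about `1 /
rank P`. The element `u` acts as a unit on `e`, so `u²` will dominate whatever is built inside `e
A`. -/
theorem exists_small_trace_element [Nonempty X] (φ : C ≃⋆ₐ[ℂ] cornerAlg P hP)
    (hC : IsClosed (C : Set A)) {N : ℝ} (hN : 0 < N) (h : ∀ x, N ≤ (P x).trace.re) :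
    ∃ u e : A, star u = u ∧ u * e = e ∧ e ≠ 0 ∧
      ∀ τ ∈ tracialStates A, (τ (u * u)).re ≤ 1 / N := by
  obtain ⟨x₀⟩ := ‹Nonempty X›
  obtain ⟨k, hk⟩ : ∃ k, 0 < (P x₀ k k).re := by
    by_contra! hcon
    have h1 : (P x₀).trace.re ≤ 0 := by
      rw [Matrix.trace, Complex.re_sum]
      exact Finset.sum_nonpos fun k _ => hcon k
    linarith [h x₀]
  have hPk : ∀ x, P x k k = ((P x k k).re : ℂ) := fun x => by
    have h1 := (Matrix.nonneg_iff_posSemidef.1 (hP.apply x).nonneg).diag_nonneg (i := k)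
    have := (Complex.le_def.1 h1).2
    exact Complex.ext (by simp) (by simpa using this.symm)
  have hs0 : ∀ x, 0 ≤ (P x k k).re := fun x =>
    (Complex.le_def.1 ((Matrix.nonneg_iff_posSemidef.1 (hP.apply x).nonneg).diag_nonneg (i := k))).1
  have hcont : Continuous fun x => (P x k k).re :=
    Complex.continuous_re.comp (P.continuous.matrix_elem k k)
  set s₀ := (P x₀ k k).re
  have hmax : ∀ x, 0 < max (P x k k).re (s₀ / 2) := fun x => lt_max_of_lt_right (half_pos hk)
  -- `h₁` inverts `P_kk` where `P_kk ≥ s₀/2`, and `h₂` vanishes elsewhere; hence `h₁ h₂ P_kk = h₂`,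
  -- which is `u e = e`.
  set h₁ : C(X, ℝ) := ⟨fun x => (max (P x k k).re (s₀ / 2))⁻¹,
    (hcont.max continuous_const).inv₀ fun x => (hmax x).ne'⟩ with hh₁
  set h₂ : C(X, ℝ) := ⟨fun x => max ((P x k k).re - s₀ / 2) 0,
    (hcont.sub continuous_const).max continuous_const⟩ with hh₂
  set E : C(X, Matrix (Fin r) (Fin r) ℂ) := .const X (Matrix.single k k 1) with hE
  have hmul : ∀ w₁ w₂ w : C(X, ℝ), (∀ x, w₁ x * w₂ x * (P x k k).re = w x) →
      cornerLift φ (scaleFun w₁ E) * cornerLift φ (scaleFun w₂ E)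
        = cornerLift φ (scaleFun w E) := by
    intro w₁ w₂ w hw
    rw [cornerLift_mul]
    congr 1
    ext1 x
    change ((w₁ x : ℂ) • Matrix.single k k (1 : ℂ)) * P x * ((w₂ x : ℂ) • Matrix.single k k (1 : ℂ))
      = (w x : ℂ) • Matrix.single k k (1 : ℂ)
    rw [smul_mul_assoc, smul_mul_assoc, mul_smul_comm, Matrix.single_mul_mul_single, smul_smul,
      Matrix.smul_single, Matrix.smul_single, hPk, ← hw]
    congr 1
    push_cast
    simp
  refine ⟨cornerLift φ (scaleFun h₁ E), cornerLift φ (scaleFun h₂ E), ?_, ?_, ?_, ?_⟩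
  · rw [star_cornerLift]
    congr 1
    ext1 x
    change star ((h₁ x : ℂ) • Matrix.single k k (1 : ℂ)) = (h₁ x : ℂ) • Matrix.single k k (1 : ℂ)
    rw [star_smul, Matrix.star_eq_conjTranspose, Matrix.conjTranspose_single, star_one]
    simp
  · refine hmul _ _ _ fun x => ?_
    change (max (P x k k).re (s₀ / 2))⁻¹ * max ((P x k k).re - s₀ / 2) 0 * (P x k k).re
      = max ((P x k k).re - s₀ / 2) 0
    rcases le_total (P x k k).re (s₀ / 2) with hx | hx
    · rw [max_eq_right (a := (P x k k).re - s₀ / 2) (by linarith)]; simp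
    · have : 0 < (P x k k).re := (half_pos hk).trans_le hx
      rw [max_eq_left hx]
      field_simp
  · intro h0
    have h1 := congrFun (congrFun (eq_zero_of_cornerLift_eq_zero φ h0 x₀) k) k
    change (P x₀ * ((h₂ x₀ : ℂ) • Matrix.single k k (1 : ℂ)) * P x₀) k k = 0 at h1
    rw [mul_smul_comm, smul_mul_assoc, Matrix.smul_apply] at h1
    have h2 : (P x₀ * Matrix.single k k (1 : ℂ) * P x₀) k k = P x₀ k k * P x₀ k k := by
      rw [Matrix.mul_apply, Finset.sum_eq_single k]
      · simp
      · intro j _ hj; simp [Matrix.mul_single_apply_of_ne, hj]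
      · simp
    rw [h2, hPk] at h1
    have h3 : h₂ x₀ = s₀ / 2 := by
      change max (s₀ - s₀ / 2) 0 = _
      rw [max_eq_left (by linarith)]; ring
    rw [h3, smul_eq_mul] at h1
    norm_cast at h1
    have : 0 < s₀ / 2 * (s₀ * s₀) := by positivity
    exact this.ne' h1
  · intro τ hτ
    rw [hmul h₁ h₁ ⟨fun x => h₁ x * h₁ x * (P x k k).re,
      (h₁.continuous.mul h₁.continuous).mul hcont⟩ fun x => rfl]
    refine trace_cornerLift_le φ hC hN h k (fun x => ?_) hτ
    change (max (P x k k).re (s₀ / 2))⁻¹ * (max (P x k k).re (s₀ / 2))⁻¹ * (P x k k).re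
      * (P x k k).re ≤ 1
    have h1 : (max (P x k k).re (s₀ / 2))⁻¹ * (P x k k).re ≤ 1 := by
      rw [inv_mul_le_iff₀ (hmax x), mul_one]; exact le_max_left _ _
    have h2 : 0 ≤ (max (P x k k).re (s₀ / 2))⁻¹ * (P x k k).re :=
      mul_nonneg (inv_pos.2 (hmax x)).le (hs0 x)
    calc _ = ((max (P x k k).re (s₀ / 2))⁻¹ * (P x k k).re)
          * ((max (P x k k).re (s₀ / 2))⁻¹ * (P x k k).re) := by ring
      _ ≤ 1 := mul_le_one₀ h1 h2 h1

end CornerLift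

/-! ### Positive approximants in the subalgebra -/

section Approximation

variable {A : Type*} [CStarAlgebra A] [PartialOrder A] [StarOrderedRing A]

/-- Approximating the square root `s` and then squaring gives an approximant that is positive by its
form; rescaling by `(1 + θ)⁻¹` makes it a contraction. -/
theorem exists_star_mul_self_near {C : NonUnitalStarSubalgebra ℂ A} {p s : A} {θ : ℝ}
    (hp : IsStarProjection p) (hs : IsSelfAdjoint s) (hs1 : ‖s‖ ≤ 1)
    (hcomm : ‖p * s - s * p‖ < θ) (hdist : Metric.infDist (p * s * p) (C : Set A) < θ) :
    ∃ c : C, ‖(c : A)‖ ≤ 1 ∧ ‖p * (s * s) * p - star (c : A) * c‖ ≤ 5 * θ := by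
  have hθ : 0 < θ := (norm_nonneg _).trans_lt hcomm
  obtain ⟨t, ht, htd⟩ := (Metric.infDist_lt_iff ⟨0, C.zero_mem⟩).1 hdist
  rw [dist_eq_norm] at htd
  set m := p * s * p with hm
  have hm1 : ‖m‖ ≤ 1 := (norm_compress_le hp s).trans hs1
  have hmsa : star m = m := by
    rw [hm, star_mul, star_mul, hs.star_eq, hp.isSelfAdjoint.star_eq, mul_assoc]
  have ht1 : ‖t‖ ≤ 1 + θ := by
    calc ‖t‖ = ‖m - (m - t)‖ := by rw [sub_sub_cancel]
      _ ≤ ‖m‖ + ‖m - t‖ := norm_sub_le _ _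
      _ ≤ 1 + θ := by linarith
  have h1θ : (0 : ℝ) < 1 + θ := by linarith
  set c : A := (((1 + θ)⁻¹ : ℝ) : ℂ) • t with hc
  have hc1 : ‖c‖ ≤ 1 := by
    rw [hc, norm_smul, Complex.norm_real, Real.norm_of_nonneg (by positivity),
      inv_mul_le_iff₀ h1θ, mul_one]
    exact ht1
  have hct : ‖t - c‖ ≤ θ := by
    have e : t - c = ((θ : ℝ) : ℂ) • c := by
      rw [hc, smul_smul, ← Complex.ofReal_mul]
      nth_rewrite 1 [← one_smul ℂ t]
      rw [← sub_smul]
      congr 1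
      norm_cast
      field_simp
      ring
    rw [e, norm_smul, Complex.norm_real, Real.norm_of_nonneg hθ.le]
    exact mul_le_of_le_one_right hθ.le hc1
  have hmc : ‖m - c‖ ≤ 2 * θ := by
    calc ‖m - c‖ = ‖(m - t) + (t - c)‖ := by rw [sub_add_sub_cancel]
      _ ≤ _ := norm_add_le _ _
      _ ≤ 2 * θ := by linarith
  refine ⟨⟨c, SMulMemClass.smul_mem _ ht⟩, hc1, ?_⟩
  change ‖p * (s * s) * p - star c * c‖ ≤ 5 * θ
  have h1 := norm_compress_mul_sub_le hp s hcomm.le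
  have h2 : ‖m * m - star c * c‖ ≤ 4 * θ := by
    have e : m * m - star c * c = star (m - c) * m + star c * (m - c) := by
      rw [star_sub, hmsa]; noncomm_ring
    rw [e]
    refine (norm_add_le _ _).trans ?_
    have h3 : ‖star (m - c) * m‖ ≤ 2 * θ * 1 := by
      refine (norm_mul_le _ _).trans ?_
      rw [norm_star]
      gcongr
    have h4 : ‖star c * (m - c)‖ ≤ 1 * (2 * θ) := by
      refine (norm_mul_le _ _).trans ?_
      rw [norm_star]
      gcongr
    linarith
  have h5 : θ * ‖s‖ ≤ θ := mul_le_of_le_one_right hθ.le hs1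
  calc _ = ‖(p * (s * s) * p - m * m) + (m * m - star c * c)‖ := by rw [sub_add_sub_cancel]
    _ ≤ _ := norm_add_le _ _
    _ ≤ 5 * θ := by linarith

end Approximation

/-! ### Splitting off a small piece, and strict comparison -/

section MainTheorem

set_option linter.unusedSectionVars false

variable {A : Type*} [CStarAlgebra A] [PartialOrder A] [StarOrderedRing A]

theorem InClassC1.exists_corner (hA : InClassC1 A) (F : Finset A) {ε η : ℝ} {a : A} (hε : 0 < ε)
    (hη : 0 < η) (ha : 0 ≤ a) (ha0 : a ≠ 0) :
    ∃ (p : A) (C : NonUnitalStarSubalgebra ℂ A) (d : ℕ) (X : Type) (_ : TopologicalSpace X)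
      (_ : CompactSpace X) (_ : T2Space X) (_ : Nonempty X) (r : ℕ)
      (P : C(X, Matrix (Fin r) (Fin r) ℂ)) (hP : IsStarProjection P) (_ : C ≃⋆ₐ[ℂ] cornerAlg P hP)
      (q : C),
      IsStarProjection p ∧ IsClosed (C : Set A) ∧ (q : A) = p ∧ (∀ c : C, q * c = c) ∧
      CoveringDimLE X d ∧ (∀ x ∈ F, ‖p * x - x * p‖ < ε) ∧
      (∀ x ∈ F, Metric.infDist (p * x * p) (C : Set A) < ε) ∧
      (∀ x, 0 < (P x).trace.re) ∧ (∀ x, ((d : ℝ) + 1) / (P x).trace.re < η / 2) ∧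
      CuntzLE (1 - p) a := by
  obtain ⟨p, C, d, M, hp, hC, hpC, hunit, hX, ⟨φ⟩, hcomm, hdist, hrank, hle⟩ :=
    hA F ε η a hε hη ha ha0
  have htr : ∀ x, (M.P x).trace.re = M.rankAt x := fun x =>
    Matrix.trace_re_eq_rank (M.isStarProjection_P.apply x)
  refine ⟨p, C, d, M.X, inferInstance, isCompact_iff_compactSpace.1 M.isCompact_X, inferInstance,
    hX.to_subtype, M.r, M.P, M.isStarProjection_P, φ, ⟨p, hpC⟩, hp, hC, rfl,
    fun c => Subtype.ext (hunit c c.2).1, M.dim_le.of_isClosed M.isCompact_X.isClosed, hcomm, hdist,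
    fun x => ?_, fun x => ?_, hle⟩
  · rw [htr]
    exact_mod_cast (hrank x).1
  · rw [htr]
    refine (hrank x).2.trans_le (le_of_eq ?_)
    norm_num

/-- Without tracial states a gap from `1` to `0` would hold vacuously and transfer to a fiber trace,
giving `1 + 1/2 ≤ 0`. -/
theorem InClassC1.tracialStates_nonempty [Nontrivial A] (hA : InClassC1 A) :
    (tracialStates A).Nonempty := by
  by_contra hcon
  obtain ⟨F, θ, hθ, h⟩ := exists_trace_transfer (A := A) (g := 1) (h := 0) one_pos
    fun τ hτ => absurd ⟨τ, hτ⟩ hcon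
  obtain ⟨p, C, d, X, _, _, _, hne, r, P, hP, φ, q, hp, hC, hqp, hq, -, hcomm, hdist, hpos, -, -⟩ :=
    hA.exists_corner F hθ one_pos (zero_le_one' A) one_ne_zero
  obtain ⟨x⟩ := hne
  have := h p C (fiberTrace φ x) q hp hqp (fiberTrace_unit φ (hpos x) hq)
    (fiberTrace_mul_comm φ x) (norm_fiberTrace_le φ hC (hpos x))
    (fun c => fiberTrace_star_mul_self_nonneg φ c (hpos x)) hcomm hdist q 0
    (by rw [mul_one, hp.isIdempotentElem.eq, hqp, sub_self, norm_zero]; exact hθ.le)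
    (by simpa using hθ.le)
  rw [fiberTrace_unit φ (hpos x) hq, map_zero] at this
  norm_num at this

/-- The `x` with `e A x = 0` form a closed two-sided ideal that does not contain `1`. -/
theorem IsSimpleCStar.exists_mul_mul_ne_zero (hA : IsSimpleCStar A) {e b : A} (he : e ≠ 0)
    (hb : b ≠ 0) : ∃ y, e * y * b ≠ 0 := by
  by_contra! hcon
  set I : TwoSidedIdeal A := TwoSidedIdeal.mk' {x | ∀ y, e * y * x = 0} (by simp)
    (fun {x z} hx hz y => by rw [mul_add, hx, hz, add_zero])
    (fun {x} hx y => by rw [mul_neg, hx, neg_zero])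
    (fun {x z} hz y => by rw [← mul_assoc, mul_assoc e, hz])
    (fun {x z} hx y => by rw [← mul_assoc, hx, zero_mul]) with hI
  have hmem : ∀ x, x ∈ I ↔ ∀ y, e * y * x = 0 := fun x => TwoSidedIdeal.mem_mk' _ _ _ _ _ _ _
  have hcl : IsClosed (I : Set A) := by
    have : (I : Set A) = ⋂ y, {x | e * y * x = 0} := by
      ext x
      simp [hmem]
    rw [this]
    exact isClosed_iInter fun y => isClosed_eq (by fun_prop) continuous_const
  rcases hA.2 I hcl with h | h
  · have : b ∈ I := (hmem b).2 hcon
    rw [h, TwoSidedIdeal.mem_bot] at this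
    exact hb this
  · have : (1 : A) ∈ I := by rw [h]; trivial
    have h1 := (hmem 1).1 this 1
    rw [mul_one, mul_one] at h1
    exact he h1

theorem norm_one_sub_le_one {e : A} (h0 : 0 ≤ e) (h1 : e ≤ 1) : ‖1 - e‖ ≤ 1 := by
  rw [CStarAlgebra.norm_le_one_iff_of_nonneg _ (sub_nonneg.2 h1)]
  exact sub_le_self _ h0

theorem cutoff_nonneg (ε t : ℝ) : 0 ≤ cutoff ε t := le_max_left _ _

theorem cfc_cutoff_nonneg (ε : ℝ) (a : A) : 0 ≤ cfc (cutoff ε) a :=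
  cfc_nonneg fun t _ => cutoff_nonneg ε t

theorem cfc_cutoff_le_one (ε : ℝ) (a : A) : cfc (cutoff ε) a ≤ 1 :=
  cfc_le_one _ _ fun t _ => cutoff_le_one ε t

theorem cfc_cutoff_le_smul {ε : ℝ} (hε : 0 < ε) {a : A} (ha : 0 ≤ a) :
    cfc (cutoff ε) a ≤ (2 / ε) • a := by
  have h : cfc (fun t : ℝ => (2 / ε) * t) a = (2 / ε) • a := cfc_const_mul_id (2 / ε) a
  rw [← h]
  refine cfc_mono (fun t ht => ?_) (cutoff_continuous ε).continuousOn (by fun_prop)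
  have ht0 : 0 ≤ t := spectrum_nonneg_of_nonneg ha ht
  refine max_le (by positivity) ((min_le_right _ _).trans ?_)
  rw [div_mul_eq_mul_div]
  linarith

/-- Expanding, the cross terms have trace `τ(e^{1/2} f e^{1/2}) ≤ τ(e)` each, and `τ(e f e) ≥ 0`. -/
theorem re_conj_one_sub_ge {τ : A →ₚ[ℂ] ℂ} (hτ : τ ∈ tracialStates A) {e f : A} (he : 0 ≤ e)
    (hf0 : 0 ≤ f) (hf1 : f ≤ 1) :
    (τ f).re - 2 * (τ e).re ≤ (τ ((1 - e) * f * (1 - e))).re := by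
  set h := CFC.sqrt e with hh
  have hs : star h = h := IsSelfAdjoint.of_nonneg (CFC.sqrt_nonneg e)
  have hhe : h * h = e := CFC.sqrt_mul_sqrt_self e
  have es : star e = e := IsSelfAdjoint.of_nonneg he
  have h1 : τ (e * f) = τ (h * f * h) := by
    rw [← hhe, mul_assoc, hτ.2]
  have h2 : τ (f * e) = τ (h * f * h) := by
    rw [hτ.2, h1]
  have h3 : (τ (h * f * h)).re ≤ (τ e).re := by
    refine re_mono ?_
    have := star_left_conjugate_le_conjugate hf1 h
    rwa [hs, mul_one, hhe] at this
  have h4 : 0 ≤ (τ (e * f * e)).re := by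
    refine re_nonneg ?_
    have := star_left_conjugate_nonneg hf0 e
    rwa [es] at this
  have e1 : (1 - e) * f * (1 - e) = f - e * f - f * e + e * f * e := by noncomm_ring
  rw [e1, map_add, map_sub, map_sub, h1, h2, Complex.add_re, Complex.sub_re, Complex.sub_re]
  linarith

theorem mul_self_le_self_of_le_one {e : A} (h0 : 0 ≤ e) (h1 : e ≤ 1) : e * e ≤ e := by
  have h2 := CStarAlgebra.star_left_conjugate_le_norm_smul (a := CFC.sqrt e) (b := e)
    (IsSelfAdjoint.of_nonneg h0)
  have hq : star (CFC.sqrt e) = CFC.sqrt e := IsSelfAdjoint.of_nonneg (CFC.sqrt_nonneg e)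
  have hqq : CFC.sqrt e * CFC.sqrt e = e := CFC.sqrt_mul_sqrt_self e h0
  have h3 : CFC.sqrt e * e * CFC.sqrt e = e * e := by
    calc CFC.sqrt e * e * CFC.sqrt e
        = CFC.sqrt e * (CFC.sqrt e * CFC.sqrt e) * CFC.sqrt e := by rw [hqq]
      _ = (CFC.sqrt e * CFC.sqrt e) * (CFC.sqrt e * CFC.sqrt e) := by simp only [mul_assoc]
      _ = e * e := by rw [hqq]
  rw [hq, h3, hqq] at h2
  refine h2.trans ?_
  exact (smul_le_smul_of_nonneg_right ((CStarAlgebra.norm_le_one_iff_of_nonneg e h0).2 h1)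
    h0).trans_eq (one_smul ℝ e)

/-- Parallelogram identity: `(1 - e) f (1 - e) + (1 + e) f (1 + e) = 2 f + 2 e f e`, and `e f e ≤ e²
≤ e`. -/
theorem conj_one_sub_le {e f : A} (he0 : 0 ≤ e) (he1 : e ≤ 1) (hf0 : 0 ≤ f) (hf1 : f ≤ 1) :
    (1 - e) * f * (1 - e) ≤ (2 : ℝ) • f + (2 : ℝ) • e := by
  have hes : star e = e := IsSelfAdjoint.of_nonneg he0
  have h2 := star_left_conjugate_nonneg hf0 (1 + e)
  have h3 := star_left_conjugate_le_conjugate hf1 e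
  rw [star_add, star_one, hes] at h2
  rw [hes, mul_one] at h3
  have h6 : e * f * e ≤ e := h3.trans (mul_self_le_self_of_le_one he0 he1)
  have h7 : (1 - e) * f * (1 - e) = (2 : ℝ) • f + (2 : ℝ) • (e * f * e)
      - (1 + e) * f * (1 + e) := by
    rw [two_smul, two_smul]; noncomm_ring
  rw [h7]
  refine (sub_le_self _ h2).trans ?_
  exact add_le_add le_rfl (smul_le_smul_of_nonneg_left h6 zero_le_two)

/-- Below a nonzero positive element there is a positive element of norm one and small trace. -/
theorem exists_norm_one_small_trace (hsimple : IsSimpleCStar A) (hA : InClassC1 A) {b : A}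
    (hb : 0 ≤ b) (hb0 : b ≠ 0) {η : ℝ} (hη : 0 < η) :
    ∃ c₀ : A, 0 ≤ c₀ ∧ ‖c₀‖ = 1 ∧ (∃ K : ℝ, 0 ≤ K ∧ c₀ ≤ K • b) ∧
      ∀ τ ∈ tracialStates A, (τ c₀).re ≤ η / 8 := by
  have : Nontrivial A := hsimple.1
  obtain ⟨p, C, d, X, _, _, _, _, r, P, hP, φ, q, -, hC, -, -, -, -, -, hpos, hrank, -⟩ :=
    hA.exists_corner ∅ one_pos (η := η / 4) (by positivity) (zero_le_one' A) one_ne_zero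
  obtain ⟨u, e, hu, hue, he, hτu⟩ := exists_small_trace_element (N := 8 / η) φ hC (by positivity)
    (fun x => by
      have h1 := hrank x
      rw [div_lt_iff₀ (hpos x)] at h1
      rw [div_le_iff₀ hη]
      have : (0 : ℝ) ≤ d := d.cast_nonneg
      linarith)
  set s := CFC.sqrt b with hs
  have hs0 : 0 ≤ s := CFC.sqrt_nonneg b
  have hss : star s = s := IsSelfAdjoint.of_nonneg hs0
  have hsb : s * s = b := CFC.sqrt_mul_sqrt_self b
  have hsne : s ≠ 0 := by
    rintro h
    rw [h, zero_mul] at hsb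
    exact hb0 hsb.symm
  obtain ⟨y, hy⟩ := hsimple.exists_mul_mul_ne_zero he hsne
  set k : ℝ := ‖e * y * s‖⁻¹ with hk
  have hk0 : 0 < k := inv_pos.2 (norm_pos_iff.2 hy)
  -- `w* w` lies below a multiple of `s² = b`, while `w w* ≤ u²` because `u w = w`. The trace does
  -- not distinguish `w* w` from `w w*`.
  set w : A := k • (e * y * s) with hw
  have hw1 : ‖w‖ = 1 := by
    rw [hw, norm_smul, Real.norm_of_nonneg hk0.le, hk, inv_mul_cancel₀ (norm_ne_zero_iff.2 hy)]
  have huw : u * w = w := by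
    rw [hw, mul_smul_comm, ← mul_assoc, ← mul_assoc, hue]
  set c₀ := star w * w with hc₀
  have hc₀0 : 0 ≤ c₀ := star_mul_self_nonneg w
  have hc₀1 : ‖c₀‖ = 1 := by rw [hc₀, CStarRing.norm_star_mul_self, hw1, mul_one]
  have hτc₀ : ∀ τ ∈ tracialStates A, (τ c₀).re ≤ η / 8 := fun τ hτ => by
    have h1 : w * star w ≤ u * u := by
      have h2 : w * star w ≤ 1 := by
        rw [← CStarAlgebra.norm_le_one_iff_of_nonneg _ (mul_star_self_nonneg w),
          CStarRing.norm_self_mul_star, hw1, mul_one]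
      have h3 := star_left_conjugate_le_conjugate h2 u
      have h4 : star w * u = star w := by
        have := congrArg star huw
        rwa [star_mul, hu] at this
      rwa [hu, mul_one, ← mul_assoc, huw, mul_assoc, h4] at h3
    have h5 := hτu τ hτ
    rw [one_div_div] at h5
    rw [hc₀, hτ.2]
    exact (re_mono h1).trans h5
  refine ⟨c₀, hc₀0, hc₀1, ?_, hτc₀⟩
  set v : A := k • (e * y) with hv
  refine ⟨‖star v * v‖, norm_nonneg _, ?_⟩
  have h1 : w = v * s := by rw [hw, hv, smul_mul_assoc]
  have h2 := CStarAlgebra.star_left_conjugate_le_norm_smul (a := s) (b := star v * v)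
    (IsSelfAdjoint.star_mul_self v)
  rw [hss, hsb] at h2
  rwa [hc₀, h1, star_mul, hss, mul_assoc, ← mul_assoc (star v), ← mul_assoc]

/-- A positive element of small trace can be split off from a nonzero positive element. -/
theorem exists_orthogonal_splitting (hsimple : IsSimpleCStar A) (hA : InClassC1 A) {b : A}
    (hb : 0 ≤ b) (hb0 : b ≠ 0) {δ η : ℝ} (hδ : 0 < δ) (hη : 0 < η) :
    ∃ b₁ c : A, 0 ≤ b₁ ∧ b₁ ≤ 1 ∧ 0 ≤ c ∧ c ≠ 0 ∧ b₁ * c = 0 ∧ CuntzLE (b₁ + c) b ∧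
      ∀ τ ∈ tracialStates A, (τ (cfc (cutoff δ) b)).re ≤ (τ b₁).re + η := by
  obtain ⟨c₀, hc₀0, hc₀1, ⟨K, hK, hc₀K⟩, hτc₀⟩ :=
    exists_norm_one_small_trace hsimple hA hb hb0 hη
  set f := cfc (cutoff δ) b with hf
  have hf0 : 0 ≤ f := cfc_cutoff_nonneg _ _
  have hf1 : f ≤ 1 := cfc_cutoff_le_one _ _
  -- `e₁` is a unit for `c = (c₀ - 1/2)_+`, so compressing `f` by `1 - e₁` makes it orthogonal to
  -- `c`. The cost in trace is `2 τ(e₁) ≤ 8 τ(c₀) ≤ η`, and `‖c₀‖ = 1` guarantees `c ≠ 0`.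
  set e₁ := cfc (cutoff (1 / 2)) c₀ with he₁
  have he0 : 0 ≤ e₁ := cfc_cutoff_nonneg _ _
  have he1 : e₁ ≤ 1 := cfc_cutoff_le_one _ _
  have hes : star e₁ = e₁ := IsSelfAdjoint.of_nonneg he0
  have he4 : e₁ ≤ (4 : ℝ) • c₀ := by
    have := cfc_cutoff_le_smul (ε := 1 / 2) (by norm_num) hc₀0
    norm_num at this ⊢
    exact this
  set c := cfc (fun t : ℝ => max (t - 1 / 2) 0) c₀ with hc
  have hc0 : 0 ≤ c := cfc_nonneg fun t _ => le_max_right _ _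
  have hcc₀ : c ≤ c₀ := by
    have h1 : cfc (fun t : ℝ => max (t - 1 / 2) 0) c₀ ≤ cfc (fun t : ℝ => t) c₀ :=
      cfc_mono (fun t ht => max_le (by linarith) (spectrum_nonneg_of_nonneg hc₀0 ht))
        (by fun_prop) (by fun_prop)
    rwa [cfc_id' ℝ c₀] at h1
  have hcne : c ≠ 0 := by
    intro h0
    have h1 := norm_cfc_max_sub_sub_le hc₀0 (γ := 1 / 2) (by norm_num)
    rw [← hc, h0, zero_sub, norm_neg, hc₀1] at h1
    norm_num at h1
  have hec : e₁ * c = c := by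
    rw [he₁, hc, ← cfc_mul _ _ c₀ (cutoff_continuous _).continuousOn (by fun_prop)]
    refine cfc_congr fun t _ => ?_
    rcases le_total t (1 / 2) with h | h
    · simp only [max_eq_right (sub_nonpos.2 h), mul_zero]
    · have h1 : cutoff (1 / 2) t = 1 := by
        unfold cutoff
        rw [min_eq_left (by linarith), max_eq_right zero_le_one]
      simp only [h1, one_mul]
  have h1s : star (1 - e₁) = 1 - e₁ := by rw [star_sub, star_one, hes]
  have hb₁0 : 0 ≤ (1 - e₁) * f * (1 - e₁) := by
    have := star_left_conjugate_nonneg hf0 (1 - e₁)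
    rwa [h1s] at this
  refine ⟨(1 - e₁) * f * (1 - e₁), c, hb₁0, ?_, hc0, hcne, ?_, ?_, fun τ hτ => ?_⟩
  · rw [← CStarAlgebra.norm_le_one_iff_of_nonneg _ hb₁0]
    have h1 := norm_one_sub_le_one he0 he1
    have h2 := (CStarAlgebra.norm_le_one_iff_of_nonneg _ hf0).2 hf1
    calc _ ≤ ‖1 - e₁‖ * ‖f‖ * ‖1 - e₁‖ := norm_mul₃_le
      _ ≤ 1 * 1 * 1 := by gcongr
      _ = 1 := by norm_num
  · rw [mul_assoc, sub_mul 1 e₁ c, one_mul, hec, sub_self, mul_zero]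
  · have h1 := conj_one_sub_le he0 he1 hf0 hf1
    have h8 := cfc_cutoff_le_smul hδ hb
    refine cuntzLE_of_le_smul (K := 4 / δ + 9 * K) (add_nonneg hb₁0 hc0) (by positivity) ?_
    calc (1 - e₁) * f * (1 - e₁) + c
        ≤ ((2 : ℝ) • ((2 / δ) • b) + (2 : ℝ) • ((4 : ℝ) • (K • b))) + K • b := by
          refine add_le_add (h1.trans (add_le_add ?_ ?_)) (hcc₀.trans hc₀K)
          · exact smul_le_smul_of_nonneg_left h8 zero_le_two
          · exact smul_le_smul_of_nonneg_left
              (he4.trans (smul_le_smul_of_nonneg_left hc₀K (by norm_num))) zero_le_two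
      _ = (4 / δ + 9 * K) • b := by module
  · have h1 := re_conj_one_sub_ge hτ he0 hf0 hf1
    have h2 := re_mono (τ := τ) he4
    have h3 : (τ ((4 : ℝ) • c₀)).re = 4 * (τ c₀).re := by
      rw [← Complex.coe_smul, map_smul, smul_eq_mul, Complex.re_ofReal_mul]
    have h4 := hτc₀ τ hτ
    linarith

/-- Up to the commutator, `g` is block diagonal for `p`, and the block `(1 - p) g (1 - p)` is at
most `1 - p`. -/
theorem le_compress_add {p g : A} (hp : IsStarProjection p) (hg0 : 0 ≤ g) (hg1 : g ≤ 1) {θ : ℝ}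
    (h : ‖p * g - g * p‖ ≤ θ) : g ≤ p * g * p + (1 - p) + (2 * θ) • (1 : A) := by
  have hgs : star g = g := IsSelfAdjoint.of_nonneg hg0
  have hps := hp.isSelfAdjoint.star_eq
  have hpp := hp.isIdempotentElem.eq
  have hp' := hp.one_sub
  have hn := norm_le_one_of_isStarProjection hp'
  have h1 : ‖g - (p * g * p + (1 - p) * g * (1 - p))‖ ≤ 2 * θ := by
    have e : g - (p * g * p + (1 - p) * g * (1 - p))
        = (p * g - g * p) * (1 - p) + star ((p * g - g * p) * (1 - p)) := by
      have e1 : p * (1 - p) = 0 := by rw [mul_sub, mul_one, hpp, sub_self]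
      have e2 : (1 - p) * p = 0 := by rw [sub_mul, one_mul, hpp, sub_self]
      have e3 : (p * g - g * p) * (1 - p) = p * g * (1 - p) := by
        rw [sub_mul, mul_assoc g, e1, mul_zero, sub_zero]
      rw [e3, star_mul, star_mul, star_sub, star_one, hps, hgs]
      noncomm_ring
    have h2 : ‖(p * g - g * p) * (1 - p)‖ ≤ θ :=
      (norm_mul_le _ _).trans ((mul_le_of_le_one_right (norm_nonneg _) hn).trans h)
    rw [e]
    refine (norm_add_le _ _).trans ?_
    rw [norm_star]
    linarith
  have hpg := star_left_conjugate_nonneg hg0 p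
  have hpg' := star_left_conjugate_nonneg hg0 (1 - p)
  have hle := star_left_conjugate_le_conjugate hg1 (1 - p)
  rw [hps] at hpg
  rw [hp'.isSelfAdjoint.star_eq] at hpg' hle
  rw [mul_one, hp'.isIdempotentElem.eq] at hle
  refine (le_add_smul_one_of_norm_sub_le (IsSelfAdjoint.of_nonneg hg0)
    (IsSelfAdjoint.of_nonneg (add_nonneg hpg hpg')) h1).trans ?_
  gcongr

theorem exists_cuntzLE_of_trace_gap [Nontrivial A] (hA : InClassC1 A) {g b c : A} (hg0 : 0 ≤ g)
    (hg1 : g ≤ 1) (hb0 : 0 ≤ b) (hb1 : b ≤ 1) (hc0 : 0 ≤ c) (hc : c ≠ 0) (hbc : b * c = 0)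
    {η : ℝ} (hη : 0 < η) (hη1 : η ≤ 1)
    (hgap : ∀ τ ∈ tracialStates A, (τ g).re + η ≤ (τ b).re) :
    CuntzLE (cfc (fun t : ℝ => max (t - (1 - η / 64)) 0) g) (b + c) := by
  classical
  obtain ⟨F, θ₀, hθ₀, htrans⟩ := exists_trace_transfer hη hgap
  obtain ⟨θ, hθ, hθ1, hθ2⟩ : ∃ θ : ℝ, 0 < θ ∧ 5 * θ ≤ θ₀ ∧ 1000 * θ ≤ η :=
    ⟨min (θ₀ / 5) (η / 1000), by positivity, by
      have := min_le_left (θ₀ / 5) (η / 1000); linarith, by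
      have := min_le_right (θ₀ / 5) (η / 1000); linarith⟩
  obtain ⟨p, C, d, X, _, _, _, _, r, P, hP, φ, q, hp, hC, hqp, hq, hX, hcomm, hdist, hpos, hrank,
    hle⟩ := hA.exists_corner (F ∪ {CFC.sqrt g, CFC.sqrt b, g}) hθ (η := η / 4) (by positivity)
      hc0 hc
  have hsqrt : ∀ x : A, x ≤ 1 → 0 ≤ x → ‖CFC.sqrt x‖ ≤ 1 := fun x h1 h0 => by
    rw [CFC.norm_sqrt x h0]
    exact Real.sqrt_le_one.2 ((CStarAlgebra.norm_le_one_iff_of_nonneg x h0).2 h1)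
  obtain ⟨cg, hcg1, hcg⟩ := exists_star_mul_self_near hp
    (IsSelfAdjoint.of_nonneg (CFC.sqrt_nonneg g)) (hsqrt g hg1 hg0) (hcomm _ (by simp))
    (hdist _ (by simp))
  obtain ⟨cb, hcb1, hcb⟩ := exists_star_mul_self_near hp
    (IsSelfAdjoint.of_nonneg (CFC.sqrt_nonneg b)) (hsqrt b hb1 hb0) (hcomm _ (by simp))
    (hdist _ (by simp))
  rw [CFC.sqrt_mul_sqrt_self g] at hcg
  rw [CFC.sqrt_mul_sqrt_self b] at hcb
  have hft : ∀ x, (fiberTrace φ x (star cg * cg)).re + η / 2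
      ≤ (fiberTrace φ x (star cb * cb)).re := fun x =>
    htrans p C (fiberTrace φ x) q hp hqp (fiberTrace_unit φ (hpos x) hq)
      (fiberTrace_mul_comm φ x) (norm_fiberTrace_le φ hC (hpos x))
      (fun c => fiberTrace_star_mul_self_nonneg φ c (hpos x))
      (fun x hx => (hcomm x (by simp [hx])).trans_le (by linarith))
      (fun x hx => (hdist x (by simp [hx])).trans_le (by linarith)) _ _
      (hcg.trans hθ1) (hcb.trans hθ1)
  -- Of the fiber gap `η/2`, one `η/8` pays for dividing by `1 - η/32`, one for the term `(d +
  -- 1)/rank P`, and one for `δ`.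
  obtain ⟨y, hqy, hy⟩ := exists_comparison_of_fiberTrace φ hC hX hq hpos (c := cg) (c' := cb) hcb1
    (θ := 1 - η / 32) (δ := η / 8) (ε := η / 128) (by linarith) (by positivity) (by positivity)
    (fun x => by
      have h1 := hft x
      have h2 := (hrank x).le
      set t := (fiberTrace φ x (star cg * cg)).re with ht
      have h3 : t ≤ 2 := by
        have h4 := norm_fiberTrace_le φ hC (hpos x) (star cg * cg)
        have h5 : ‖((star cg * cg : C) : A)‖ ≤ 1 := by
          change ‖star (cg : A) * cg‖ ≤ 1
          rw [CStarRing.norm_star_mul_self]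
          exact mul_le_one₀ hcg1 (norm_nonneg _) hcg1
        have h6 := Complex.re_le_norm (fiberTrace φ x (star cg * cg))
        linarith
      have h0 : 0 ≤ t :=
        (Complex.le_def.1 (fiberTrace_star_mul_self_nonneg φ cg (hpos x))).1
      have h7 : t / (1 - η / 32) ≤ t + η / 8 := by
        rw [div_le_iff₀ (by linarith)]
        nlinarith [mul_nonneg h0 hη.le]
      linarith)
  rw [hqp] at hqy hy
  have hps := hp.isSelfAdjoint.star_eq
  have hyp : star y * p = star y := by
    have := congrArg star hqy
    rwa [star_mul, hps] at this
  have hpgp : 0 ≤ p * g * p := by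
    have := star_left_conjugate_nonneg hg0 p
    rwa [hps] at this
  have hpbp : 0 ≤ p * b * p := by
    have := star_left_conjugate_nonneg hb0 p
    rwa [hps] at this
  have h1 : star (cb : A) * cb ≤ p * b * p + (5 * θ) • (1 : A) :=
    le_add_smul_one_of_norm_sub_le (.star_mul_self _) (.of_nonneg hpbp)
      (by rw [norm_sub_rev]; exact hcb)
  have h2 : p * g * p ≤ star (cg : A) * cg + (5 * θ) • (1 : A) :=
    le_add_smul_one_of_norm_sub_le (.of_nonneg hpgp) (.star_mul_self _) hcg
  have h3 : star y * (star (cb : A) * cb - (η / 8 / 2) • p) * y ≤ star y * b * y := by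
    have e1 : star y * (star (cb : A) * cb - (η / 8 / 2) • p) * y
        = star y * (star (cb : A) * cb - (η / 8 / 2) • (1 : A)) * y := by
      rw [mul_sub, mul_sub, mul_smul_comm, mul_smul_comm, hyp, mul_one]
    have e2 : star y * b * y = star y * (p * b * p) * y := by
      calc star y * b * y = (star y * p) * b * (p * y) := by rw [hyp, hqy]
        _ = _ := by noncomm_ring
    rw [e1, e2]
    refine star_left_conjugate_le_conjugate ?_ y
    rw [sub_le_iff_le_add]
    refine h1.trans ?_
    gcongr
    linarith
  have h4 : star (cg : A) * cg ≤ star y * b * y + (1 - η / 32 + η / 128) • (1 : A) := by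
    have h5 := sub_le_iff_le_add.1 (hy.trans h3)
    refine h5.trans ?_
    gcongr
    · linarith
    · exact sub_nonneg.1 hp.one_sub.nonneg
  have h6 := le_compress_add hp hg0 hg1 (hcomm g (by simp)).le
  -- The total is `1 - η/32 + η/128 + 7θ`; as `1000 θ ≤ η`, the errors fit below `1 - η/64`.
  have h7 : g ≤ (star y * b * y + (1 - p)) + algebraMap ℝ A (1 - η / 64) := by
    rw [Algebra.algebraMap_eq_smul_one]
    calc g ≤ p * g * p + (1 - p) + (2 * θ) • (1 : A) := h6
      _ ≤ ((star y * b * y + (1 - η / 32 + η / 128) • (1 : A)) + (5 * θ) • (1 : A)) + (1 - p)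
          + (2 * θ) • (1 : A) := by
        gcongr
        exact h2.trans (by gcongr)
      _ = (star y * b * y + (1 - p)) + (1 - η / 32 + η / 128 + 7 * θ) • (1 : A) := by module
      _ ≤ _ := by
        gcongr
        linarith
  exact (cuntzLE_of_le_add hg0 h7).trans
    (CuntzLE.add_of_mul_eq_zero hb0 hc0 hbc (cuntzLE_conj y b) hle)

/-- Wherever `(t - ε)_+` is nonzero, `cutoff ε` equals `1`, so the right-hand function equals `γ`
there. -/
theorem cuntzLE_cfc_cutoff [Nontrivial A] {a : A} (ha : 0 ≤ a) {ε γ : ℝ} (hε : 0 < ε) (hγ : 0 < γ) :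
    CuntzLE (cfc (fun t : ℝ => max (t - ε) 0) a)
      (cfc (fun t : ℝ => max (t - (1 - γ)) 0) (cfc (cutoff ε) a)) := by
  have hcut := cutoff_continuous ε
  rw [← cfc_comp' (fun t : ℝ => max (t - (1 - γ)) 0) (cutoff ε) a (by fun_prop) (by fun_prop)]
  refine cuntzLE_of_le_smul (K := ‖a‖ / γ) (cfc_nonneg fun t _ => le_max_right _ _)
    (by positivity) ?_
  rw [← cfc_smul (‖a‖ / γ) _ a (by fun_prop)]
  refine cfc_mono (fun t ht => ?_) (by fun_prop) (by fun_prop)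
  rw [smul_eq_mul]
  refine max_le ?_ (by positivity)
  rcases le_total t ε with h | h
  · exact (sub_nonpos.2 h).trans (by positivity)
  · have h1 : cutoff ε t = 1 := by
      unfold cutoff
      have : 1 ≤ 2 * t / ε - 1 := by
        rw [le_sub_iff_add_le, le_div_iff₀ hε]; linarith
      rw [min_eq_left this, max_eq_right zero_le_one]
    rw [h1, sub_sub_cancel, max_eq_left hγ.le, div_mul_cancel₀ _ hγ.ne']
    have h2 : t ≤ ‖a‖ := (le_abs_self t).trans (spectrum.norm_le_norm_of_mem ht)
    linarith

end MainTheorem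

theorem mainTheorem7 {A : Type*} [CStarAlgebra A] [PartialOrder A] [StarOrderedRing A]
    (hsimple : IsSimpleCStar A) (hA : InClassC1 A) (a b : A) (ha : 0 ≤ a) (hb : 0 ≤ b)
    (hab : ∀ τ ∈ tracialStates A, dimFun τ a < dimFun τ b) :
    CuntzLE a b := by
  have : Nontrivial A := hsimple.1
  refine cuntzLE_of_forall_approx fun ε hε => ⟨cfc (fun t : ℝ => max (t - ε / 2) 0) a,
    (norm_cfc_max_sub_sub_le ha (half_pos hε).le).trans_lt (half_lt_self hε), ?_⟩
  have hε2 := half_pos hε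
  set g := cfc (cutoff (ε / 2)) a with hg
  have hg0 : 0 ≤ g := cfc_cutoff_nonneg _ _
  obtain ⟨δ, hδ, η₀, hη₀, hgap₀⟩ := exists_uniform_gap (g := g) hb fun τ hτ =>
    (re_cfc_cutoff_le_dimFun hτ ha hε2).trans_lt (hab τ hτ)
  -- One `η` is spent on splitting off `c`, the other remains as the gap for `b₁`.
  obtain ⟨η, hη, hη1, hgap⟩ : ∃ η : ℝ, 0 < η ∧ η ≤ 1 ∧ ∀ τ ∈ tracialStates A,
      (τ g).re + 2 * η ≤ (τ (cfc (cutoff δ) b)).re :=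
    ⟨min (η₀ / 2) 1, by positivity, min_le_right _ _, fun τ hτ => by
      have h1 := hgap₀ τ hτ
      have h2 := min_le_left (η₀ / 2) 1
      linarith⟩
  -- The gap forces `b ≠ 0` only once a tracial state is known to exist.
  have hb0 : b ≠ 0 := by
    rintro rfl
    obtain ⟨τ, hτ⟩ := hA.tracialStates_nonempty
    have h1 := hgap τ hτ
    have h2 := re_nonneg (τ := τ) hg0
    have h3 : cfc (cutoff δ) (0 : A) = 0 := by
      rw [cfc_apply_zero]
      simp [cutoff]
    rw [h3, map_zero, Complex.zero_re] at h1
    linarith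
  obtain ⟨b₁, c, hb₁0, hb₁1, hc0, hc, hbc, hle, hτ⟩ :=
    exists_orthogonal_splitting hsimple hA hb hb0 hδ hη
  have h1 := exists_cuntzLE_of_trace_gap hA hg0 (cfc_cutoff_le_one _ _) hb₁0 hb₁1 hc0 hc hbc hη hη1
    fun τ hτ' => by
      have h2 := hgap τ hτ'
      have h3 := hτ τ hτ'
      linarith
  exact ((cuntzLE_cfc_cutoff ha hε2 (by positivity)).trans h1).trans hle
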